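/- **Theorem 11.2 (Main Theorem).** Suppose that: 1. $\lambda$ is an infinite cardinal such that $\diamondsuit(\lambda^+)$ holds; 2. $\mathfrak s=(\mathbf K,\mathrm{dnf},S^{bs})$ is a pre-$\lambda$-frame satisfying amalgamation, no maximal model, density, transitivity, existence, and continuity; 3. $\mathbf K_{\lambda^+}$ satisfies amalgamation and stability. Then the class of uniqueness triples is dense among the basic triples: for every basic triple $(A,B,b)$ there is a uniqueness triple $(C,D,b)$ such that $(A,B,b)\le_{bs}(C,D,b)$. (No extension, uniqueness, stability, symmetry, or local character property of $\mathfrak s$ is assumed.) Here the notions are as follows. *Diamond.* $\diamondsuit(\kappa)$: there are sets $S_\alpha\subseteq\alpha$ ($\alpha<\kappa$) such that for every $X\subseteq\kappa$ the set $\{\alpha<\kappa : X\cap\alpha=S_\alpha\}$ is stationary in $\kappa$. *AEC.* $\mathbf K$ is an abstract elementary class in a fixed vocabulary $\tau$: a class of $\tau$-structures with a reflexive transitive relation $\le_{\mathbf K}$ on it refining the substructure relation, such that: both are invariant under isomorphism; if $\langle A_\alpha\mid\alpha<\delta\rangle$, $\delta>0$, is $\le_{\mathbf K}$-increasing, then its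 union is in $\mathbf K$ and every $A_\beta$ is $\le_{\mathbf K}$ the union; if in addition the sequence is continuous and all $A_\alpha\le_{\mathbf K}N\in\mathbf K$, then the union is $\le_{\mathbf K}N$; if $A\subseteq B\subseteq C$ are in $\mathbf K$, $A\le_{\mathbf K}C$ and $B\le_{\mathbf K}C$, then $A\le_{\mathbf K}B$; and there is a least infinite cardinal $\kappa=\mathrm{LST}(\mathbf K)\ge|\tau|$ such that for every $N\in\mathbf K$ each subset $Z$ of $N$ is contained in some $M\le_{\mathbf K}N$ with $|M|\le\max\{\kappa,|Z|\}$. $\mathbf K_\mu$ is the class of models in $\mathbf K$ of cardinality $\mu$, and $A<_{\mathbf K}B$ means $A\le_{\mathbf K}B$ and $A\ne B$. An embedding $f:A\to B$ is an isomorphism of $A$ onto some $f[A]\le_{\mathbf K}B$. *Amalgamation, no maximal model.* For embeddings $g_B:A\to B$ and $g_C:A\to C$, an amalgamation of $B$ and $C$ over $(A,g_B,g_C)$ is a triple $(f_B,f_C,D)$ with $D\in\mathbf K$ and $f_B:B\to D$, $f_C:C\to D$ embeddings such that $f_B\circ g_B=f_C\circ g_C$; it is over $A$ if $g_B=g_C=\mathrm{id}_A$,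 and it is a $\lambda$-amalgamation if $D\in\mathbf K_\lambda$. $\mathbf K_\mu$ has amalgamation if for all $A\le_{\mathbf K}B,C$ in $\mathbf K_\mu$ there is an amalgamation of $B$ and $C$ over $A$ with $D\in\mathbf K_\mu$; it has no maximal model if each $A\in\mathbf K_\mu$ has some $B\in\mathbf K_\mu$ with $A<_{\mathbf K}B$. These two properties of $\mathfrak s$ are those of $\mathbf K_\lambda$. *Types.* For $A\le_{\mathbf K}B$, $A\le_{\mathbf K}C$, $b\in B$, $c\in C$, call $(A,B,b)$ and $(A,C,c)$ atomically equivalent if there is an amalgamation $(f_B,f_C,D)$ of $B$ and $C$ over $A$ with $f_B(b)=f_C(c)$; the (Galois) type $\mathrm{tp}(b/A;B)$ is the class of $(A,B,b)$ under the equivalence relation generated by this. $S(A)$ is the collection of types over $A$, $S^{na}(A)$ that of the types $\mathrm{tp}(b/A;B)$ with $b\notin A$, and $\mathrm{tp}(b/B;C)\restriction A=\mathrm{tp}(b/A;C)$ for $A\le_{\mathbf K}B$. $\mathbf K_\mu$ is stable if $|S^{na}(M)|\le\mu$ for all $M\in\mathbf K_\mu$. *Pre-$\lambda$-frame.* $\mathbf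 K$ is an AEC with $\lambda\ge\mathrm{LST}(\mathbf K)$ and $\mathbf K_\lambda\neq\emptyset$; $S^{bs}$ assigns to each $A\in\mathbf K_\lambda$ a set $S^{bs}(A)\subseteq S^{na}(A)$ of basic types; $\mathrm{dnf}$ is a relation on quadruples $(A,B,c,C)$ with $A,B,C\in\mathbf K_\lambda$, $A\le_{\mathbf K}B<_{\mathbf K}C$, $c\in C\setminus B$; $\mathrm{dnf}$ and $S^{bs}$ are invariant under isomorphisms; if $A\le_{\mathbf K}A'\le_{\mathbf K}B'\le_{\mathbf K}B<_{\mathbf K}C'\le_{\mathbf K}C\le_{\mathbf K}C''$ are in $\mathbf K_\lambda$, $c\in C'\setminus B$ and $\mathrm{dnf}(A,B,c,C)$, then $\mathrm{dnf}(A',B',c,C')$ and $\mathrm{dnf}(A',B',c,C'')$; and $\mathrm{dnf}(A,A,c,C)$ implies $\mathrm{tp}(c/A;C)\in S^{bs}(A)$. A type $p\in S(B)$ does not fork over $A\le_{\mathbf K}B$ (with $A,B\in\mathbf K_\lambda$) if $p=\mathrm{tp}(c/B;C)$ for some $c,C$ with $\mathrm{dnf}(A,B,c,C)$. *Properties of $\mathfrak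 s$.* Density: if $A<_{\mathbf K}B$ are in $\mathbf K_\lambda$, then $\mathrm{tp}(b/A;B)\in S^{bs}(A)$ for some $b\in B\setminus A$. Transitivity: if $A\le_{\mathbf K}B\le_{\mathbf K}C$ are in $\mathbf K_\lambda$ and $p\in S(C)$ does not fork over $B$ and $p\restriction B$ does not fork over $A$, then $p$ does not fork over $A$. Existence: for $A\in\mathbf K_\lambda$ every $p\in S^{bs}(A)$ does not fork over $A$. Continuity: for every nonzero limit ordinal $\delta<\lambda^+$, every $\le_{\mathbf K}$-increasing continuous sequence $\langle A_\alpha\mid\alpha\le\delta\rangle$ in $\mathbf K_\lambda$ and every $p\in S(A_\delta)$, if $p\restriction A_\alpha$ does not fork over $A_0$ for all $\alpha<\delta$, then $p\in S^{bs}(A_\delta)$ and $p$ does not fork over $A_0$. *Triples.* $(A,B,b)$ is a basic triple if $A,B\in\mathbf K_\lambda$, $A<_{\mathbf K}B$, $b\in B\setminus A$ and $\mathrm{tp}(b/A;B)\in S^{bs}(A)$. For basic triples, $(A,B,b)\le_{bs}(C,D,d)$ if $A\le_{\mathbf K}C$, $B\le_{\mathbf K}D$, $b=d$ and $\mathrm{tp}(b/C;D)$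 does not fork over $A$. Two amalgamations $(f^D_B,f^D_C,D)$, $(f^F_B,f^F_C,F)$ of $B$ and $C$ over $A$ are equivalent if there are $G\in\mathbf K$ and embeddings $h_D:D\to G$, $h_F:F\to G$ with $h_D\circ f^D_B=h_F\circ f^F_B$ and $h_D\circ f^D_C=h_F\circ f^F_C$. A basic triple $(A,B,b)$ is a uniqueness triple if there are no $C\in\mathbf K_\lambda$ with $A<_{\mathbf K}C$ and two non-equivalent $\lambda$-amalgamations $(f^D_B,\mathrm{id}_C,D)$, $(f^F_B,\mathrm{id}_C,F)$ of $B$ and $C$ over $A$ such that $\mathrm{tp}(f^D_B(b)/C;D)=\mathrm{tp}(f^F_B(b)/C;F)$ and this type does not fork over $A$. -/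

import Mathlib

open Cardinal FirstOrder

universe u

/-! ### The diamond principle -/

/-- `◇(κ)`: there are sets `S α ⊆ α` (`α < κ`) such that every `X ⊆ κ` satisfies `X ∩ α = S α`
for stationarily many `α < κ`.  Ordinals below `κ` form the linear order `Set.Iio κ.ord`. -/
def Diamond (κ : Cardinal.{u}) : Prop :=
  ∃ S : Set.Iio κ.ord → Set (Set.Iio κ.ord),
    (∀ α, S α ⊆ Set.Iio α) ∧
      ∀ X : Set (Set.Iio κ.ord), IsStationary {α | X ∩ Set.Iio α = S α}

/-! ### Abstract elementary classes -/

/-- A class of `L`-structures together with a strong-submodel relation.  As usual in type theory,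
"`A` is a strong submodel of `M`" is a property of a substructure `A` of `M`. -/
structure ModelClass (L : FirstOrder.Language.{u, u}) where
  /-- `Mem M`: the structure `M` belongs to the class. -/
  Mem : ∀ (M : Type u) [L.Structure M], Prop
  /-- `Strong M A`: the substructure `A` is a strong submodel of `M`. -/
  Strong : ∀ (M : Type u) [L.Structure M], L.Substructure M → Prop

namespace ModelClass

variable {L : FirstOrder.Language.{u, u}} (K : ModelClass L)

/-- `A ≤_K B` for two substructures `A`, `B` of a common (arbitrary) structure. -/
def Le {M : Type u} [L.Structure M] (A B : L.Substructure M) : Prop :=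
  A ≤ B ∧ K.Strong B (A.comap B.subtype.toHom)

/-- `⟨A α | α < δ⟩` is a `≤_K`-increasing sequence of members of the class (all of them being
substructures of a common structure); values `A α` with `δ ≤ α` are irrelevant. -/
def IncreasingChain {M : Type u} [L.Structure M] (δ : Ordinal.{u})
    (A : Ordinal.{u} → L.Substructure M) : Prop :=
  (∀ α < δ, K.Mem (A α)) ∧ ∀ α β, α ≤ β → β < δ → K.Le (A α) (A β)

/-- `⟨A α | α < δ⟩` is continuous: at nonzero limit stages `γ < δ` it takes unions. -/
def ContinuousChain {M : Type u} [L.Structure M] (δ : Ordinal.{u})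
    (A : Ordinal.{u} → L.Substructure M) : Prop :=
  ∀ γ < δ, Order.IsSuccLimit γ → ∀ x, x ∈ A γ ↔ ∃ α < γ, x ∈ A α

/-- The substructure `U` is the union of `⟨A α | α < δ⟩`. -/
def IsUnion {M : Type u} [L.Structure M] (δ : Ordinal.{u})
    (A : Ordinal.{u} → L.Substructure M) (U : L.Substructure M) : Prop :=
  ∀ x, x ∈ U ↔ ∃ α < δ, x ∈ A α

/-- The infinite cardinal `κ` is at least the size of the vocabulary, and every subset `Z` of a
model `N` of the class is contained in a strong submodel of `N` of size at most `max κ |Z|`. -/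
def HasLST (κ : Cardinal.{u}) : Prop :=
  ℵ₀ ≤ κ ∧ L.card ≤ κ ∧
    ∀ (N : Type u) [L.Structure N], K.Mem N → ∀ Z : Set N,
      ∃ M : L.Substructure N, K.Strong N M ∧ Z ⊆ (M : Set N) ∧ #M ≤ max κ #Z

end ModelClass

/-- Abstract elementary classes in the vocabulary `L`. -/
structure AEC (L : FirstOrder.Language.{u, u}) extends ModelClass L where
  /-- The relation `≤_K` is a relation on the class. -/
  mem_of_strong : ∀ {M : Type u} [L.Structure M] {A : L.Substructure M},
    Strong M A → Mem M ∧ Mem A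
  /-- The class is closed under isomorphism. -/
  mem_iso : ∀ {M N : Type u} [L.Structure M] [L.Structure N], (M ≃[L] N) → Mem M → Mem N
  /-- The relation `≤_K` is invariant under isomorphism. -/
  strong_iso : ∀ {M N : Type u} [L.Structure M] [L.Structure N] (φ : M ≃[L] N)
    {A : L.Substructure M}, Strong M A → Strong N (A.map φ.toHom)
  /-- Reflexivity. -/
  strong_refl : ∀ {M : Type u} [L.Structure M], Mem M → Strong M ⊤
  /-- Transitivity. -/
  strong_trans : ∀ {M : Type u} [L.Structure M] {A B : L.Substructure M},
    toModelClass.Le A B → Strong M B → Strong M A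
  /-- Unions of increasing chains of length `δ > 0`: every structure that is the union of such a
  chain is in the class, and all members of the chain are strong submodels of it. -/
  chain : ∀ {M : Type u} [L.Structure M] (δ : Ordinal.{u}) (A : Ordinal.{u} → L.Substructure M),
    0 < δ → toModelClass.IncreasingChain δ A → ModelClass.IsUnion δ A ⊤ →
      Mem M ∧ ∀ β < δ, Strong M (A β)
  /-- Smoothness. -/
  smooth : ∀ {N : Type u} [L.Structure N] (δ : Ordinal.{u}) (A : Ordinal.{u} → L.Substructure N)
    (U : L.Substructure N), 0 < δ → Mem N → toModelClass.IncreasingChain δ A →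
      ModelClass.ContinuousChain δ A → ModelClass.IsUnion δ A U →
      (∀ α < δ, Strong N (A α)) → Strong N U
  /-- Coherence. -/
  coherence : ∀ {C : Type u} [L.Structure C] {A B : L.Substructure C},
    A ≤ B → Strong C A → Strong C B → toModelClass.Le A B
  /-- Existence of a Löwenheim–Skolem–Tarski number. -/
  exists_lst : ∃ κ, toModelClass.HasLST κ

namespace AEC

variable {L : FirstOrder.Language.{u, u}} (K : AEC L)

/-- The Löwenheim–Skolem–Tarski number: the least cardinal with the property `HasLST`. -/
noncomputable def LST : Cardinal.{u} := sInf {κ | K.HasLST κ}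

/-- `M ∈ K_μ`. -/
def MemCard (μ : Cardinal.{u}) (M : Type u) [L.Structure M] : Prop :=
  K.Mem M ∧ #M = μ

/-- `K`-embeddings: embeddings whose image is a strong submodel of the target. -/
def IsEmb {M N : Type u} [L.Structure M] [L.Structure N] (f : M ↪[L] N) : Prop :=
  K.Strong N f.toHom.range

variable {K}

theorem isEmb_subtype {M : Type u} [L.Structure M] {A : L.Substructure M}
    (h : K.Strong M A) : K.IsEmb A.subtype := by
  unfold IsEmb
  rwa [FirstOrder.Language.Substructure.range_subtype]

theorem IsEmb.comp {A B C : Type u} [L.Structure A] [L.Structure B] [L.Structure C]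
    {g : B ↪[L] C} {f : A ↪[L] B} (hg : K.IsEmb g) (hf : K.IsEmb f) :
    K.IsEmb (g.comp f) := by
  refine K.strong_trans (B := g.toHom.range) ⟨?_, ?_⟩ hg
  · rintro _ ⟨a, rfl⟩
    exact ⟨f a, rfl⟩
  · have h := K.strong_iso g.equivRange hf
    convert h using 1
    ext ⟨x, hx⟩
    simp only [FirstOrder.Language.Substructure.mem_comap, FirstOrder.Language.Substructure.mem_map]
    constructor
    · rintro ⟨a, ha⟩
      exact ⟨f a, ⟨a, rfl⟩, Subtype.ext ha⟩
    · rintro ⟨_, ⟨a, rfl⟩, ha⟩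
      exact ⟨a, congrArg Subtype.val ha⟩

variable (K)

/-! ### Galois types -/

/-- A model `B` of the class extending (via a `K`-embedding) `A`, with a distinguished point. -/
structure PointedExt (A : Type u) [L.Structure A] where
  carrier : Type u
  [str : L.Structure carrier]
  emb : A ↪[L] carrier
  isEmb : K.IsEmb emb
  pt : carrier

attribute [instance] PointedExt.str

/-- Two pointed extensions of `A` are atomically equivalent if they can be amalgamated over `A`
in such a way that the distinguished points are identified. -/
def AtEquiv {A : Type u} [L.Structure A] (p q : K.PointedExt A) : Prop :=
  ∃ (D : Type u) (_ : L.Structure D) (f : p.carrier ↪[L] D) (g : q.carrier ↪[L] D),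
    K.IsEmb f ∧ K.IsEmb g ∧ (∀ a, f (p.emb a) = g (q.emb a)) ∧ f p.pt = g q.pt

/-- `S(A)`: the Galois types over `A`, i.e. the classes of the equivalence relation generated by
atomic equivalence. -/
def GaloisType (A : Type u) [L.Structure A] : Type (u + 1) :=
  Quot (K.AtEquiv (A := A))

variable {K}

/-- The type `tp(b/A; B)`, where `B` is an extension of `A` via the `K`-embedding `f`. -/
def tpEmb {A B : Type u} [L.Structure A] [L.Structure B] (f : A ↪[L] B) (hf : K.IsEmb f)
    (b : B) : K.GaloisType A :=
  Quot.mk _ ⟨B, f, hf, b⟩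

/-- The type `tp(b/A; B)` for a strong submodel `A` of `B`. -/
def tp {B : Type u} [L.Structure B] (A : L.Substructure B) (hA : K.Strong B A) (b : B) :
    K.GaloisType A :=
  tpEmb A.subtype (isEmb_subtype hA) b

/-- The restriction of a type along a `K`-embedding. -/
def restrictEmb {A B : Type u} [L.Structure A] [L.Structure B] (f : A ↪[L] B) (hf : K.IsEmb f) :
    K.GaloisType B → K.GaloisType A :=
  Quot.map (fun e => ⟨e.carrier, e.emb.comp f, e.isEmb.comp hf, e.pt⟩) (by
    rintro p q ⟨D, iD, g, h, hg, hh, hgh, hpt⟩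
    exact ⟨D, iD, g, h, hg, hh, fun a => hgh (f a), hpt⟩)

/-- The restriction `p ↾ A` of a type `p ∈ S(B)` to a strong submodel `A` of `B`. -/
def restrict {B : Type u} [L.Structure B] (p : K.GaloisType B) (A : L.Substructure B)
    (hA : K.Strong B A) : K.GaloisType A :=
  restrictEmb A.subtype (isEmb_subtype hA) p

variable (K)

/-- `S^na(A)`: the non-algebraic types over `A`, i.e. the types `tp(b/A; B)` with `b ∉ A`. -/
def na (A : Type u) [L.Structure A] : Set (K.GaloisType A) :=
  {p | ∃ (B : Type u) (_ : L.Structure B) (f : A ↪[L] B) (hf : K.IsEmb f) (b : B),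
    b ∉ Set.range f ∧ p = tpEmb f hf b}

/-! ### Properties of `K_μ` -/

/-- `(fB, fC, D)` is an amalgamation of `B` and `C` over `(A, gB, gC)`. -/
def IsAmalgamation {A B C D : Type u} [L.Structure A] [L.Structure B] [L.Structure C]
    [L.Structure D] (gB : A ↪[L] B) (gC : A ↪[L] C) (fB : B ↪[L] D) (fC : C ↪[L] D) : Prop :=
  K.IsEmb fB ∧ K.IsEmb fC ∧ ∀ a, fB (gB a) = fC (gC a)

/-- The relation `E` between two amalgamations `(fBD, fCD, D)` and `(fBF, fCF, F)` of `B`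
and `C`. -/
def AmalgEquiv {B C D F : Type u} [L.Structure B] [L.Structure C] [L.Structure D]
    [L.Structure F] (fBD : B ↪[L] D) (fCD : C ↪[L] D) (fBF : B ↪[L] F) (fCF : C ↪[L] F) : Prop :=
  ∃ (G : Type u) (_ : L.Structure G) (fDG : D ↪[L] G) (fFG : F ↪[L] G),
    K.IsEmb fDG ∧ K.IsEmb fFG ∧ (∀ b, fDG (fBD b) = fFG (fBF b)) ∧
      ∀ c, fDG (fCD c) = fFG (fCF c)

/-- `K_μ` has the amalgamation property. -/
def Amalgamation (μ : Cardinal.{u}) : Prop :=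
  ∀ (A B C : Type u) [L.Structure A] [L.Structure B] [L.Structure C]
    (gB : A ↪[L] B) (gC : A ↪[L] C), K.MemCard μ A → K.MemCard μ B → K.MemCard μ C →
    K.IsEmb gB → K.IsEmb gC →
    ∃ (D : Type u) (_ : L.Structure D) (fB : B ↪[L] D) (fC : C ↪[L] D),
      K.MemCard μ D ∧ K.IsAmalgamation gB gC fB fC

/-- `K_μ` has no maximal model. -/
def NoMaximalModel (μ : Cardinal.{u}) : Prop :=
  ∀ (A : Type u) [L.Structure A], K.MemCard μ A →
    ∃ (B : Type u) (_ : L.Structure B) (f : A ↪[L] B),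
      K.MemCard μ B ∧ K.IsEmb f ∧ ¬ Function.Surjective f

/-- `K_μ` is stable: there are at most `μ` non-algebraic types over each of its models. -/
def Stable (μ : Cardinal.{u}) : Prop :=
  ∀ (M : Type u) [L.Structure M], K.MemCard μ M → #(K.na M) ≤ Cardinal.lift.{u + 1} μ

end AEC

/-! ### Pre-`λ`-frames -/

/-- The data of a pre-`λ`-frame: an AEC, a function `S^bs`, and a relation `dnf(A, B, c, C)`
between a model `C`, two substructures `A`, `B` of `C` and an element `c` of `C`. -/
structure FrameData (L : FirstOrder.Language.{u, u}) where
  K : AEC L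
  bs : ∀ (A : Type u) [L.Structure A], Set (K.GaloisType A)
  dnf : ∀ (C : Type u) [L.Structure C], L.Substructure C → L.Substructure C → C → Prop

/-- `dnf(A, B, c, C)` where `A`, `B`, `C` are substructures of a common structure `M` and `A`, `B`
are contained in `C`. -/
def FrameData.dnfIn {L : FirstOrder.Language.{u, u}} (s : FrameData L) {M : Type u} [L.Structure M]
    (A B : L.Substructure M) (c : M) (C : L.Substructure M) : Prop :=
  ∃ hc : c ∈ C, s.dnf C (A.comap C.subtype.toHom) (B.comap C.subtype.toHom) ⟨c, hc⟩

/-- Pre-`λ`-frames (`lam` stands for the cardinal `λ`). -/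
structure PreFrame (L : FirstOrder.Language.{u, u}) (lam : Cardinal.{u}) extends FrameData L where
  lst_le : K.LST ≤ lam
  nonempty : ∃ (M : Type u) (_ : L.Structure M), K.MemCard lam M
  /-- Basic types are non-algebraic. -/
  bs_subset_na : ∀ (A : Type u) [L.Structure A], K.MemCard lam A → bs A ⊆ K.na A
  /-- The domain of `dnf`: quadruples `(A, B, c, C)` of `A, B, C ∈ K_λ` with `A ≤_K B <_K C` and
  `c ∈ C \ B`. -/
  dnf_dom : ∀ {C : Type u} [L.Structure C] {A B : L.Substructure C} {c : C}, dnf C A B c →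
    K.MemCard lam A ∧ K.MemCard lam B ∧ K.MemCard lam C ∧ K.Le A B ∧ K.Strong C B ∧ c ∉ B
  /-- Invariance of `dnf` under isomorphisms. -/
  dnf_iso : ∀ {C C' : Type u} [L.Structure C] [L.Structure C'] (φ : C ≃[L] C')
    {A B : L.Substructure C} {c : C}, dnf C A B c →
    dnf C' (A.map φ.toHom) (B.map φ.toHom) (φ c)
  /-- Invariance of `S^bs` under isomorphisms `(ψ, φ)` between pairs of models `(B, C)` and
  `(B', C')`, where `C` extends `B` via `i` and `C'` extends `B'` via `i'`. -/
  bs_iso : ∀ {B C B' C' : Type u} [L.Structure B] [L.Structure C] [L.Structure B']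
    [L.Structure C'] (i : B ↪[L] C) (hi : K.IsEmb i) (i' : B' ↪[L] C') (hi' : K.IsEmb i')
    (ψ : B ≃[L] B') (φ : C ≃[L] C') (c : C),
    K.MemCard lam B → K.MemCard lam C → (∀ b, φ (i b) = i' (ψ b)) → c ∉ Set.range i →
    AEC.tpEmb i hi c ∈ bs B → AEC.tpEmb i' hi' (φ c) ∈ bs B'
  /-- Monotonicity. -/
  dnf_mono : ∀ {M : Type u} [L.Structure M] (A A' B' B C' C : L.Substructure M) (c : M),
    K.MemCard lam A → K.MemCard lam A' → K.MemCard lam B' → K.MemCard lam B →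
    K.MemCard lam C' → K.MemCard lam C → K.MemCard lam M →
    K.Le A A' → K.Le A' B' → K.Le B' B → K.Le B C' → K.Le C' C → K.Strong M C →
    c ∈ C' → c ∉ B →
    toFrameData.dnfIn A B c C → toFrameData.dnfIn A' B' c C' ∧ dnf M A' B' c
  /-- Non-forking types are basic. -/
  dnf_basic : ∀ {C : Type u} [L.Structure C] (A : L.Substructure C) (hA : K.Strong C A) (c : C),
    dnf C A A c → AEC.tp A hA c ∈ bs A

namespace PreFrame

variable {L : FirstOrder.Language.{u, u}} {lam : Cardinal.{u}} (s : PreFrame L lam)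

/-- The type `p ∈ S(B)` does not fork over the submodel `A` of `B`. -/
def DoesNotFork {B : Type u} [L.Structure B] (p : s.K.GaloisType B) (A : L.Substructure B) :
    Prop :=
  ∃ (C : Type u) (_ : L.Structure C) (i : B ↪[L] C) (hi : s.K.IsEmb i) (c : C),
    p = AEC.tpEmb i hi c ∧ s.dnf C (A.map i.toHom) i.toHom.range c

/-- Density of basic types. -/
def Density : Prop :=
  ∀ (B : Type u) [L.Structure B] (A : L.Substructure B) (hA : s.K.Strong B A),
    s.K.MemCard lam A → s.K.MemCard lam B → A ≠ ⊤ →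
    ∃ b : B, b ∉ A ∧ AEC.tp A hA b ∈ s.bs A

/-- Transitivity. -/
def Transitivity : Prop :=
  ∀ (C : Type u) [L.Structure C] (A B : L.Substructure C) (hB : s.K.Strong C B),
    s.K.MemCard lam A → s.K.MemCard lam B → s.K.MemCard lam C → s.K.Le A B →
    ∀ p : s.K.GaloisType C, s.DoesNotFork p B →
      s.DoesNotFork (AEC.restrict p B hB) (A.comap B.subtype.toHom) → s.DoesNotFork p A

/-- Existence: every basic type over `A` does not fork over `A`. -/
def Existence : Prop :=
  ∀ (A : Type u) [L.Structure A], s.K.MemCard lam A → ∀ p ∈ s.bs A, s.DoesNotFork p ⊤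

/-- Continuity.  The sequence `⟨A α | α ≤ δ⟩` consists of the substructures `A α` (`α < δ`) of
`C` and of their union `A δ = C`. -/
def Continuity : Prop :=
  ∀ (C : Type u) [L.Structure C] (δ : Ordinal.{u}) (A : Ordinal.{u} → L.Substructure C)
    (hA : ∀ α < δ, s.K.Strong C (A α)),
    Order.IsSuccLimit δ → δ < (Order.succ lam).ord → s.K.MemCard lam C →
    (∀ α < δ, s.K.MemCard lam (A α)) →
    s.K.IncreasingChain δ A → ModelClass.ContinuousChain δ A → ModelClass.IsUnion δ A ⊤ →
    ∀ p : s.K.GaloisType C,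
      (∀ (α : Ordinal.{u}) (hα : α < δ),
        s.DoesNotFork (AEC.restrict p (A α) (hA α hα)) ((A 0).comap (A α).subtype.toHom)) →
      p ∈ s.bs C ∧ s.DoesNotFork p (A 0)

/-- `(A, B, b)` is a basic triple. -/
def IsBasicTriple {B : Type u} [L.Structure B] (A : L.Substructure B) (b : B) : Prop :=
  s.K.MemCard lam A ∧ s.K.MemCard lam B ∧ b ∉ A ∧
    ∃ hA : s.K.Strong B A, AEC.tp A hA b ∈ s.bs A

/-- The relation `(A, B, b) ≤_bs (C, D, d)`, where `h` is the inclusion of `B` in `D` (that is,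
`B` is identified with a strong submodel of `D` via the `K`-embedding `h`). -/
def LeBs {B D : Type u} [L.Structure B] [L.Structure D] (h : B ↪[L] D) (A : L.Substructure B)
    (b : B) (C : L.Substructure D) (d : D) : Prop :=
  s.K.IsEmb h ∧ s.K.Le (A.map h.toHom) C ∧ h b = d ∧
    ∃ hC : s.K.Strong D C,
      s.DoesNotFork (AEC.tp C hC d) ((A.map h.toHom).comap C.subtype.toHom)

/-- `C`, extending `A` via `j`, witnesses the non-uniqueness of `(A, B, b)`: there are two
non-equivalent `λ`-amalgamations `(fBD, fCD, D)` and `(fBF, fCF, F)` of `B` and `C` over `A` in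
which `b` realizes the same type over `C`, and this type does not fork over `A`. -/
def WitnessesNonuniqueness {B C : Type u} [L.Structure B] [L.Structure C] (A : L.Substructure B)
    (b : B) (j : A ↪[L] C) : Prop :=
  s.K.MemCard lam C ∧ s.K.IsEmb j ∧ ¬ Function.Surjective j ∧
    ∃ (D : Type u) (_ : L.Structure D) (F : Type u) (_ : L.Structure F)
      (fBD : B ↪[L] D) (fCD : C ↪[L] D) (fBF : B ↪[L] F) (fCF : C ↪[L] F)
      (hD : s.K.IsEmb fCD) (hF : s.K.IsEmb fCF),
      s.K.MemCard lam D ∧ s.K.MemCard lam F ∧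
      s.K.IsAmalgamation A.subtype j fBD fCD ∧ s.K.IsAmalgamation A.subtype j fBF fCF ∧
      ¬ s.K.AmalgEquiv fBD fCD fBF fCF ∧
      AEC.tpEmb fCD hD (fBD b) = AEC.tpEmb fCF hF (fBF b) ∧
      s.DoesNotFork (AEC.tpEmb fCD hD (fBD b)) j.toHom.range

/-- `(A, B, b)` is a uniqueness triple. -/
def IsUniquenessTriple {B : Type u} [L.Structure B] (A : L.Substructure B) (b : B) : Prop :=
  s.IsBasicTriple A b ∧
    ¬ ∃ (C : Type u) (_ : L.Structure C) (j : A ↪[L] C), s.WitnessesNonuniqueness A b j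

end PreFrame

-- The uniqueness triple is found in two stages. Each argues by contradiction: if nothing above the
-- given triple is good enough, there is a binary tree of height λ⁺ of triples `(A_η, B_η, b)`, all
-- nonforking extensions of one triple with the same `b`, and this tree violates a property of
-- K_{λ⁺}. Transitivity keeps the type of `b` nonforking over the root at successor levels,
-- continuity does so at limit levels, and transitivity finally composes the two stages.
--
-- Stage one (`exists_uniqueExt`) makes nonforking extensions of the type of `b` unique. Otherwise
-- the type of `b` at every node has two different nonforking extensions over one larger model, and
-- amalgamation lets `b` itself realize each of them in an extension of `B_η`. If M in K_{λ⁺} is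
-- homogeneous over models in K_λ (`exists_homogeneous`), all bases can be chosen inside M.
-- Amalgamating M with the union of a branch turns the branch into a type over M
-- (`exists_type_of_branch`), and distinct branches give distinct types. There are 2^{λ⁺} branches
-- but only λ⁺ types over M, by stability.
--
-- Stage two (`exists_not_witnessesNonuniqueness`) starts from such a type. At each level the type
-- of `b` over the base no longer depends on the node, so all nodes of a level can share one base
-- `A_α`. If no triple above is a uniqueness triple, then at each level α one node of choice can be
-- given two successors over `A_{α+1}` that cannot be amalgamated over `A_{α+1}` and the model of
-- that node (`exists_incompatible_tree`). Let A be the union of the bases and N a universal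
-- extension of A in K_{λ⁺}; the union of every branch embeds in N over A. The diamond guesses
-- initial segments of a branch together with such an embedding, and the tree splits at the guessed
-- nodes. Let η turn right at δ exactly when the left successor of the guessed node embeds in N over
-- A by an extension of the guessed map. Where η and its embedding are guessed correctly, a right
-- turn makes the two successors compatible inside N, while a left turn makes the embedding of η
-- itself a reason to turn right.
--
-- All models live on subsets of a fixed set U. Inclusions between them are then literal, the trees
-- are families of elements of one type, and maps are functions U → U that the diamond can guess.

universe v w

/-! ### Embeddings in an abstract elementary class -/

namespace AEC

variable {L : FirstOrder.Language.{u, u}} {K : AEC L}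

theorem IsEmb.mem_right {M N : Type u} [L.Structure M] [L.Structure N] {f : M ↪[L] N}
    (hf : K.IsEmb f) : K.Mem N :=
  (K.mem_of_strong hf).1

theorem IsEmb.mem_left {M N : Type u} [L.Structure M] [L.Structure N] {f : M ↪[L] N}
    (hf : K.IsEmb f) : K.Mem M :=
  K.mem_iso f.equivRange.symm (K.mem_of_strong hf).2

theorem isEmb_equiv {M N : Type u} [L.Structure M] [L.Structure N] (φ : M ≃[L] N)
    (hM : K.Mem M) : K.IsEmb φ.toEmbedding := by
  unfold IsEmb
  rw [FirstOrder.Language.Equiv.toEmbedding_toHom, FirstOrder.Language.Equiv.toHom_range]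
  exact K.strong_refl (K.mem_iso φ hM)

theorem isEmb_refl {M : Type u} [L.Structure M] (hM : K.Mem M) :
    K.IsEmb (FirstOrder.Language.Embedding.refl L M) :=
  isEmb_equiv (FirstOrder.Language.Equiv.refl L M) hM

/-- The image of `K`-comparable models under an embedding into an arbitrary structure. -/
theorem le_range {M X Y : Type u} [L.Structure M] [L.Structure X] [L.Structure Y]
    {e : X ↪[L] M} {e' : Y ↪[L] M} {i : X ↪[L] Y} (hi : K.IsEmb i) (h : ∀ x, e' (i x) = e x) :
    K.Le e.toHom.range e'.toHom.range := by
  refine ⟨?_, ?_⟩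
  · rintro _ ⟨x, rfl⟩
    exact ⟨i x, h x⟩
  · have := K.strong_iso e'.equivRange hi
    convert this using 1
    ext ⟨y, hy⟩
    simp only [FirstOrder.Language.Substructure.mem_comap, FirstOrder.Language.Substructure.mem_map]
    constructor
    · rintro ⟨a, ha⟩
      exact ⟨i a, ⟨a, rfl⟩, Subtype.ext ((h a).trans ha)⟩
    · rintro ⟨_, ⟨a, rfl⟩, ha⟩
      exact ⟨a, (h a).symm.trans (congrArg Subtype.val ha)⟩

/-- `K`-comparability of ranges gives a `K`-embedding. -/
theorem isEmb_of_le_range {M X Y : Type u} [L.Structure M] [L.Structure X] [L.Structure Y]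
    {e : X ↪[L] M} {e' : Y ↪[L] M} (hle : K.Le e.toHom.range e'.toHom.range) :
    ∃ i : X ↪[L] Y, K.IsEmb i ∧ ∀ x, e' (i x) = e x := by
  have hmem : ∀ x, e x ∈ e'.toHom.range := fun x => hle.1 ⟨x, rfl⟩
  let c := e.codRestrict e'.toHom.range hmem
  refine ⟨e'.equivRange.symm.toEmbedding.comp c, ?_, ?_⟩
  · have hc : K.IsEmb c := by
      have := hle.2
      unfold IsEmb
      convert this using 1
      ext ⟨y, hy⟩
      simp only [FirstOrder.Language.Substructure.mem_comap]
      constructor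
      · rintro ⟨a, ha⟩
        exact ⟨a, congrArg Subtype.val ha⟩
      · rintro ⟨a, ha⟩
        exact ⟨a, Subtype.ext ha⟩
    exact (isEmb_equiv _ hc.mem_right).comp hc
  · intro x
    have : e'.equivRange (e'.equivRange.symm (c x)) = c x := by simp
    exact (e'.equivRange_apply _).symm.trans (congrArg Subtype.val this)

/-- Coherence for embeddings. -/
theorem exists_factor {P X Y : Type u} [L.Structure P] [L.Structure X] [L.Structure Y]
    {f : X ↪[L] P} {g : Y ↪[L] P} (hf : K.IsEmb f) (hg : K.IsEmb g)
    (h : ∀ x, ∃ y, g y = f x) :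
    ∃ i : X ↪[L] Y, K.IsEmb i ∧ ∀ x, g (i x) = f x :=
  isEmb_of_le_range (K.coherence (by rintro _ ⟨x, rfl⟩; exact h x) hf hg)

theorem MemCard.of_equiv {M N : Type u} [L.Structure M] [L.Structure N] {μ : Cardinal.{u}}
    (h : K.MemCard μ M) (φ : M ≃[L] N) : K.MemCard μ N :=
  ⟨K.mem_iso φ h.1, by rw [← h.2, Cardinal.mk_congr φ.toEquiv]⟩

theorem hasLST_LST : K.HasLST K.LST :=
  csInf_mem (s := {κ | K.HasLST κ}) K.exists_lst

/-- Downward Löwenheim–Skolem, to an exact cardinality. -/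
theorem exists_strong_card {μ : Cardinal.{u}} (hμ : K.LST ≤ μ) {N : Type u} [L.Structure N]
    (hN : K.Mem N) (hc : μ ≤ #N) (Z : Set N) (hZ : #Z ≤ μ) :
    ∃ M : L.Substructure N, K.Strong N M ∧ Z ⊆ (M : Set N) ∧ K.MemCard μ M := by
  obtain ⟨W, hW⟩ := Cardinal.le_mk_iff_exists_set.1 hc
  have hinf : ℵ₀ ≤ μ := hasLST_LST.1.trans hμ
  have hZW : #(Z ∪ W : Set N) ≤ μ := by
    refine (Cardinal.mk_union_le _ _).trans ?_
    rw [hW]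
    exact Cardinal.add_le_of_le hinf hZ le_rfl
  obtain ⟨M, hM, hsub, hcard⟩ := hasLST_LST.2.2 N hN (Z ∪ W)
  refine ⟨M, hM, fun x hx => hsub (Or.inl hx), (K.mem_of_strong hM).2, le_antisymm ?_ ?_⟩
  · exact hcard.trans (max_le hμ hZW)
  · rw [← hW]
    exact Cardinal.mk_le_mk_of_subset (fun x hx => hsub (Or.inr hx))

/-- A variant of `exists_strong_card` for embeddings. -/
theorem exists_emb_card {μ : Cardinal.{u}} (hμ : K.LST ≤ μ) {N : Type u} [L.Structure N]
    (hN : K.Mem N) (hc : μ ≤ #N) (Z : Set N) (hZ : #Z ≤ μ) :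
    ∃ (M : Type u) (_ : L.Structure M) (i : M ↪[L] N), K.IsEmb i ∧ K.MemCard μ M ∧
      Z ⊆ Set.range i := by
  obtain ⟨M, hM, hsub, hcard⟩ := exists_strong_card hμ hN hc Z hZ
  refine ⟨M, inferInstance, M.subtype, isEmb_subtype hM, hcard, ?_⟩
  simpa using hsub

/-! ### Equality of Galois types -/

/-- Amalgamating maps are injective and agree on the base, so being algebraic depends only on the
type and not on its realization. -/
theorem tpEmb_pt_mem_range {A : Type u} [L.Structure A] {p q : K.PointedExt A}
    (h : Relation.EqvGen K.AtEquiv p q) : p.pt ∈ Set.range p.emb ↔ q.pt ∈ Set.range q.emb := by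
  induction h with
  | rel p q h =>
    obtain ⟨D, _, f, g, -, -, hfg, hpt⟩ := h
    constructor
    · rintro ⟨a, ha⟩
      refine ⟨a, g.injective ?_⟩
      rw [← hfg, ha, hpt]
    · rintro ⟨a, ha⟩
      refine ⟨a, f.injective ?_⟩
      rw [hfg, ha, hpt]
  | refl => rfl
  | symm _ _ _ ih => exact ih.symm
  | trans _ _ _ _ _ ih₁ ih₂ => exact ih₁.trans ih₂

theorem mem_range_of_tpEmb_eq {A B C : Type u} [L.Structure A] [L.Structure B] [L.Structure C]
    {f : A ↪[L] B} {hf : K.IsEmb f} {b : B} {g : A ↪[L] C} {hg : K.IsEmb g} {c : C}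
    (h : tpEmb f hf b = tpEmb g hg c) : b ∈ Set.range f ↔ c ∈ Set.range g :=
  tpEmb_pt_mem_range (Quot.eqvGen_exact h)

theorem tpEmb_eq_of_amalg {A B C D : Type u} [L.Structure A] [L.Structure B] [L.Structure C]
    [L.Structure D] {f : A ↪[L] B} {hf : K.IsEmb f} {b : B} {g : A ↪[L] C} {hg : K.IsEmb g}
    {c : C} (f' : B ↪[L] D) (g' : C ↪[L] D) (hf' : K.IsEmb f') (hg' : K.IsEmb g')
    (h : ∀ a, f' (f a) = g' (g a)) (hp : f' b = g' c) : tpEmb f hf b = tpEmb g hg c :=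
  Quot.sound ⟨D, inferInstance, f', g', hf', hg', h, hp⟩

/-- A type computed in an extension. -/
theorem tpEmb_eq_of_comp {A B C : Type u} [L.Structure A] [L.Structure B] [L.Structure C]
    {f : A ↪[L] B} {hf : K.IsEmb f} {b : B} {g : A ↪[L] C} {hg : K.IsEmb g} {c : C}
    (i : B ↪[L] C) (hi : K.IsEmb i) (h : ∀ a, i (f a) = g a) (hp : i b = c) :
    tpEmb f hf b = tpEmb g hg c :=
  tpEmb_eq_of_amalg i (FirstOrder.Language.Embedding.refl L C) hi (isEmb_refl hi.mem_right) h hp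

theorem exists_eq_tpEmb {A : Type u} [L.Structure A] (p : K.GaloisType A) :
    ∃ (B : Type u) (_ : L.Structure B) (f : A ↪[L] B) (hf : K.IsEmb f) (b : B),
      p = tpEmb f hf b := by
  induction p using Quot.ind with
  | mk e => exact ⟨e.carrier, e.str, e.emb, e.isEmb, e.pt, rfl⟩

/-- Every pointed extension of a model `A` of size `μ` has a pointed subextension of size `μ`. -/
theorem exists_small_pointed {μ : Cardinal.{u}} (hμ : K.LST ≤ μ) {A B : Type u} [L.Structure A]
    [L.Structure B] (hA : K.MemCard μ A) (f : A ↪[L] B) (hf : K.IsEmb f) (b : B) :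
    ∃ (B' : Type u) (_ : L.Structure B') (i : B' ↪[L] B) (f' : A ↪[L] B') (b' : B'),
      K.IsEmb i ∧ K.IsEmb f' ∧ K.MemCard μ B' ∧ (∀ a, i (f' a) = f a) ∧ i b' = b := by
  have hinf : ℵ₀ ≤ μ := hasLST_LST.1.trans hμ
  have hAB : μ ≤ #B := hA.2 ▸ Cardinal.mk_le_of_injective f.injective
  have hZ : #(insert b (Set.range f) : Set B) ≤ μ := by
    refine (Cardinal.mk_insert_le).trans (Cardinal.add_le_of_le hinf ?_ ?_)
    · exact Cardinal.mk_range_le.trans hA.2.le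
    · exact Cardinal.one_le_aleph0.trans hinf
  obtain ⟨B', _, i, hi, hc, hsub⟩ := exists_emb_card hμ hf.mem_right hAB _ hZ
  obtain ⟨b', hb'⟩ := hsub (Set.mem_insert _ _)
  obtain ⟨f', hf', h⟩ := exists_factor hf hi (fun a => hsub (Set.mem_insert_of_mem _ ⟨a, rfl⟩))
  exact ⟨B', inferInstance, i, f', b', hi, hf', hc, h, hb'⟩

/-- Two models of size `μ` embedded in `D` are contained in a submodel of size `μ`. -/
theorem exists_small_cover {μ : Cardinal.{u}} (hμ : K.LST ≤ μ) {B C D : Type u} [L.Structure B]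
    [L.Structure C] [L.Structure D] (hB : K.MemCard μ B) (hC : K.MemCard μ C)
    (f : B ↪[L] D) (g : C ↪[L] D) (hf : K.IsEmb f) (hg : K.IsEmb g) :
    ∃ (D' : Type u) (_ : L.Structure D') (i : D' ↪[L] D) (f' : B ↪[L] D') (g' : C ↪[L] D'),
      K.MemCard μ D' ∧ K.IsEmb i ∧ K.IsEmb f' ∧ K.IsEmb g' ∧ (∀ x, i (f' x) = f x) ∧
        ∀ x, i (g' x) = g x := by
  have hinf : ℵ₀ ≤ μ := hasLST_LST.1.trans hμ
  have hBD : μ ≤ #D := hB.2 ▸ Cardinal.mk_le_of_injective f.injective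
  have hZ : #(Set.range f ∪ Set.range g : Set D) ≤ μ := by
    refine (Cardinal.mk_union_le _ _).trans (Cardinal.add_le_of_le hinf ?_ ?_)
    · exact Cardinal.mk_range_le.trans hB.2.le
    · exact Cardinal.mk_range_le.trans hC.2.le
  obtain ⟨D', _, i, hi, hc, hsub⟩ := exists_emb_card hμ hf.mem_right hBD _ hZ
  obtain ⟨f', hf', h⟩ := exists_factor hf hi (fun a => hsub (Or.inl ⟨a, rfl⟩))
  obtain ⟨g', hg', h'⟩ := exists_factor hg hi (fun a => hsub (Or.inr ⟨a, rfl⟩))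
  exact ⟨D', inferInstance, i, f', g', hc, hi, hf', hg', h, h'⟩

/-- Amalgamation in K_μ makes atomic equivalence transitive, but the intermediate pointed extensions
of a chain of atomic equivalences may have any size. The induction therefore speaks of arbitrary
small pointed models inside the two ends; in the transitive case the middle extension is first
shrunk to size μ, and the two amalgams are amalgamated over it. -/
theorem exists_amalg_of_eqvGen {μ : Cardinal.{u}} (hμ : K.LST ≤ μ) (hAP : K.Amalgamation μ)
    {A : Type u} [L.Structure A] (hA : K.MemCard μ A) {p q : K.PointedExt A}
    (h : Relation.EqvGen K.AtEquiv p q) :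
    ∀ (B C : Type u) [L.Structure B] [L.Structure C] (f : A ↪[L] B) (g : A ↪[L] C) (b : B) (c : C)
      (i : B ↪[L] p.carrier) (j : C ↪[L] q.carrier),
      K.MemCard μ B → K.MemCard μ C → K.IsEmb f → K.IsEmb g → K.IsEmb i → K.IsEmb j →
      (∀ a, i (f a) = p.emb a) → (∀ a, j (g a) = q.emb a) → i b = p.pt → j c = q.pt →
      ∃ (D : Type u) (_ : L.Structure D) (f' : B ↪[L] D) (g' : C ↪[L] D),
        K.MemCard μ D ∧ K.IsEmb f' ∧ K.IsEmb g' ∧ (∀ a, f' (f a) = g' (g a)) ∧ f' b = g' c := by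
  induction h with
  | rel p q h =>
    obtain ⟨D, _, k, l, hk, hl, hfg, hpt⟩ := h
    intro B C _ _ f g b c i j hB hC hf hg hi hj hif hjg hib hjc
    obtain ⟨D', _, m, f', g', hD', hm, hf', hg', hmf, hmg⟩ :=
      exists_small_cover hμ hB hC (k.comp i) (l.comp j) (hk.comp hi) (hl.comp hj)
    refine ⟨D', inferInstance, f', g', hD', hf', hg', fun a => m.injective ?_, m.injective ?_⟩
    · simp [hmf, hmg, hif, hjg, hfg]
    · simp [hmf, hmg, hib, hjc, hpt]
  | refl p =>
    intro B C _ _ f g b c i j hB hC hf hg hi hj hif hjg hib hjc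
    obtain ⟨D', _, m, f', g', hD', hm, hf', hg', hmf, hmg⟩ :=
      exists_small_cover hμ hB hC i j hi hj
    refine ⟨D', inferInstance, f', g', hD', hf', hg', fun a => m.injective ?_, m.injective ?_⟩
    · simp [hmf, hmg, hif, hjg]
    · simp [hmf, hmg, hib, hjc]
  | symm p q _ ih =>
    intro B C _ _ f g b c i j hB hC hf hg hi hj hif hjg hib hjc
    obtain ⟨D, _, f', g', hD, hf', hg', h, h'⟩ :=
      ih C B g f c b j i hC hB hg hf hj hi hjg hif hjc hib
    exact ⟨D, inferInstance, g', f', hD, hg', hf', fun a => (h a).symm, h'.symm⟩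
  | trans p r q _ _ ih₁ ih₂ =>
    intro B C _ _ f g b c i j hB hC hf hg hi hj hif hjg hib hjc
    obtain ⟨R, _, k, r', e', hk, hr', hR, hkr, hkp⟩ :=
      exists_small_pointed hμ hA r.emb r.isEmb r.pt
    obtain ⟨D₁, _, f₁, g₁, hD₁, hf₁, hg₁, h₁, h₁'⟩ :=
      ih₁ B R f r' b e' i k hB hR hf hr' hi hk hif hkr hib hkp
    obtain ⟨D₂, _, f₂, g₂, hD₂, hf₂, hg₂, h₂, h₂'⟩ :=
      ih₂ R C r' g e' c k j hR hC hr' hg hk hj hkr hjg hkp hjc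
    obtain ⟨D, _, k₁, k₂, hD, hk₁, hk₂, hk₁₂⟩ :=
      hAP R D₁ D₂ g₁ f₂ hR hD₁ hD₂ hg₁ hf₂
    refine ⟨D, inferInstance, k₁.comp f₁, k₂.comp g₂, hD, hk₁.comp hf₁, hk₂.comp hg₂, ?_, ?_⟩
    · intro a
      simp [h₁, ← h₂, hk₁₂]
    · simp [h₁', ← h₂', hk₁₂]

/-- If `A`, `B`, `C ∈ K_μ`, equality of types over `A` is witnessed by an amalgamation in
`K_μ`. -/
theorem exists_amalg_of_tpEmb_eq {μ : Cardinal.{u}} (hμ : K.LST ≤ μ) (hAP : K.Amalgamation μ)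
    {A B C : Type u} [L.Structure A] [L.Structure B] [L.Structure C] (hA : K.MemCard μ A)
    (hB : K.MemCard μ B) (hC : K.MemCard μ C)
    {f : A ↪[L] B} {hf : K.IsEmb f} {b : B} {g : A ↪[L] C} {hg : K.IsEmb g} {c : C}
    (h : tpEmb f hf b = tpEmb g hg c) :
    ∃ (D : Type u) (_ : L.Structure D) (f' : B ↪[L] D) (g' : C ↪[L] D),
      K.MemCard μ D ∧ K.IsEmb f' ∧ K.IsEmb g' ∧ (∀ a, f' (f a) = g' (g a)) ∧ f' b = g' c :=
  exists_amalg_of_eqvGen hμ hAP hA (Quot.eqvGen_exact h) B C f g b c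
    (FirstOrder.Language.Embedding.refl L B) (FirstOrder.Language.Embedding.refl L C) hB hC hf hg
    (isEmb_refl hB.1) (isEmb_refl hC.1) (fun _ => rfl) (fun _ => rfl) rfl rfl

/-- Every type over a model of size `μ` is realized in an extension of size `μ`. -/
theorem exists_eq_tpEmb_card {μ : Cardinal.{u}} (hμ : K.LST ≤ μ) {A : Type u} [L.Structure A]
    (hA : K.MemCard μ A) (p : K.GaloisType A) :
    ∃ (B : Type u) (_ : L.Structure B) (f : A ↪[L] B) (hf : K.IsEmb f) (b : B),
      K.MemCard μ B ∧ p = tpEmb f hf b := by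
  obtain ⟨B, _, f, hf, b, rfl⟩ := exists_eq_tpEmb p
  obtain ⟨B', _, i, f', b', hi, hf', hB', h, hb⟩ := exists_small_pointed hμ hA f hf b
  exact ⟨B', inferInstance, f', hf', b', hB', (tpEmb_eq_of_comp i hi h hb).symm⟩

end AEC

/-! ### Models living on subsets of a fixed set -/

/-- An `L`-structure whose universe is a subset of `U`. -/
structure CModel (L : FirstOrder.Language.{u, u}) (U : Type u) where
  carrier : Set U
  [str : L.Structure carrier]

attribute [instance] CModel.str

namespace CModel

variable {L : FirstOrder.Language.{u, u}} {K : AEC L} {U V W : Type u}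

/-- The map `j` restricts to a `K`-embedding of `M` in `N`. -/
def Emb (K : AEC L) (M : CModel L U) (N : CModel L V) (j : U → V) : Prop :=
  ∃ e : M.carrier ↪[L] N.carrier, K.IsEmb e ∧ ∀ x, (e x : V) = j x

/-- `M ≤_K N`. -/
def Le (K : AEC L) (M N : CModel L U) : Prop := Emb K M N id

namespace Emb

variable {M : CModel L U} {N : CModel L V} {P : CModel L W} {j : U → V} {k : V → W}

/-- The embedding underlying `Emb`. -/
noncomputable def emb (h : Emb K M N j) : M.carrier ↪[L] N.carrier := h.choose

theorem isEmb (h : Emb K M N j) : K.IsEmb h.emb := h.choose_spec.1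

@[simp]
theorem emb_apply (h : Emb K M N j) (x : M.carrier) : (h.emb x : V) = j x := h.choose_spec.2 x

theorem eq_emb (h : Emb K M N j) (e : M.carrier ↪[L] N.carrier) (he : ∀ x, (e x : V) = j x) :
    e = h.emb := by
  ext x
  exact (he x).trans (h.emb_apply x).symm

theorem maps (h : Emb K M N j) {x : U} (hx : x ∈ M.carrier) : j x ∈ N.carrier := by
  have := (h.emb ⟨x, hx⟩).2
  rwa [h.emb_apply] at this

theorem injOn (h : Emb K M N j) : Set.InjOn j M.carrier := by
  intro x hx y hy hxy
  have : h.emb ⟨x, hx⟩ = h.emb ⟨y, hy⟩ := Subtype.ext (by simpa using hxy)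
  exact congrArg Subtype.val (h.emb.injective this)

theorem mem_left (h : Emb K M N j) : K.Mem M.carrier := h.isEmb.mem_left

theorem mem_right (h : Emb K M N j) : K.Mem N.carrier := h.isEmb.mem_right

theorem comp (hk : Emb K N P k) (hj : Emb K M N j) : Emb K M P (k ∘ j) :=
  ⟨hk.emb.comp hj.emb, hk.isEmb.comp hj.isEmb, fun x => by simp⟩

theorem congr {j' : U → V} (h : Emb K M N j) (hj : ∀ x ∈ M.carrier, j x = j' x) :
    Emb K M N j' :=
  ⟨h.emb, h.isEmb, fun x => by simp [hj x x.2]⟩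

theorem of_le {M' : CModel L U} (h : Emb K M N j) (hM : Le K M' M) : Emb K M' N j :=
  h.comp hM

theorem le_trans {N' : CModel L V} (h : Emb K M N j) (hN : Le K N N') : Emb K M N' j :=
  hN.comp h

/-- Coherence. -/
theorem of_comp (hk : Emb K N P k) (h : Emb K M P (k ∘ j))
    (hj : ∀ x ∈ M.carrier, j x ∈ N.carrier) : Emb K M N j := by
  obtain ⟨i, hi, hki⟩ := AEC.exists_factor h.isEmb hk.isEmb
    (fun x => ⟨⟨j x, hj x x.2⟩, Subtype.ext (by simp)⟩)
  refine ⟨i, hi, fun x => ?_⟩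
  have := hki x
  exact hk.injOn (i x).2 (hj x x.2) (by simpa using congrArg Subtype.val this)

end Emb

theorem Le.refl {M : CModel L U} (h : K.Mem M.carrier) : Le K M M :=
  ⟨FirstOrder.Language.Embedding.refl L _, AEC.isEmb_refl h, fun _ => rfl⟩

theorem Le.trans {M N P : CModel L U} (h : Le K M N) (h' : Le K N P) : Le K M P :=
  Emb.comp h' h

theorem Le.subset {M N : CModel L U} (h : Le K M N) : M.carrier ⊆ N.carrier :=
  fun _ hx => Emb.maps h hx

theorem Le.of_subset {M N P : CModel L U} (hM : Le K M P) (hN : Le K N P)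
    (h : M.carrier ⊆ N.carrier) : Le K M N :=
  Emb.of_comp hN hM (fun _ hx => h hx)

@[simp]
theorem Le.emb_apply {M N : CModel L U} (h : Le K M N) (x : M.carrier) :
    (Emb.emb h x : U) = x := Emb.emb_apply h x

/-- Turn an embedding between concrete models into a map. -/
theorem exists_emb_map [Nonempty V] {M : CModel L U} {N : CModel L V}
    (e : M.carrier ↪[L] N.carrier) (he : K.IsEmb e) :
    ∃ j : U → V, Emb K M N j ∧ ∀ x : M.carrier, j x = e x := by
  classical
  refine ⟨fun x => if h : x ∈ M.carrier then e ⟨x, h⟩ else Classical.arbitrary V, ⟨e, he, ?_⟩, ?_⟩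
  all_goals
    intro x
    simp

/-- The image of an embedding, as a concrete model. -/
theorem exists_image {M : CModel L U} {X : Type u} [L.Structure X] (e : X ↪[L] M.carrier)
    (he : K.IsEmb e) :
    ∃ (N : CModel L U) (φ : X ≃[L] N.carrier), Le K N M ∧ ∀ x, (φ x : U) = e x := by
  let k : X → U := fun x => e x
  have hk : Function.Injective k := Subtype.val_injective.comp e.injective
  let E := _root_.Equiv.ofInjective k hk
  let _ : L.Structure (Set.range k) := E.inducedStructure
  let φ : X ≃[L] Set.range k := E.inducedStructureEquiv
  have hφ : ∀ x, (φ x : U) = e x := fun x => rfl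
  let N : CModel L U := ⟨Set.range k⟩
  refine ⟨N, φ, ⟨e.comp φ.symm.toEmbedding, ?_, ?_⟩, hφ⟩
  · exact he.comp (AEC.isEmb_equiv _ (K.mem_iso φ he.mem_left))
  · intro x
    obtain ⟨y, rfl⟩ := φ.surjective x
    simp [hφ]

/-- An abstract extension of a concrete model can be made concrete. -/
theorem exists_concrete_ext [Infinite U] {M : CModel L U} {X : Type u} [L.Structure X]
    (e : M.carrier ↪[L] X) (he : K.IsEmb e) (hX : #X ≤ #U) (hM : #M.carrier < #U) :
    ∃ (N : CModel L U) (φ : X ≃[L] N.carrier), Le K M N ∧ ∀ x, (φ (e x) : U) = x := by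
  classical
  have hcompl : #((M.carrier)ᶜ : Set U) = #U := Cardinal.mk_compl_of_infinite _ hM
  have : #((Set.range e)ᶜ : Set X) ≤ #((M.carrier)ᶜ : Set U) :=
    (Cardinal.mk_set_le _).trans (hX.trans hcompl.ge)
  obtain ⟨g⟩ := this
  let k : X → U := fun x => if h : x ∈ Set.range e then h.choose else g ⟨x, h⟩
  have hke : ∀ x, k (e x) = x := by
    intro x
    have h : e x ∈ Set.range e := ⟨x, rfl⟩
    simp only [k, dif_pos h]
    exact congrArg Subtype.val (e.injective h.choose_spec)
  have hkg : ∀ x (h : x ∉ Set.range e), k x = g ⟨x, h⟩ := fun x h => by simp only [k, dif_neg h]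
  have hk : Function.Injective k := by
    intro x y hxy
    by_cases hx : x ∈ Set.range e <;> by_cases hy : y ∈ Set.range e
    · obtain ⟨x, rfl⟩ := hx
      obtain ⟨y, rfl⟩ := hy
      rw [hke, hke] at hxy
      rw [Subtype.ext hxy]
    · obtain ⟨x, rfl⟩ := hx
      rw [hke, hkg y hy] at hxy
      exact absurd x.2 (hxy ▸ (g ⟨y, hy⟩).2)
    · obtain ⟨y, rfl⟩ := hy
      rw [hke, hkg x hx] at hxy
      exact absurd y.2 (hxy ▸ (g ⟨x, hx⟩).2)
    · rw [hkg x hx, hkg y hy] at hxy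
      exact congrArg Subtype.val (g.injective (Subtype.ext hxy))
  let E := _root_.Equiv.ofInjective k hk
  let _ : L.Structure (Set.range k) := E.inducedStructure
  let φ : X ≃[L] Set.range k := E.inducedStructureEquiv
  have hφ : ∀ x, (φ x : U) = k x := fun x => rfl
  let N : CModel L U := ⟨Set.range k⟩
  refine ⟨N, φ, ⟨φ.toEmbedding.comp e, (AEC.isEmb_equiv φ he.mem_right).comp he, ?_⟩, ?_⟩
  · intro x
    exact hke x
  · intro x
    exact hke x

theorem exists_concrete {X : Type u} [L.Structure X] (hX : #X ≤ #U) :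
    ∃ N : CModel L U, Nonempty (X ≃[L] N.carrier) := by
  obtain ⟨k⟩ := hX
  let E := _root_.Equiv.ofInjective k k.injective
  let _ : L.Structure (Set.range k) := E.inducedStructure
  let φ : X ≃[L] Set.range k := E.inducedStructureEquiv
  exact ⟨⟨Set.range k⟩, ⟨φ⟩⟩

/-! ### Unions of chains -/

/-- `⟨F α | α < δ⟩` is an increasing continuous chain. -/
structure IsChain (K : AEC L) (δ : Ordinal.{u}) (F : Ordinal.{u} → CModel L U) : Prop where
  le : ∀ α β, α ≤ β → β < δ → Le K (F α) (F β)
  cont : ∀ γ < δ, Order.IsSuccLimit γ → (F γ).carrier ⊆ ⋃ α < γ, (F α).carrier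

/-- Functions and relations are finitary, so in a union of a chain they can be evaluated inside a
single member. -/
theorem exists_common_index {δ : Ordinal.{u}} (hδ : 0 < δ) {S : Ordinal.{u} → Set U}
    (hS : ∀ α β, α ≤ β → β < δ → S α ⊆ S β) {n : ℕ} (x : Fin n → U)
    (hx : ∀ i, ∃ α < δ, x i ∈ S α) : ∃ α < δ, ∀ i, x i ∈ S α := by
  choose a ha hxa using hx
  by_cases hn : Nonempty (Fin n)
  · obtain ⟨i, hi⟩ := Finite.exists_max a
    exact ⟨a i, ha i, fun k => hS _ _ (hi k) (ha i) (hxa k)⟩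
  · exact ⟨0, hδ, fun i => absurd ⟨i⟩ hn⟩

theorem exists_union {δ : Ordinal.{u}} (hδ : 0 < δ) {F : Ordinal.{u} → CModel L U}
    (hF : ∀ α β, α ≤ β → β < δ → Le K (F α) (F β)) :
    ∃ N : CModel L U, N.carrier = ⋃ α < δ, (F α).carrier ∧ ∀ α < δ, Le K (F α) N := by
  let C : Set U := ⋃ α < δ, (F α).carrier
  have hC : ∀ x, x ∈ C ↔ ∃ α < δ, x ∈ (F α).carrier := fun x => by simp [C]
  have hidx : ∀ {n : ℕ} (x : Fin n → C), ∃ α, α < δ ∧ ∀ i, (x i : U) ∈ (F α).carrier := by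
    intro n x
    obtain ⟨α, hα, h⟩ := exists_common_index (S := fun α => (F α).carrier) hδ
      (fun α β h h' => (hF α β h h').subset)
      (fun i => (x i : U)) (fun i => (hC _).1 (x i).2)
    exact ⟨α, hα, h⟩
  choose a ha hxa using @hidx
  -- Symbols are evaluated at a chosen index `a x`; `hfun` and `hrel` show that any index containing
  -- the arguments gives the same value, as the members of the chain embed in each other by
  -- inclusion.
  let _ : L.Structure C :=
    { funMap := fun {n} f x => ⟨(FirstOrder.Language.Structure.funMap f
          (fun i => (⟨x i, hxa x i⟩ : (F (a x)).carrier)) : (F (a x)).carrier).1,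
        (hC _).2 ⟨a x, ha x, Subtype.coe_prop _⟩⟩
      RelMap := fun {n} r x => FirstOrder.Language.Structure.RelMap r
          (fun i => (⟨x i, hxa x i⟩ : (F (a x)).carrier)) }
  have hfun : ∀ α, α < δ → ∀ {n : ℕ} (f : L.Functions n) (x : Fin n → (F α).carrier)
      (x' : Fin n → C), (∀ i, (x' i : U) = x i) →
      ((FirstOrder.Language.Structure.funMap f x : (F α).carrier) : U) =
        (FirstOrder.Language.Structure.funMap f x' : C) := by
    intro α hα n f x x' hxx
    change _ = ((FirstOrder.Language.Structure.funMap f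
          (fun i => (⟨x' i, hxa x' i⟩ : (F (a x')).carrier)) : (F (a x')).carrier) : U)
    rcases le_total α (a x') with h | h
    · have := (hF _ _ h (ha x')).emb.map_fun f x
      have h2 := congrArg Subtype.val this
      rw [Le.emb_apply] at h2
      rw [h2]
      congr 2
      funext i
      exact Subtype.ext (by simp [hxx])
    · have := (hF _ _ h hα).emb.map_fun f (fun i => ⟨x' i, hxa x' i⟩)
      have h2 := congrArg Subtype.val this
      rw [Le.emb_apply] at h2
      rw [h2]
      congr 2
      funext i
      exact Subtype.ext (by simp [hxx])
  have hrel : ∀ α, α < δ → ∀ {n : ℕ} (r : L.Relations n) (x : Fin n → (F α).carrier)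
      (x' : Fin n → C), (∀ i, (x' i : U) = x i) →
      (FirstOrder.Language.Structure.RelMap r x' ↔ FirstOrder.Language.Structure.RelMap r x) := by
    intro α hα n r x x' hxx
    change FirstOrder.Language.Structure.RelMap r
          (fun i => (⟨x' i, hxa x' i⟩ : (F (a x')).carrier)) ↔ _
    rcases le_total α (a x') with h | h
    · rw [← (hF _ _ h (ha x')).emb.map_rel r x]
      refine iff_of_eq (congrArg _ ?_)
      funext i
      exact Subtype.ext (by simp [hxx])
    · rw [← (hF _ _ h hα).emb.map_rel r]
      refine iff_of_eq (congrArg _ ?_)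
      funext i
      exact Subtype.ext (by simp [hxx])
  let e : ∀ α, α < δ → ((F α).carrier ↪[L] C) := fun α hα =>
    { toFun := fun x => ⟨x, (hC _).2 ⟨α, hα, x.2⟩⟩
      inj' := fun x y h => Subtype.ext (congrArg (fun z : C => (z : U)) h)
      map_fun' := fun f x => Subtype.ext (hfun α hα f x _ (fun i => rfl))
      map_rel' := fun r x => hrel α hα r x _ (fun i => rfl) }
  classical
  let A : Ordinal.{u} → L.Substructure C := fun α =>
    if h : α < δ then (e α h).toHom.range else ⊤
  have hA : ∀ α (h : α < δ), A α = (e α h).toHom.range := fun α h => dif_pos h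
  have hch : K.IncreasingChain δ A := by
    constructor
    · intro α hα
      rw [hA α hα]
      exact K.mem_iso (e α hα).equivRange (hF α α le_rfl hα).mem_left
    · intro α β h hβ
      rw [hA α (h.trans_lt hβ), hA β hβ]
      exact AEC.le_range (hF α β h hβ).isEmb
        (fun x => Subtype.ext (Le.emb_apply (hF α β h hβ) x))
  have hun : ModelClass.IsUnion δ A (⊤ : L.Substructure C) := by
    intro x
    simp only [FirstOrder.Language.Substructure.mem_top, true_iff]
    obtain ⟨α, hα, hx⟩ := (hC x).1 x.2
    refine ⟨α, hα, ?_⟩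
    rw [hA α hα]
    exact ⟨⟨x, hx⟩, rfl⟩
  have := K.chain δ A hδ hch hun
  refine ⟨⟨C⟩, rfl, fun α hα => ⟨e α hα, ?_, fun x => rfl⟩⟩
  have h2 := this.2 α hα
  rwa [hA α hα] at h2

/-- Smoothness: compatible embeddings of the members of a continuous chain give an embedding
of the union. -/
theorem emb_of_union {δ : Ordinal.{u}} (hδ : 0 < δ) {F : Ordinal.{u} → CModel L U}
    (hF : IsChain K δ F) {N : CModel L U} (hN : N.carrier ⊆ ⋃ α < δ, (F α).carrier)
    (hle : ∀ α < δ, Le K (F α) N) {P : CModel L V} {j : U → V}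
    (hj : ∀ α < δ, Emb K (F α) P j) : Emb K N P j := by
  have hidx : ∀ {n : ℕ} (x : Fin n → N.carrier), ∃ α, α < δ ∧ ∀ i, (x i : U) ∈ (F α).carrier := by
    intro n x
    obtain ⟨α, hα, h⟩ := exists_common_index (S := fun α => (F α).carrier) hδ
      (fun α β h h' => (hF.le α β h h').subset)
      (fun i => (x i : U)) (fun i => by simpa using hN (x i).2)
    exact ⟨α, hα, h⟩
  have hmem : ∀ x ∈ N.carrier, ∃ α < δ, x ∈ (F α).carrier := fun x hx => by simpa using hN hx
  have hP : ∀ x ∈ N.carrier, j x ∈ P.carrier := by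
    intro x hx
    obtain ⟨α, hα, hxα⟩ := hmem x hx
    exact (hj α hα).maps hxα
  let t : N.carrier → P.carrier := fun x => ⟨j x, hP x x.2⟩
  have ht : ∀ α (hα : α < δ) (x : (F α).carrier), t ((hle α hα).emb x) = (hj α hα).emb x := by
    intro α hα x
    exact Subtype.ext (by simp [t, Le.emb_apply])
  let e : N.carrier ↪[L] P.carrier :=
    { toFun := t
      inj' := by
        intro x y hxy
        obtain ⟨α, hα, h⟩ := hidx ![x, y]
        refine Subtype.ext ((hj α hα).injOn (by simpa using h 0) (by simpa using h 1) ?_)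
        exact congrArg Subtype.val hxy
      map_fun' := by
        intro n f x
        obtain ⟨α, hα, h⟩ := hidx x
        have hx : x = (hle α hα).emb ∘ (fun i => (⟨x i, h i⟩ : (F α).carrier)) := by
          funext i
          exact Subtype.ext (by simp [Le.emb_apply])
        have hx' : t ∘ x = (hj α hα).emb ∘ (fun i => (⟨x i, h i⟩ : (F α).carrier)) := by
          funext i
          exact Subtype.ext (by simp [t])
        rw [hx', ← FirstOrder.Language.Embedding.map_fun]
        conv_lhs => rw [hx]
        rw [← FirstOrder.Language.Embedding.map_fun]
        exact ht α hα _
      map_rel' := by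
        intro n r x
        obtain ⟨α, hα, h⟩ := hidx x
        have hx : x = (hle α hα).emb ∘ (fun i => (⟨x i, h i⟩ : (F α).carrier)) := by
          funext i
          exact Subtype.ext (by simp [Le.emb_apply])
        have hx' : t ∘ x = (hj α hα).emb ∘ (fun i => (⟨x i, h i⟩ : (F α).carrier)) := by
          funext i
          exact Subtype.ext (by simp [t])
        rw [hx', FirstOrder.Language.Embedding.map_rel]
        conv_rhs => rw [hx]
        rw [FirstOrder.Language.Embedding.map_rel] }
  classical
  let A : Ordinal.{u} → L.Substructure P.carrier := fun α =>
    if h : α < δ then (hj α h).emb.toHom.range else ⊤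
  have hA : ∀ α (h : α < δ), A α = (hj α h).emb.toHom.range := fun α h => dif_pos h
  have hAmem : ∀ α, α < δ → ∀ x, x ∈ A α ↔ ∃ y ∈ (F α).carrier, j y = x := by
    intro α h x
    rw [hA α h]
    constructor
    · rintro ⟨y, hy⟩
      exact ⟨y, y.2, by rw [← (hj α h).emb_apply]; exact congrArg Subtype.val hy⟩
    · rintro ⟨y, hy, hyx⟩
      exact ⟨⟨y, hy⟩, Subtype.ext (by simpa using hyx)⟩
  refine ⟨e, ?_, fun x => rfl⟩
  -- The images of the members form a continuous chain of strong submodels of `P` whose union is the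
  -- range of `e`.
  refine K.smooth δ A _ hδ (hj 0 hδ).mem_right ⟨?_, ?_⟩ ?_ ?_ ?_
  · intro α hα
    rw [hA α hα]
    exact K.mem_iso (hj α hα).emb.equivRange (hj α hα).mem_left
  · intro α β h hβ
    rw [hA α (h.trans_lt hβ), hA β hβ]
    exact AEC.le_range (hF.le α β h hβ).isEmb
      (fun x => Subtype.ext (by simp [Le.emb_apply]))
  · intro γ hγ hlim x
    rw [hAmem γ hγ]
    constructor
    · rintro ⟨y, hy, rfl'⟩
      have := hF.cont γ hγ hlim hy
      simp only [Set.mem_iUnion, exists_prop] at this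
      obtain ⟨α, hα, hyα⟩ := this
      exact ⟨α, hα, (hAmem α (hα.trans hγ) x).2 ⟨y, hyα, rfl'⟩⟩
    · rintro ⟨α, hα, hx⟩
      obtain ⟨y, hy, hyx⟩ := (hAmem α (hα.trans hγ) x).1 hx
      exact ⟨y, (hF.le α γ hα.le hγ).subset hy, hyx⟩
  · intro x
    constructor
    · rintro ⟨y, rfl⟩
      obtain ⟨α, hα, hy⟩ := hmem y y.2
      exact ⟨α, hα, (hAmem α hα _).2 ⟨y, hy, rfl⟩⟩
    · rintro ⟨α, hα, hx⟩
      obtain ⟨y, hy, hyx⟩ := (hAmem α hα _).1 hx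
      exact ⟨⟨y, (hle α hα).subset hy⟩, Subtype.ext hyx⟩
  · intro α hα
    rw [hA α hα]
    exact (hj α hα).isEmb

end CModel

/-! ### Transfinite constructions -/

theorem Cardinal.mk_biUnion_ordinal_le {U : Type u} {μ : Cardinal.{u}} (hμ : ℵ₀ ≤ μ)
    {δ : Ordinal.{u}} (hδ : δ.card ≤ μ) {S : Ordinal.{u} → Set U} (hS : ∀ α < δ, #(S α) ≤ μ) :
    #(⋃ α < δ, S α : Set U) ≤ μ := by
  have h : (⋃ α < δ, S α) ⊆ ⋃ i : δ.ToType, S (Ordinal.ToType.mk.symm i) := by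
    intro x hx
    simp only [Set.mem_iUnion, exists_prop] at hx ⊢
    obtain ⟨α, hα, hx⟩ := hx
    exact ⟨Ordinal.ToType.mk ⟨α, hα⟩, by simpa using hx⟩
  refine (Cardinal.mk_le_mk_of_subset h).trans ((Cardinal.mk_iUnion_le _).trans ?_)
  refine (mul_le_mul' (b := μ) (d := μ) ?_ ?_).trans (Cardinal.mul_eq_self hμ).le
  · simpa using hδ
  · exact ciSup_le' fun i => hS _ (Ordinal.ToType.mk.symm i).2

/-- A construction by transfinite recursion of length `θ`: a continuous increasing sequence with
prescribed successor steps. -/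
theorem Ordinal.exists_continuous_chain {P : Type v} {W : Type w} (θ : Ordinal.{u})
    (le : P → P → Prop) (supp : P → Set W) (Inv : Ordinal.{u} → P → Prop)
    (Step : Ordinal.{u} → P → P → Prop) (x₀ : P)
    (hrefl : ∀ α x, Inv α x → le x x) (htrans : ∀ x y z, le x y → le y z → le x z)
    (h0 : Inv 0 x₀)
    (hs : ∀ α, α + 1 < θ → ∀ x, Inv α x → ∃ y, le x y ∧ Inv (α + 1) y ∧ Step α x y)
    (hl : ∀ δ < θ, Order.IsSuccLimit δ → ∀ F : Ordinal.{u} → P, (∀ α < δ, Inv α (F α)) →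
      (∀ α β, α ≤ β → β < δ → le (F α) (F β)) →
      (∀ γ < δ, Order.IsSuccLimit γ → supp (F γ) ⊆ ⋃ α < γ, supp (F α)) → F 0 = x₀ →
      ∃ y, Inv δ y ∧ (∀ α < δ, le (F α) y) ∧ supp y ⊆ ⋃ α < δ, supp (F α)) :
    ∃ F : Ordinal.{u} → P, F 0 = x₀ ∧ (0 < θ → ∀ α < θ, Inv α (F α)) ∧
      (∀ α β, α ≤ β → β < θ → le (F α) (F β)) ∧
      (∀ γ < θ, Order.IsSuccLimit γ → supp (F γ) ⊆ ⋃ α < γ, supp (F α)) ∧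
      ∀ α, α + 1 < θ → Step α (F α) (F (α + 1)) := by
  classical
  have : Nonempty P := ⟨x₀⟩
  -- The recursion picks by `epsilon` and carries no proofs; that the picked objects have the
  -- required properties is shown afterwards, by the induction `key`.
  let F : Ordinal.{u} → P := fun α => Ordinal.limitRecOn (motive := fun _ => P) α x₀
    (fun α x => Classical.epsilon fun y => le x y ∧ Inv (α + 1) y ∧ Step α x y)
    (fun δ _ ih => Classical.epsilon fun y => Inv δ y ∧
      (∀ α (h : α < δ), le (ih α h) y) ∧ supp y ⊆ ⋃ α, ⋃ h : α < δ, supp (ih α h))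
  have hF0 : F 0 = x₀ := Ordinal.limitRecOn_zero ..
  have hFs : ∀ α, F (α + 1) =
      Classical.epsilon fun y => le (F α) y ∧ Inv (α + 1) y ∧ Step α (F α) y :=
    fun α => Ordinal.limitRecOn_add_one ..
  have hFl : ∀ δ, Order.IsSuccLimit δ → F δ = Classical.epsilon fun y => Inv δ y ∧
      (∀ α < δ, le (F α) y) ∧ supp y ⊆ ⋃ α < δ, supp (F α) :=
    fun δ hδ => Ordinal.limitRecOn_limit _ _ _ _ hδ
  have key : ∀ β < θ, Inv β (F β) ∧ (∀ α ≤ β, le (F α) (F β)) ∧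
      (Order.IsSuccLimit β → supp (F β) ⊆ ⋃ α < β, supp (F α)) ∧
      ∀ α, β = α + 1 → Step α (F α) (F (α + 1)) := by
    intro β
    induction β using WellFoundedLT.induction with
    | ind β ih =>
      intro hβ
      rcases Ordinal.zero_or_succ_or_isSuccLimit β with rfl | ⟨α, rfl⟩ | hlim
      · refine ⟨hF0 ▸ h0, ?_, ?_, ?_⟩
        · intro α hα
          rw [nonpos_iff_eq_zero.1 hα, hF0]
          exact hrefl 0 _ h0
        · intro h
          exact absurd h.bot_lt (lt_irrefl _)
        · intro α h
          exact absurd h.symm (Order.succ_ne_bot α)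
      · have hα : α < Order.succ α := Order.lt_succ α
        obtain ⟨h1, h2, -, -⟩ := ih α hα (hα.trans hβ)
        have h3 := Classical.epsilon_spec (hs α hβ (F α) h1)
        rw [← hFs α] at h3
        change Inv (α + 1) (F (α + 1)) ∧ (∀ γ ≤ α + 1, le (F γ) (F (α + 1))) ∧
          (Order.IsSuccLimit (α + 1) → _) ∧ ∀ γ, α + 1 = γ + 1 → _
        refine ⟨h3.2.1, ?_, ?_, ?_⟩
        · intro γ hγ
          rcases hγ.lt_or_eq with h | rfl
          · exact htrans _ _ _ (h2 γ (Order.lt_succ_iff.1 h)) h3.1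
          · exact hrefl _ _ h3.2.1
        · intro h
          exact absurd h.isSuccPrelimit (Order.not_isSuccPrelimit_succ α)
        · intro γ h
          obtain rfl : α = γ := Order.succ_injective h
          exact h3.2.2
      · have h1 : ∀ α < β, Inv α (F α) := fun α hα => (ih α hα (hα.trans hβ)).1
        have h2 : ∀ α γ, α ≤ γ → γ < β → le (F α) (F γ) :=
          fun α γ h hγ => (ih γ hγ (hγ.trans hβ)).2.1 α h
        have h3 := Classical.epsilon_spec (hl β hβ hlim F h1 h2
          (fun γ hγ => (ih γ hγ (hγ.trans hβ)).2.2.1) hF0)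
        rw [← hFl β hlim] at h3
        refine ⟨h3.1, ?_, fun _ => h3.2.2, ?_⟩
        · intro γ hγ
          rcases hγ.lt_or_eq with h | rfl
          · exact h3.2.1 γ h
          · exact hrefl _ _ h3.1
        · rintro γ rfl
          exact absurd hlim.isSuccPrelimit (Order.not_isSuccPrelimit_succ γ)
  exact ⟨F, hF0, fun _ α hα => (key α hα).1, fun α β h hβ => (key β hβ).2.1 α h,
    fun γ hγ => (key γ hγ).2.2.1, fun α hα => (key (α + 1) hα).2.2.2 α rfl⟩

/-! ### Chains and unions of models of a fixed cardinality -/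

namespace CModel

variable {L : FirstOrder.Language.{u, u}} {K : AEC L} {U : Type u} {μ : Cardinal.{u}}

/-- `N` is a union of the chain `⟨F α | α < δ⟩`. -/
structure IsUnionOf (K : AEC L) (δ : Ordinal.{u}) (F : Ordinal.{u} → CModel L U)
    (N : CModel L U) : Prop where
  subset : N.carrier ⊆ ⋃ α < δ, (F α).carrier
  le : ∀ α < δ, Le K (F α) N

theorem IsUnionOf.exists_mem {δ : Ordinal.{u}} {F : Ordinal.{u} → CModel L U} {N : CModel L U}
    (h : IsUnionOf K δ F N) {x : U} (hx : x ∈ N.carrier) : ∃ α < δ, x ∈ (F α).carrier := by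
  simpa using h.subset hx

theorem IsChain.exists_isUnionOf {δ : Ordinal.{u}} (hδ : 0 < δ) {F : Ordinal.{u} → CModel L U}
    (hF : IsChain K δ F) : ∃ N, IsUnionOf K δ F N := by
  obtain ⟨N, h, h'⟩ := exists_union hδ hF.le
  exact ⟨N, h.subset, h'⟩

theorem IsUnionOf.emb {V : Type u} {δ : Ordinal.{u}} (hδ : 0 < δ) {F : Ordinal.{u} → CModel L U}
    (hF : IsChain K δ F) {N : CModel L U} (hN : IsUnionOf K δ F N) {P : CModel L V} {j : U → V}
    (hj : ∀ α < δ, Emb K (F α) P j) : Emb K N P j :=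
  emb_of_union hδ hF hN.subset hN.le hj

theorem IsChain.isUnionOf {δ γ : Ordinal.{u}} {F : Ordinal.{u} → CModel L U} (hF : IsChain K δ F)
    (h : γ < δ) (hγ : Order.IsSuccLimit γ) : IsUnionOf K γ F (F γ) :=
  ⟨hF.cont γ h hγ, fun α hα => hF.le α γ hα.le h⟩

theorem IsUnionOf.memCard {δ : Ordinal.{u}} (hδ : 0 < δ) (hμ : ℵ₀ ≤ μ) (hδμ : δ.card ≤ μ)
    {F : Ordinal.{u} → CModel L U} {N : CModel L U} (hN : IsUnionOf K δ F N)
    (hF : ∀ α < δ, K.MemCard μ (F α).carrier) : K.MemCard μ N.carrier := by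
  refine ⟨(hN.le 0 hδ).mem_right, le_antisymm ?_ ?_⟩
  · exact (Cardinal.mk_le_mk_of_subset hN.subset).trans
      (Cardinal.mk_biUnion_ordinal_le hμ hδμ fun α hα => (hF α hα).2.le)
  · rw [← (hF 0 hδ).2]
    exact Cardinal.mk_le_mk_of_subset (hN.le 0 hδ).subset

/-- The union of a strictly increasing chain of length `μ⁺` of models in `K_μ` is in `K_{μ⁺}`. -/
theorem IsUnionOf.memCard_succ (hμ : ℵ₀ ≤ μ) {F : Ordinal.{u} → CModel L U} {N : CModel L U}
    (hN : IsUnionOf K (Order.succ μ).ord F N)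
    (hF : ∀ α < (Order.succ μ).ord, #(F α).carrier ≤ μ)
    (hle : ∀ α β, α ≤ β → β < (Order.succ μ).ord → (F α).carrier ⊆ (F β).carrier)
    (hstrict : ∀ α < (Order.succ μ).ord, ¬ (F (α + 1)).carrier ⊆ (F α).carrier) :
    K.MemCard (Order.succ μ) N.carrier := by
  have hlim := Cardinal.isSuccLimit_ord (hμ.trans (Order.le_succ μ))
  refine ⟨(hN.le 0 hlim.bot_lt).mem_right, le_antisymm ?_ ?_⟩
  · refine (Cardinal.mk_le_mk_of_subset hN.subset).trans
      (Cardinal.mk_biUnion_ordinal_le (hμ.trans (Order.le_succ μ)) (by simp) fun α hα => ?_)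
    exact (hF α hα).trans (Order.le_succ μ)
  -- One new element from each successor stage gives an injection of μ⁺ into the union.
  · have : ∀ α : Set.Iio (Order.succ μ).ord,
        ∃ x : N.carrier, (x : U) ∈ (F (α + 1)).carrier ∧ (x : U) ∉ (F α).carrier := by
      rintro ⟨α, hα⟩
      obtain ⟨x, hx, hx'⟩ := Set.not_subset.1 (hstrict α hα)
      exact ⟨⟨x, (hN.le _ (hlim.succ_lt hα)).subset hx⟩, hx, hx'⟩
    choose f hf hf' using this
    have hlt : ∀ α β : Set.Iio (Order.succ μ).ord, α < β → f α ≠ f β := by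
      intro α β h heq
      refine hf' β (heq ▸ hle _ _ (Order.succ_le_of_lt h) β.2 (hf α))
    have hinj : Function.Injective f := by
      intro α β h
      rcases lt_trichotomy α β with h' | h' | h'
      · exact absurd h (hlt _ _ h')
      · exact h'
      · exact absurd h.symm (hlt _ _ h')
    have h1 := Cardinal.mk_le_of_injective
      (hinj.comp (Ordinal.ToType.mk (o := (Order.succ μ).ord)).symm.injective)
    simpa using h1

/-- Construction of continuous chains of models in `K_μ`. -/
theorem exists_model_chain (hμ : ℵ₀ ≤ μ) (θ : Ordinal.{u}) (hθ : 0 < θ)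
    (hθμ : ∀ δ < θ, δ.card ≤ μ)
    (Inv : CModel L U → Prop) (Step : Ordinal.{u} → CModel L U → CModel L U → Prop)
    (M₀ : CModel L U) (hM₀ : K.MemCard μ M₀.carrier) (hInv₀ : Inv M₀)
    (hs : ∀ α, α + 1 < θ → ∀ M : CModel L U, K.MemCard μ M.carrier → Inv M → Le K M₀ M →
      ∃ M' : CModel L U, Le K M M' ∧ K.MemCard μ M'.carrier ∧ Inv M' ∧ Step α M M')
    (hInv : ∀ δ < θ, Order.IsSuccLimit δ → ∀ F : Ordinal.{u} → CModel L U, IsChain K δ F →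
      (∀ α < δ, Inv (F α)) → ∀ N, IsUnionOf K δ F N → Inv N) :
    ∃ F : Ordinal.{u} → CModel L U, F 0 = M₀ ∧ IsChain K θ F ∧
      (∀ α < θ, K.MemCard μ (F α).carrier ∧ Inv (F α)) ∧
      ∀ α, α + 1 < θ → Step α (F α) (F (α + 1)) := by
  have H := Ordinal.exists_continuous_chain θ (Le K)
    CModel.carrier (fun _ M => (K.MemCard μ M.carrier ∧ Inv M) ∧ Le K M₀ M) Step M₀
    (fun _ x hx => Le.refl hx.1.1.1) (fun _ _ _ h h' => Le.trans h h')
    ⟨⟨hM₀, hInv₀⟩, Le.refl hM₀.1⟩ ?_ ?_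
  · obtain ⟨F, h0, h1, h2, h3, h4⟩ := H
    exact ⟨F, h0, ⟨h2, h3⟩, fun α hα => (h1 hθ α hα).1, h4⟩
  · rintro α hα M ⟨⟨hM, hI⟩, hle⟩
    obtain ⟨M', h, hM', hI', hS⟩ := hs α hα M hM hI hle
    exact ⟨M', h, ⟨⟨hM', hI'⟩, Le.trans hle h⟩, hS⟩
  · intro δ hδ hlim F hF hle hc hF0
    have hch : IsChain K δ F := ⟨hle, hc⟩
    obtain ⟨N, hN⟩ := hch.exists_isUnionOf hlim.bot_lt
    refine ⟨N, ⟨⟨?_, ?_⟩, ?_⟩, hN.le, hN.subset⟩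
    · exact hN.memCard hlim.bot_lt hμ (hθμ δ hδ) fun α hα => (hF α hα).1.1
    · exact hInv δ hδ hlim F hch (fun α hα => (hF α hα).1.2) N hN
    · exact hF0 ▸ hN.le 0 hlim.bot_lt

end CModel

/-! ### Chains of embeddings -/

/-- Two concrete models together with a map which is meant to embed one in the other. -/
structure EmbNode (L : FirstOrder.Language.{u, u}) (U : Type u) where
  dom : CModel L U
  cod : CModel L U
  map : U → U

namespace EmbNode

open CModel

variable {L : FirstOrder.Language.{u, u}} {K : AEC L} {U : Type u} {μ : Cardinal.{u}}

/-- The map of the node is a `K`-embedding between models in `K_μ`. -/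
structure Good (K : AEC L) (μ : Cardinal.{u}) (n : EmbNode L U) : Prop where
  emb : Emb K n.dom n.cod n.map
  dom : K.MemCard μ n.dom.carrier
  cod : K.MemCard μ n.cod.carrier

/-- Extension of nodes. -/
structure Le (K : AEC L) (n m : EmbNode L U) : Prop where
  dom : CModel.Le K n.dom m.dom
  cod : CModel.Le K n.cod m.cod
  map : ∀ x ∈ n.dom.carrier, m.map x = n.map x

theorem Good.le_refl {n : EmbNode L U} (h : Good K μ n) : Le K n n :=
  ⟨CModel.Le.refl h.dom.1, CModel.Le.refl h.cod.1, fun _ _ => rfl⟩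

theorem Le.trans {n m k : EmbNode L U} (h : Le K n m) (h' : Le K m k) : Le K n k :=
  ⟨h.dom.trans h'.dom, h.cod.trans h'.cod,
    fun x hx => (h'.map x (h.dom.subset hx)).trans (h.map x hx)⟩

/-- The elements occurring in a node. -/
def supp (n : EmbNode L U) : Set (U ⊕ U) :=
  {z | Sum.elim (· ∈ n.dom.carrier) (· ∈ n.cod.carrier) z}

/-- An increasing continuous chain of nodes. -/
structure IsChain (K : AEC L) (δ : Ordinal.{u}) (F : Ordinal.{u} → EmbNode L U) : Prop where
  le : ∀ α β, α ≤ β → β < δ → Le K (F α) (F β)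
  cont : ∀ γ < δ, Order.IsSuccLimit γ → (F γ).supp ⊆ ⋃ α < γ, (F α).supp

theorem IsChain.dom {δ : Ordinal.{u}} {F : Ordinal.{u} → EmbNode L U} (h : IsChain K δ F) :
    CModel.IsChain K δ fun α => (F α).dom := by
  refine ⟨fun α β hαβ hβ => (h.le α β hαβ hβ).dom, fun γ hγ hlim x hx => ?_⟩
  have := h.cont γ hγ hlim (show Sum.inl x ∈ (F γ).supp from hx)
  simpa [supp] using this

theorem IsChain.cod {δ : Ordinal.{u}} {F : Ordinal.{u} → EmbNode L U} (h : IsChain K δ F) :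
    CModel.IsChain K δ fun α => (F α).cod := by
  refine ⟨fun α β hαβ hβ => (h.le α β hαβ hβ).cod, fun γ hγ hlim x hx => ?_⟩
  have := h.cont γ hγ hlim (show Sum.inr x ∈ (F γ).supp from hx)
  simpa [supp] using this

theorem supp_subset {δ : Ordinal.{u}} {F : Ordinal.{u} → EmbNode L U} {n : EmbNode L U}
    (hd : IsUnionOf K δ (fun α => (F α).dom) n.dom)
    (hc : IsUnionOf K δ (fun α => (F α).cod) n.cod) : n.supp ⊆ ⋃ α < δ, (F α).supp := by
  rintro (x | x) hx
  · obtain ⟨α, hα, h⟩ := hd.exists_mem hx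
    exact Set.mem_biUnion (s := Set.Iio δ) hα h
  · obtain ⟨α, hα, h⟩ := hc.exists_mem hx
    exact Set.mem_biUnion (s := Set.Iio δ) hα h

/-- The union of a chain of embeddings. -/
theorem IsChain.exists_map {δ : Ordinal.{u}} (hδ : 0 < δ) {F : Ordinal.{u} → EmbNode L U}
    (h : IsChain K δ F) (hemb : ∀ α < δ, Emb K (F α).dom (F α).cod (F α).map) {A B : CModel L U}
    (hA : IsUnionOf K δ (fun α => (F α).dom) A) (hB : IsUnionOf K δ (fun α => (F α).cod) B) :
    ∃ j : U → U, Emb K A B j ∧ ∀ α < δ, ∀ x ∈ (F α).dom.carrier, j x = (F α).map x := by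
  classical
  -- Any index whose domain contains `x` will do, since the maps of the chain extend each other.
  let j : U → U := fun x =>
    if hx : ∃ α, α < δ ∧ x ∈ (F α).dom.carrier then (F hx.choose).map x else x
  have hj : ∀ α < δ, ∀ x ∈ (F α).dom.carrier, j x = (F α).map x := by
    intro α hα x hx
    have hex : ∃ α, α < δ ∧ x ∈ (F α).dom.carrier := ⟨α, hα, hx⟩
    have h1 : j x = (F hex.choose).map x := dif_pos hex
    rw [h1]
    rcases le_total α hex.choose with h' | h'
    · exact (h.le _ _ h' hex.choose_spec.1).map x hx
    · exact ((h.le _ _ h' hα).map x hex.choose_spec.2).symm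
  refine ⟨j, hA.emb hδ h.dom fun α hα => ?_, hj⟩
  exact ((hemb α hα).le_trans (hB.le α hα)).congr fun x hx => (hj α hα x hx).symm

/-- Unions of chains of nodes, with prescribed union of the domains. -/
theorem IsChain.exists_union {δ : Ordinal.{u}} (hδ : 0 < δ) (hμ : ℵ₀ ≤ μ) (hδμ : δ.card ≤ μ)
    {F : Ordinal.{u} → EmbNode L U} (h : IsChain K δ F) (hF : ∀ α < δ, Good K μ (F α))
    {A : CModel L U} (hA : IsUnionOf K δ (fun α => (F α).dom) A) :
    ∃ n : EmbNode L U, n.dom = A ∧ Good K μ n ∧ (∀ α < δ, Le K (F α) n) ∧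
      IsUnionOf K δ (fun α => (F α).cod) n.cod ∧ n.supp ⊆ ⋃ α < δ, (F α).supp := by
  obtain ⟨B, hB⟩ := h.cod.exists_isUnionOf hδ
  obtain ⟨j, hj, hjx⟩ := h.exists_map hδ (fun α hα => (hF α hα).emb) hA hB
  refine ⟨⟨A, B, j⟩, rfl, ⟨hj, ?_, ?_⟩, fun α hα => ⟨hA.le α hα, hB.le α hα, hjx α hα⟩, hB,
    supp_subset hA hB⟩
  · exact hA.memCard hδ hμ hδμ fun α hα => (hF α hα).dom
  · exact hB.memCard hδ hμ hδμ fun α hα => (hF α hα).cod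

/-- Amalgamating a model with all members of a continuous chain. -/
theorem exists_chain_over (hμ : ℵ₀ ≤ μ) (θ : Ordinal.{u}) (hθ : 0 < θ)
    (hθμ : ∀ δ < θ, δ.card ≤ μ) (N : Ordinal.{u} → CModel L U) (hN : CModel.IsChain K θ N)
    (Step : Ordinal.{u} → EmbNode L U → EmbNode L U → Prop)
    (n₀ : EmbNode L U) (hn₀ : Good K μ n₀) (hn₀N : n₀.dom = N 0)
    (hs : ∀ α, α + 1 < θ → ∀ n : EmbNode L U, Good K μ n → n.dom = N α → Le K n₀ n →
      ∃ n' : EmbNode L U, Le K n n' ∧ Good K μ n' ∧ n'.dom = N (α + 1) ∧ Step α n n') :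
    ∃ F : Ordinal.{u} → EmbNode L U, F 0 = n₀ ∧ IsChain K θ F ∧
      (∀ α < θ, Good K μ (F α) ∧ (F α).dom = N α) ∧
      ∀ α, α + 1 < θ → Step α (F α) (F (α + 1)) := by
  have H := Ordinal.exists_continuous_chain θ (Le K)
    supp (fun α n => (Good K μ n ∧ n.dom = N α) ∧ Le K n₀ n) Step n₀
    (fun _ x hx => hx.1.1.le_refl) (fun _ _ _ h h' => Le.trans h h')
    ⟨⟨hn₀, hn₀N⟩, hn₀.le_refl⟩ ?_ ?_
  · obtain ⟨F, h0, h1, h2, h3, h4⟩ := H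
    exact ⟨F, h0, ⟨h2, h3⟩, fun α hα => (h1 hθ α hα).1, h4⟩
  · rintro α hα n ⟨⟨hn, hI⟩, hle⟩
    obtain ⟨n', h, hn', hI', hS⟩ := hs α hα n hn hI hle
    exact ⟨n', h, ⟨⟨hn', hI'⟩, Le.trans hle h⟩, hS⟩
  · intro δ hδ hlim F hF hle hc hF0
    have hch : IsChain K δ F := ⟨hle, hc⟩
    have hA : IsUnionOf K δ (fun α => (F α).dom) (N δ) := by
      have := hN.isUnionOf hδ hlim
      refine ⟨fun x hx => ?_, fun α hα => ?_⟩
      · obtain ⟨α, hα, h⟩ := this.exists_mem hx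
        exact Set.mem_biUnion (s := Set.Iio δ) hα ((hF α hα).1.2 ▸ h)
      · rw [(hF α hα).1.2]
        exact this.le α hα
    obtain ⟨n, hnA, hn, hle', -, hsupp⟩ := hch.exists_union hlim.bot_lt hμ (hθμ δ hδ)
      (fun α hα => (hF α hα).1.1) hA
    exact ⟨n, ⟨⟨hn, hnA⟩, hF0 ▸ hle' 0 hlim.bot_lt⟩, hle', hsupp⟩

end EmbNode

/-! ### Universal and homogeneous models -/

/-- Bookkeeping for constructions of length μ: step α treats `g α`. The default value `x₀` keeps `g
α` in `S` at all ordinals, so a step needs no case distinction. -/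
theorem Ordinal.exists_enum {X : Type v} {μ : Cardinal.{u}} (S : Set X)
    (hS : Cardinal.lift.{u + 1} #S ≤ Cardinal.lift.{max (u + 1) v} μ) (x₀ : X) (hx₀ : x₀ ∈ S) :
    ∃ g : Ordinal.{u} → X, (∀ α, g α ∈ S) ∧ ∀ x ∈ S, ∃ α < μ.ord, g α = x := by
  classical
  have h : Cardinal.lift.{u + 1} #S ≤ Cardinal.lift.{v} #(Set.Iio μ.ord) := by
    rw [Cardinal.mk_Iio_ordinal, Cardinal.card_ord, Cardinal.lift_lift]
    exact hS
  obtain ⟨e⟩ := Cardinal.lift_mk_le'.1 h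
  refine ⟨fun α => if h : ∃ x : S, (e x : Ordinal) = α then h.choose else x₀, fun α => ?_,
    fun x hx => ⟨e ⟨x, hx⟩, (e ⟨x, hx⟩).2, ?_⟩⟩
  · dsimp only
    split_ifs with h
    exacts [h.choose.2, hx₀]
  · have hex : ∃ y : S, (e y : Ordinal) = e ⟨x, hx⟩ := ⟨_, rfl⟩
    dsimp only
    rw [dif_pos hex]
    exact congrArg Subtype.val (e.injective (Subtype.ext hex.choose_spec))

/-- A set of size `≤ μ` which is covered by an increasing union of length `μ⁺` is covered at a
proper stage. -/
theorem Ordinal.exists_stage {U : Type u} {μ : Cardinal.{u}} (hμ : ℵ₀ ≤ μ) {X : Type u}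
    (hX : #X ≤ μ) (f : X → U) {S : Ordinal.{u} → Set U}
    (hS : ∀ α β, α ≤ β → β < (Order.succ μ).ord → S α ⊆ S β)
    (hf : ∀ x, ∃ α < (Order.succ μ).ord, f x ∈ S α) :
    ∃ α < (Order.succ μ).ord, ∀ x, f x ∈ S α := by
  choose a ha hxa using hf
  have hreg := Cardinal.isRegular_succ hμ
  -- Regularity of μ⁺: a supremum of at most μ stages is still a proper stage.
  have hlt : ⨆ x, a x < (Order.succ μ).ord := by
    refine Ordinal.iSup_lt_of_lt_cof ?_ ha
    rw [hreg.cof_ord]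
    exact Order.lt_succ_of_le hX
  exact ⟨_, hlt, fun x => hS _ _ (Ordinal.le_iSup a x) hlt (hxa x)⟩

namespace CModel

variable {L : FirstOrder.Language.{u, u}} {K : AEC L} {U : Type u} {μ : Cardinal.{u}}

/-- An extension in `K_μ` can be made concrete. -/
theorem exists_concrete_ext_card [Infinite U] (hU : μ < #U) {M : CModel L U} {X : Type u}
    [L.Structure X] (e : M.carrier ↪[L] X) (he : K.IsEmb e) (hX : K.MemCard μ X) :
    ∃ (N : CModel L U) (φ : X ≃[L] N.carrier), Le K M N ∧ K.MemCard μ N.carrier ∧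
      ∀ x, (φ (e x) : U) = x := by
  obtain ⟨N, φ, h, hφ⟩ := exists_concrete_ext e he (hX.2.le.trans hU.le)
    ((Cardinal.mk_le_of_injective e.injective).trans_lt (hX.2 ▸ hU))
  exact ⟨N, φ, h, hX.of_equiv φ, hφ⟩

/-- By stability the types over `M` are listed in order type μ. Step α amalgamates the current model
over `M` with a realization of the α-th type; after μ steps the union still has size μ. -/
theorem exists_realizing_ext [Infinite U] (hU : μ < #U) (hinf : ℵ₀ ≤ μ) (hμ : K.LST ≤ μ)
    (hAP : K.Amalgamation μ) (hst : K.Stable μ) {M : CModel L U} (hM : K.MemCard μ M.carrier) :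
    ∃ (N : CModel L U) (h : Le K M N), K.MemCard μ N.carrier ∧
      ∀ p ∈ K.na M.carrier, ∃ c : N.carrier, p = AEC.tpEmb (Emb.emb h) (Emb.isEmb h) c := by
  rcases (K.na M.carrier).eq_empty_or_nonempty with hemp | ⟨p₀, hp₀⟩
  · exact ⟨M, Le.refl hM.1, hM, fun p hp => absurd hp (by simp [hemp])⟩
  obtain ⟨g, -, hg⟩ := Ordinal.exists_enum (μ := μ) (K.na M.carrier)
    (by simpa using hst M.carrier hM) p₀ hp₀
  have hlim := Cardinal.isSuccLimit_ord hinf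
  obtain ⟨F, h0, hF, hFμ, hstep⟩ := exists_model_chain (K := K) hinf μ.ord hlim.bot_lt
    (fun δ hδ => (Cardinal.lt_ord.1 hδ).le) (fun _ => True)
    (fun α _ Q => ∃ (h : Le K M Q) (c : Q.carrier),
      g α = AEC.tpEmb (Emb.emb h) (Emb.isEmb h) c) M hM trivial (by
      intro α _ Q hQ _ hMQ
      obtain ⟨B, _, f, hf, b, hB, hgb⟩ := AEC.exists_eq_tpEmb_card hμ hM (g α)
      obtain ⟨D, _, q, b', hD, hq, hb', hqb⟩ := hAP M.carrier Q.carrier B (Emb.emb hMQ) f hM hQ hB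
        (Emb.isEmb hMQ) hf
      obtain ⟨Q', φ, hQQ', hQ', hφ⟩ := exists_concrete_ext_card hU q hq hD
      refine ⟨Q', hQQ', hQ', trivial, hMQ.trans hQQ', φ (b' b), ?_⟩
      rw [hgb]
      refine AEC.tpEmb_eq_of_comp (φ.toEmbedding.comp b')
        ((AEC.isEmb_equiv φ hD.1).comp hb') (fun a => Subtype.ext ?_) rfl
      simp [← hqb, hφ])
    (fun _ _ _ _ _ _ _ _ => trivial)
  obtain ⟨N, hN⟩ := hF.exists_isUnionOf hlim.bot_lt
  have hMN : Le K M N := h0 ▸ hN.le 0 hlim.bot_lt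
  refine ⟨N, hMN, hN.memCard hlim.bot_lt hinf (by simp) fun α hα => (hFμ α hα).1, ?_⟩
  intro p hp
  obtain ⟨α, hα, rfl⟩ := hg p hp
  have hα' : α + 1 < μ.ord := hlim.succ_lt hα
  obtain ⟨h, c, hc⟩ := hstep α hα'
  refine ⟨Emb.emb (hN.le _ hα') c, hc.trans ?_⟩
  exact AEC.tpEmb_eq_of_comp _ (Emb.isEmb (hN.le _ hα'))
    (fun a => Subtype.ext (by simp)) rfl

/-- `N` is the union of a chain `F` of length μ in which each model realizes all nonalgebraic types
over its predecessor. To embed an extension P of `M` in `N`, one works backwards: the `F α` are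
embedded in growing extensions of P so that the α-th element of P is in the range at stage α + 1. In
the limit the range contains P, and the map is inverted on P. -/
theorem exists_universal_concrete [Infinite U] (hU : μ < #U) (hinf : ℵ₀ ≤ μ) (hμ : K.LST ≤ μ)
    (hAP : K.Amalgamation μ) (hst : K.Stable μ) {M : CModel L U} (hM : K.MemCard μ M.carrier) :
    ∃ (N : CModel L U) (h : Le K M N), K.MemCard μ N.carrier ∧
      ∀ (M' : Type u) [L.Structure M'] (f : M.carrier ↪[L] M'), K.MemCard μ M' → K.IsEmb f →
        ∃ g : M' ↪[L] N.carrier, K.IsEmb g ∧ ∀ x, g (f x) = Emb.emb h x := by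
  have hlim := Cardinal.isSuccLimit_ord hinf
  have hcard : ∀ δ < μ.ord, δ.card ≤ μ := fun δ hδ => (Cardinal.lt_ord.1 hδ).le
  obtain ⟨F, h0, hF, hFμ, hstep⟩ := exists_model_chain (K := K) hinf μ.ord hlim.bot_lt
    hcard (fun _ => True)
    (fun α P Q => ∃ (h : Le K P Q), ∀ p ∈ K.na P.carrier, ∃ c : Q.carrier,
      p = AEC.tpEmb (Emb.emb h) (Emb.isEmb h) c) M hM trivial (by
      intro α _ Q hQ _ _
      obtain ⟨N, h, hN, hna⟩ := exists_realizing_ext hU hinf hμ hAP hst hQ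
      exact ⟨N, h, hN, trivial, h, hna⟩)
    (fun _ _ _ _ _ _ _ _ => trivial)
  obtain ⟨N, hN⟩ := hF.exists_isUnionOf hlim.bot_lt
  have hMN : Le K M N := h0 ▸ hN.le 0 hlim.bot_lt
  refine ⟨N, hMN, hN.memCard hlim.bot_lt hinf (by simp) fun α hα => (hFμ α hα).1, ?_⟩
  intro M' _ f hM' hf
  obtain ⟨P, φ, hMP, hP, hφ⟩ := exists_concrete_ext_card hU f hf hM'
  have hPne : P.carrier.Nonempty := by
    have : #P.carrier ≠ 0 := by
      rw [hP.2]
      exact (aleph0_pos.trans_le hinf).ne'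
    exact Set.nonempty_coe_sort.1 (Cardinal.mk_ne_zero_iff.1 this)
  obtain ⟨p₀, hp₀⟩ := hPne
  obtain ⟨a, haP, ha⟩ := Ordinal.exists_enum (μ := μ) P.carrier
    (by simpa using hP.2.le) p₀ hp₀
  obtain ⟨G, hG0, hG, hGgood, hGstep⟩ := EmbNode.exists_chain_over hinf μ.ord hlim.bot_lt
    hcard F hF (fun α _ n' => ∃ y ∈ n'.dom.carrier, n'.map y = a α) ⟨M, P, id⟩ ⟨hMP, hM, hP⟩
    h0.symm (by
      intro α hα n hn hnF hle
      have hFna := hstep α hα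
      rw [← hnF] at hFna
      obtain ⟨hFle, hna⟩ := hFna
      have hmem : a α ∈ n.cod.carrier := hle.cod.subset (haP α)
      have hc : ∃ c : (F (α + 1)).carrier,
          AEC.tpEmb hn.emb.emb hn.emb.isEmb ⟨a α, hmem⟩ =
            AEC.tpEmb (Emb.emb hFle) (Emb.isEmb hFle) c := by
        -- Only nonalgebraic types are realized by construction; if `a α` is already in the range,
        -- its preimage realizes its type.
        by_cases hr : (⟨a α, hmem⟩ : n.cod.carrier) ∈ Set.range hn.emb.emb
        · obtain ⟨y, hy⟩ := hr
          refine ⟨Emb.emb hFle y, ?_⟩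
          have h1 : AEC.tpEmb (FirstOrder.Language.Embedding.refl L n.dom.carrier)
              (AEC.isEmb_refl hn.dom.1) y =
              AEC.tpEmb hn.emb.emb hn.emb.isEmb ⟨a α, hmem⟩ :=
            AEC.tpEmb_eq_of_comp hn.emb.emb hn.emb.isEmb (fun _ => rfl) hy
          rw [← h1]
          exact AEC.tpEmb_eq_of_comp (Emb.emb hFle) (Emb.isEmb hFle) (fun _ => rfl) rfl
        · exact hna _ ⟨_, _, _, hn.emb.isEmb, _, hr, rfl⟩
      obtain ⟨c, hc⟩ := hc
      -- The amalgam identifies `c` with `a α`, which puts `a α` in the range of the next map.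
      obtain ⟨D, _, f', g', hD, hf', hg', hfg, hfgc⟩ := AEC.exists_amalg_of_tpEmb_eq hμ hAP
        hn.dom hn.cod (hFμ _ hα).1 hc
      obtain ⟨Q, ψ, hle', hQ, hψ⟩ := exists_concrete_ext_card hU f' hf' hD
      have : Nonempty U := ⟨p₀⟩
      obtain ⟨j, hj, hjx⟩ := exists_emb_map (ψ.toEmbedding.comp g')
        ((AEC.isEmb_equiv ψ hD.1).comp hg')
      refine ⟨⟨F (α + 1), Q, j⟩, ⟨hFle, hle', ?_⟩, ⟨hj, (hFμ _ hα).1, hQ⟩, rfl, c, c.2, ?_⟩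
      · intro x hx
        have h1 := hjx (Emb.emb hFle ⟨x, hx⟩)
        rw [Le.emb_apply] at h1
        refine h1.trans ?_
        have h2 := hψ (hn.emb.emb ⟨x, hx⟩)
        rw [hfg, hn.emb.emb_apply] at h2
        exact h2
      · refine (hjx c).trans ?_
        have h2 := hψ ⟨a α, hmem⟩
        rw [hfgc] at h2
        exact h2)
  obtain ⟨B, hB⟩ := hG.cod.exists_isUnionOf hlim.bot_lt
  have hA : IsUnionOf K μ.ord (fun α => (G α).dom) N := by
    refine ⟨fun x hx => ?_, fun α hα => ?_⟩
    · obtain ⟨α, hα, h⟩ := hN.exists_mem hx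
      exact Set.mem_biUnion (s := Set.Iio μ.ord) hα ((hGgood α hα).2 ▸ h)
    · rw [(hGgood α hα).2]
      exact hN.le α hα
  obtain ⟨j, hj, hjx⟩ := hG.exists_map hlim.bot_lt (fun α hα => (hGgood α hα).1.emb) hA hB
  have hPB : Le K P B := by
    have := hB.le 0 hlim.bot_lt
    rwa [hG0] at this
  have hsurj : ∀ x : P.carrier, ∃ y : N.carrier, hj.emb y = Emb.emb hPB x := by
    intro x
    obtain ⟨α, hα, hax⟩ := ha x x.2
    have hα' : α + 1 < μ.ord := hlim.succ_lt hα
    obtain ⟨y, hy, hyx⟩ := hGstep α hα'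
    refine ⟨⟨y, (hA.le _ hα').subset hy⟩, Subtype.ext ?_⟩
    rw [hj.emb_apply, Le.emb_apply, ← hax, ← hyx]
    exact hjx _ hα' y hy
  obtain ⟨i, hi, hij⟩ := AEC.exists_factor (Emb.isEmb hPB) hj.isEmb hsurj
  refine ⟨i.comp φ.toEmbedding, hi.comp (AEC.isEmb_equiv φ hM'.1), fun x => ?_⟩
  apply hj.emb.injective
  apply Subtype.ext
  change ((hj.emb (i (φ (f x))) : B.carrier) : U) = _
  rw [hij, Le.emb_apply, hφ, hj.emb_apply, Le.emb_apply]
  have h1 := hjx 0 hlim.bot_lt x (by rw [hG0]; exact x.2)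
  rw [h1, hG0]
  rfl

end CModel

namespace AEC

variable {L : FirstOrder.Language.{u, u}} {K : AEC L} {μ : Cardinal.{u}}

/-- In a stable class with amalgamation every model has a universal extension. -/
theorem exists_universal (hinf : ℵ₀ ≤ μ) (hμ : K.LST ≤ μ) (hAP : K.Amalgamation μ)
    (hst : K.Stable μ) (M : Type u) [L.Structure M] (hM : K.MemCard μ M) :
    ∃ (N : Type u) (_ : L.Structure N) (e : M ↪[L] N), K.MemCard μ N ∧ K.IsEmb e ∧
      ∀ (M' : Type u) [L.Structure M'] (f : M ↪[L] M'), K.MemCard μ M' → K.IsEmb f →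
        ∃ g : M' ↪[L] N, K.IsEmb g ∧ ∀ x, g (f x) = e x := by
  let U : Type u := (Order.succ μ).out
  have hU : #U = Order.succ μ := Cardinal.mk_out _
  have hU' : μ < #U := hU ▸ Order.lt_succ μ
  have : Infinite U := Cardinal.infinite_iff.2 (hinf.trans hU'.le)
  obtain ⟨M₁, ⟨φ⟩⟩ := CModel.exists_concrete (L := L) (U := U) (X := M) (hM.2.le.trans hU'.le)
  have hM₁ := hM.of_equiv φ
  obtain ⟨N, h, hN, huniv⟩ := CModel.exists_universal_concrete hU' hinf hμ hAP hst hM₁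
  refine ⟨N.carrier, inferInstance, (CModel.Emb.emb h).comp φ.toEmbedding, hN,
    (CModel.Emb.isEmb h).comp (isEmb_equiv φ hM.1), ?_⟩
  intro M' _ f hM' hf
  obtain ⟨g, hg, hgx⟩ := huniv M' (f.comp φ.symm.toEmbedding) hM'
    (hf.comp (isEmb_equiv _ hM₁.1))
  refine ⟨g, hg, fun x => ?_⟩
  have := hgx (φ x)
  simpa using this

end AEC

namespace CModel

variable {L : FirstOrder.Language.{u, u}} {K : AEC L} {U : Type u} {lam : Cardinal.{u}}

/-- Every model in `K_{λ⁺}` is the union of a continuous chain of submodels in `K_λ`, starting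
with a given one. -/
theorem exists_filtration (hinf : ℵ₀ ≤ lam) (hlam : K.LST ≤ lam) {M N : CModel L U}
    (hM : K.MemCard (Order.succ lam) M.carrier) (hN : K.MemCard lam N.carrier) (hNM : Le K N M) :
    ∃ F : Ordinal.{u} → CModel L U, F 0 = N ∧ IsChain K (Order.succ lam).ord F ∧
      (∀ α < (Order.succ lam).ord, K.MemCard lam (F α).carrier) ∧
      IsUnionOf K (Order.succ lam).ord F M := by
  have hlim := Cardinal.isSuccLimit_ord (hinf.trans (Order.le_succ lam))
  have hMne : M.carrier.Nonempty := by
    have : #M.carrier ≠ 0 := by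
      rw [hM.2]
      exact (Order.bot_lt_succ lam).ne'
    exact Set.nonempty_coe_sort.1 (Cardinal.mk_ne_zero_iff.1 this)
  obtain ⟨m₀, hm₀⟩ := hMne
  obtain ⟨m, hmM, hm⟩ := Ordinal.exists_enum (μ := Order.succ lam) M.carrier
    (Cardinal.lift_le.2 hM.2.le) m₀ hm₀
  obtain ⟨F, h0, hF, hFc, hstep⟩ := exists_model_chain (K := K) hinf (Order.succ lam).ord
    hlim.bot_lt (fun δ hδ => Order.lt_succ_iff.1 (Cardinal.lt_ord.1 hδ)) (fun X => Le K X M)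
    (fun α _ Y => m α ∈ Y.carrier) N hN hNM (by
      intro α _ X hX hXM _
      have hZ : #(insert ⟨m α, hmM α⟩ (Set.range (Emb.emb hXM)) : Set M.carrier) ≤ lam := by
        refine (Cardinal.mk_insert_le).trans (Cardinal.add_le_of_le hinf ?_ ?_)
        · exact Cardinal.mk_range_le.trans hX.2.le
        · exact Cardinal.one_le_aleph0.trans hinf
      obtain ⟨Y, _, i, hi, hY, hsub⟩ := AEC.exists_emb_card hlam hM.1
        (hM.2 ▸ Order.le_succ lam) _ hZ
      obtain ⟨Y', φ, hY'M, hφ⟩ := exists_image i hi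
      have hmem : ∀ z ∈ (insert ⟨m α, hmM α⟩ (Set.range (Emb.emb hXM)) : Set M.carrier),
          (z : U) ∈ Y'.carrier := by
        intro z hz
        obtain ⟨y, rfl⟩ := hsub hz
        rw [← hφ]
        exact (φ y).2
      refine ⟨Y', hXM.of_subset hY'M fun x hx => ?_, hY.of_equiv φ, hY'M,
        hmem _ (Set.mem_insert _ _)⟩
      have := hmem _ (Set.mem_insert_of_mem _ ⟨⟨x, hx⟩, rfl⟩)
      simpa using this)
    (fun δ _ hδ F hF hFM N hN => hN.emb hδ.bot_lt hF hFM)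
  refine ⟨F, h0, hF, fun α hα => (hFc α hα).1, fun x hx => ?_, fun α hα => (hFc α hα).2⟩
  obtain ⟨α, hα, rfl⟩ := hm x hx
  exact Set.mem_biUnion (s := Set.Iio (Order.succ lam).ord) (hlim.succ_lt hα)
    (hstep α (hlim.succ_lt hα))

end CModel

/-! ### Amalgamation between λ and λ⁺, and homogeneous models in λ⁺ -/

namespace AEC

open CModel

variable {L : FirstOrder.Language.{u, u}} {K : AEC L} {lam : Cardinal.{u}}

/-- Amalgamation of a model in `K_λ` with a model in `K_{λ⁺}` over a model in `K_λ`. -/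
theorem exists_amalg_succ (hinf : ℵ₀ ≤ lam) (hlam : K.LST ≤ lam) (hAP : K.Amalgamation lam)
    {N M N' : Type u} [L.Structure N] [L.Structure M] [L.Structure N'] (hN : K.MemCard lam N)
    (hM : K.MemCard (Order.succ lam) M) (hN' : K.MemCard lam N') (e : N ↪[L] M) (he : K.IsEmb e)
    (f : N ↪[L] N') (hf : K.IsEmb f) :
    ∃ (M' : Type u) (_ : L.Structure M') (g : M ↪[L] M') (h : N' ↪[L] M'),
      K.MemCard (Order.succ lam) M' ∧ K.IsEmb g ∧ K.IsEmb h ∧ ∀ x, g (e x) = h (f x) := by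
  let U : Type u := (Order.succ lam).out
  have hU : #U = Order.succ lam := Cardinal.mk_out _
  have hU' : lam < #U := hU ▸ Order.lt_succ lam
  have : Infinite U := Cardinal.infinite_iff.2 (hinf.trans hU'.le)
  have hlim := Cardinal.isSuccLimit_ord (hinf.trans (Order.le_succ lam))
  obtain ⟨M₁, ⟨φ⟩⟩ := CModel.exists_concrete (L := L) (U := U) (X := M) (hM.2.le.trans hU.ge)
  obtain ⟨N₁, ψ, hNM, hψ⟩ := exists_image (φ.toEmbedding.comp e)
    ((isEmb_equiv φ hM.1).comp he)
  obtain ⟨F, h0, hF, hFc, hFM⟩ := exists_filtration hinf hlam (hM.of_equiv φ) (hN.of_equiv ψ) hNM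
  obtain ⟨P, χ, hle, hP, hχ⟩ := exists_concrete_ext_card hU' (f.comp ψ.symm.toEmbedding)
    (hf.comp (isEmb_equiv ψ.symm (hN.of_equiv ψ).1)) hN'
  -- `M` is filtered by models of size λ starting with the image of `N`, and the copy `P` of `N'` is
  -- amalgamated with the members of the filtration one after another; only amalgamation in λ is
  -- needed.
  obtain ⟨G, hG0, hG, hGgood, -⟩ := EmbNode.exists_chain_over hinf (Order.succ lam).ord
    hlim.bot_lt (fun δ hδ => Order.lt_succ_iff.1 (Cardinal.lt_ord.1 hδ)) F hF
    (fun _ _ _ => True) ⟨N₁, P, id⟩ ⟨hle, hN.of_equiv ψ, hP⟩ h0.symm (by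
      intro α hα n hn hnF _
      have hFle : Le K n.dom (F (α + 1)) :=
        hnF ▸ hF.le _ _ (Order.le_succ α) hα
      obtain ⟨D, _, g', f', hD, hg', hf', hfg⟩ := hAP _ _ _ (Emb.emb hFle) hn.emb.emb hn.dom
        (hFc _ hα) hn.cod (Emb.isEmb hFle) hn.emb.isEmb
      obtain ⟨Q, ψ, hle', hQ, hψ⟩ := exists_concrete_ext_card hU' f' hf' hD
      obtain ⟨j, hj, hjx⟩ := exists_emb_map (ψ.toEmbedding.comp g')
        ((AEC.isEmb_equiv ψ hD.1).comp hg')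
      refine ⟨⟨F (α + 1), Q, j⟩, ⟨hFle, hle', ?_⟩, ⟨hj, hFc _ hα, hQ⟩, rfl, trivial⟩
      intro x hx
      have h1 := hjx (Emb.emb hFle ⟨x, hx⟩)
      rw [Le.emb_apply] at h1
      refine h1.trans ?_
      have h2 := hψ (hn.emb.emb ⟨x, hx⟩)
      rw [← hfg, hn.emb.emb_apply] at h2
      exact h2)
  obtain ⟨B, hB⟩ := hG.cod.exists_isUnionOf hlim.bot_lt
  have hA : IsUnionOf K (Order.succ lam).ord (fun α => (G α).dom) M₁ := by
    refine ⟨fun x hx => ?_, fun α hα => ?_⟩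
    · obtain ⟨α, hα, h⟩ := hFM.exists_mem hx
      exact Set.mem_biUnion (s := Set.Iio (Order.succ lam).ord) hα ((hGgood α hα).2 ▸ h)
    · rw [(hGgood α hα).2]
      exact hFM.le α hα
  obtain ⟨j, hj, hjx⟩ := hG.exists_map hlim.bot_lt (fun α hα => (hGgood α hα).1.emb) hA hB
  have hPB : Le K P B := by
    have := hB.le 0 hlim.bot_lt
    rwa [hG0] at this
  refine ⟨B.carrier, inferInstance, hj.emb.comp φ.toEmbedding,
    (Emb.emb hPB).comp χ.toEmbedding, ⟨hj.mem_right, le_antisymm ?_ ?_⟩,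
    hj.isEmb.comp (isEmb_equiv φ hM.1), (Emb.isEmb hPB).comp (isEmb_equiv χ hN'.1),
    fun x => Subtype.ext ?_⟩
  · exact (Cardinal.mk_set_le _).trans hU.le
  · rw [← (hM.of_equiv φ).2]
    exact Cardinal.mk_le_of_injective hj.emb.injective
  · change ((hj.emb (φ (e x)) : B.carrier) : U) = (Emb.emb hPB (χ (f x)) : B.carrier)
    have h1 := hχ (ψ x)
    have h2 : (φ (e x) : U) = ψ x := (hψ x).symm
    rw [hj.emb_apply, Le.emb_apply, h2, hjx 0 hlim.bot_lt _ (by rw [hG0]; exact (ψ x).2), hG0]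
    simpa using h1.symm

/-- Models in `K_λ` have extensions in `K_{λ⁺}`. -/
theorem exists_ext_succ (hinf : ℵ₀ ≤ lam) (hNM : K.NoMaximalModel lam)
    {A : Type u} [L.Structure A] (hA : K.MemCard lam A) :
    ∃ (M : Type u) (_ : L.Structure M) (e : A ↪[L] M), K.MemCard (Order.succ lam) M ∧
      K.IsEmb e := by
  let U : Type u := (Order.succ lam).out
  have hU : #U = Order.succ lam := Cardinal.mk_out _
  have hU' : lam < #U := hU ▸ Order.lt_succ lam
  have : Infinite U := Cardinal.infinite_iff.2 (hinf.trans hU'.le)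
  have hlim := Cardinal.isSuccLimit_ord (hinf.trans (Order.le_succ lam))
  obtain ⟨A₁, ⟨φ⟩⟩ := CModel.exists_concrete (L := L) (U := U) (X := A) (hA.2.le.trans hU'.le)
  obtain ⟨F, h0, hF, hFc, hstep⟩ := exists_model_chain (K := K) hinf (Order.succ lam).ord
    hlim.bot_lt (fun δ hδ => Order.lt_succ_iff.1 (Cardinal.lt_ord.1 hδ)) (fun _ => True)
    (fun _ X Y => ¬ Y.carrier ⊆ X.carrier) A₁ (hA.of_equiv φ) trivial (by
      intro α _ X hX _ _
      obtain ⟨B, _, f, hB, hf, hns⟩ := hNM X.carrier hX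
      obtain ⟨Y, ψ, hXY, hY, hψ⟩ := exists_concrete_ext_card hU' f hf hB
      refine ⟨Y, hXY, hY, trivial, fun hsub => hns fun b => ⟨⟨ψ b, hsub (ψ b).2⟩, ?_⟩⟩
      apply ψ.injective
      exact Subtype.ext (hψ _))
    (fun _ _ _ _ _ _ _ _ => trivial)
  obtain ⟨N, hN⟩ := hF.exists_isUnionOf hlim.bot_lt
  have hle : Le K A₁ N := h0 ▸ hN.le 0 hlim.bot_lt
  refine ⟨N.carrier, inferInstance, (Emb.emb hle).comp φ.toEmbedding, ?_,
    (Emb.isEmb hle).comp (isEmb_equiv φ hA.1)⟩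
  exact hN.memCard_succ hinf (fun α hα => (hFc α hα).1.2.le)
    (fun α β h h' => (hF.le α β h h').subset) (fun α hα => hstep α (hlim.succ_lt hα))

/-- A model in `K_{λ⁺}` which is homogeneous and contains a given model in `K_λ`. -/
theorem exists_homogeneous (hinf : ℵ₀ ≤ lam) (hlam : K.LST ≤ lam) (hAP : K.Amalgamation lam)
    (hNM : K.NoMaximalModel lam) (hAP' : K.Amalgamation (Order.succ lam))
    (hst : K.Stable (Order.succ lam)) {A : Type u} [L.Structure A] (hA : K.MemCard lam A) :
    ∃ (M : Type u) (_ : L.Structure M), K.MemCard (Order.succ lam) M ∧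
      (∃ e : A ↪[L] M, K.IsEmb e) ∧
      ∀ (N N' : Type u) [L.Structure N] [L.Structure N'] (e : N ↪[L] M) (f : N ↪[L] N'),
        K.MemCard lam N → K.MemCard lam N' → K.IsEmb e → K.IsEmb f →
        ∃ g : N' ↪[L] M, K.IsEmb g ∧ ∀ x, g (f x) = e x := by
  obtain ⟨M₀, _, e₀, hM₀, he₀⟩ := exists_ext_succ hinf hNM hA
  have hinf' : ℵ₀ ≤ Order.succ lam := hinf.trans (Order.le_succ lam)
  -- The chain consists of models of size λ⁺, so a set of size λ⁺⁺ is needed to leave room for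
  -- extensions.
  let U : Type u := (Order.succ (Order.succ lam)).out
  have hU : #U = Order.succ (Order.succ lam) := Cardinal.mk_out _
  have hU' : Order.succ lam < #U := hU ▸ Order.lt_succ _
  have : Infinite U := Cardinal.infinite_iff.2 (hinf'.trans hU'.le)
  have hlim := Cardinal.isSuccLimit_ord hinf'
  obtain ⟨M₁, ⟨φ⟩⟩ := CModel.exists_concrete (L := L) (U := U) (X := M₀) (hM₀.2.le.trans hU'.le)
  obtain ⟨F, h0, hF, hFc, hstep⟩ := exists_model_chain (K := K) hinf' (Order.succ lam).ord
    hlim.bot_lt (fun δ hδ => (Cardinal.lt_ord.1 hδ).le) (fun _ => True)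
    (fun _ X Y => ∃ h : Le K X Y, ∀ (Z : Type u) [L.Structure Z] (f : X.carrier ↪[L] Z),
      K.MemCard (Order.succ lam) Z → K.IsEmb f →
        ∃ g : Z ↪[L] Y.carrier, K.IsEmb g ∧ ∀ x, g (f x) = Emb.emb h x)
    M₁ (hM₀.of_equiv φ) trivial (by
      intro α _ X hX _ _
      obtain ⟨N, h, hN, huniv⟩ := exists_universal_concrete hU' hinf'
        (hlam.trans (Order.le_succ lam)) hAP' hst hX
      exact ⟨N, h, hN, trivial, h, huniv⟩)
    (fun _ _ _ _ _ _ _ _ => trivial)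
  obtain ⟨M, hM⟩ := hF.exists_isUnionOf hlim.bot_lt
  have hle : Le K M₁ M := h0 ▸ hM.le 0 hlim.bot_lt
  refine ⟨M.carrier, inferInstance, hM.memCard hlim.bot_lt hinf' (by simp)
    fun α hα => (hFc α hα).1, ⟨((Emb.emb hle).comp φ.toEmbedding).comp e₀,
      ((Emb.isEmb hle).comp (isEmb_equiv φ hM₀.1)).comp he₀⟩, ?_⟩
  intro N N' _ _ e f hN hN' he hf
  -- The image of `N` already lies in some `F α`. Amalgamating `F α` with `N'` over `N` gives an
  -- extension of `F α` of size λ⁺, which embeds in `F (α + 1)` by universality.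
  obtain ⟨α, hα, hαe⟩ := Ordinal.exists_stage hinf hN.2.le (fun x => (e x : U))
    (S := fun α => (F α).carrier) (fun α β h h' => (hF.le α β h h').subset)
    (fun x => hM.exists_mem (e x).2)
  have hα' : α + 1 < (Order.succ lam).ord := hlim.succ_lt hα
  obtain ⟨e', he', hee⟩ := exists_factor he (Emb.isEmb (hM.le α hα))
    (fun x => ⟨⟨e x, hαe x⟩, Subtype.ext (Le.emb_apply (hM.le α hα) _)⟩)
  obtain ⟨M', _, g, k, hM', hg, hk, hgk⟩ := exists_amalg_succ hinf hlam hAP hN (hFc α hα).1 hN'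
    e' he' f hf
  obtain ⟨h, huniv⟩ := hstep α hα'
  obtain ⟨i, hi, hig⟩ := huniv M' g hM' hg
  refine ⟨((Emb.emb (hM.le _ hα')).comp i).comp k, ((Emb.isEmb (hM.le _ hα')).comp hi).comp hk,
    fun x => Subtype.ext ?_⟩
  change ((Emb.emb (hM.le _ hα') (i (k (f x))) : M.carrier) : U) = _
  rw [Le.emb_apply, ← hgk, hig, Le.emb_apply, ← hee, Le.emb_apply]

end AEC

/-! ### Restriction and number of Galois types -/

namespace AEC

variable {L : FirstOrder.Language.{u, u}} {K : AEC L}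

theorem restrictEmb_restrictEmb {A B C : Type u} [L.Structure A] [L.Structure B] [L.Structure C]
    (f : A ↪[L] B) (hf : K.IsEmb f) (g : B ↪[L] C) (hg : K.IsEmb g) (p : K.GaloisType C) :
    restrictEmb f hf (restrictEmb g hg p) = restrictEmb (g.comp f) (hg.comp hf) p := by
  induction p using Quot.ind with
  | mk e => rfl

theorem restrictEmb_id {A : Type u} [L.Structure A] (f : A ↪[L] A) (hf : K.IsEmb f)
    (h : ∀ a, f a = a) (p : K.GaloisType A) : restrictEmb f hf p = p := by
  obtain rfl : f = FirstOrder.Language.Embedding.refl L A := by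
    ext a
    exact h a
  obtain ⟨B, _, g, hg, b, rfl⟩ := exists_eq_tpEmb p
  rfl

theorem restrictEmb_congr {A B : Type u} [L.Structure A] [L.Structure B] {f g : A ↪[L] B}
    {hf : K.IsEmb f} {hg : K.IsEmb g} (h : ∀ a, f a = g a) (p : K.GaloisType B) :
    restrictEmb f hf p = restrictEmb g hg p := by
  obtain rfl : f = g := by
    ext a
    exact h a
  rfl

theorem tpEmb_congr {A B : Type u} [L.Structure A] [L.Structure B] {f g : A ↪[L] B}
    {hf : K.IsEmb f} {hg : K.IsEmb g} {b c : B} (h : ∀ a, f a = g a) (hbc : b = c) :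
    tpEmb f hf b = tpEmb g hg c := by
  obtain rfl : f = g := by
    ext a
    exact h a
  rw [hbc]

/-- Restriction of types along a surjective embedding is injective. -/
theorem restrictEmb_injective {A B : Type u} [L.Structure A] [L.Structure B] (f : A ↪[L] B)
    (hf : K.IsEmb f) (hs : Function.Surjective f) : Function.Injective (restrictEmb f hf) := by
  obtain ⟨i, hi, h⟩ := exists_factor (isEmb_refl hf.mem_right) hf hs
  intro p q hpq
  have := congrArg (restrictEmb i hi) hpq
  rwa [restrictEmb_restrictEmb, restrictEmb_restrictEmb, restrictEmb_id _ _ h,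
    restrictEmb_id _ _ h] at this

/-- In a stable class, there are at most `μ` types over a model of size `μ`. -/
theorem mk_galoisType_le {μ : Cardinal.{u}} (hinf : ℵ₀ ≤ μ) (hst : K.Stable μ) {M : Type u}
    [L.Structure M] (hM : K.MemCard μ M) :
    #(K.GaloisType M) ≤ Cardinal.lift.{u + 1} μ := by
  -- Stability counts nonalgebraic types only; the algebraic ones are indexed by the elements of
  -- `M`.
  have hcover : (Set.univ : Set (K.GaloisType M)) ⊆ K.na M ∪ Set.range fun m : M =>
      tpEmb (FirstOrder.Language.Embedding.refl L M) (isEmb_refl hM.1) m := by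
    intro p _
    obtain ⟨B, _, f, hf, b, rfl⟩ := exists_eq_tpEmb p
    by_cases hb : b ∈ Set.range f
    · obtain ⟨m, rfl⟩ := hb
      exact Or.inr ⟨m, tpEmb_eq_of_comp f hf (fun _ => rfl) rfl⟩
    · exact Or.inl ⟨B, inferInstance, f, hf, b, hb, rfl⟩
  have hinf' : ℵ₀ ≤ Cardinal.lift.{u + 1} μ := by simpa using hinf
  rw [← Cardinal.mk_univ]
  refine (Cardinal.mk_le_mk_of_subset hcover).trans ((Cardinal.mk_union_le _ _).trans ?_)
  refine Cardinal.add_le_of_le hinf' (hst M hM) ?_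
  have := Cardinal.mk_range_le_lift (f := fun m : M =>
      tpEmb (K := K) (FirstOrder.Language.Embedding.refl L M) (isEmb_refl hM.1) m)
  exact (Cardinal.lift_id'.{u, u + 1} _).symm.le.trans
    (this.trans_eq (congrArg Cardinal.lift hM.2))

end AEC

/-! ### Nonforking along isomorphisms, embeddings and chains -/

namespace PreFrame

open AEC

variable {L : FirstOrder.Language.{u, u}} {lam : Cardinal.{u}} {s : PreFrame L lam}

theorem DoesNotFork.transfer {B B' : Type u} [L.Structure B] [L.Structure B']
    {p : s.K.GaloisType B} {A : L.Substructure B} (h : s.DoesNotFork p A) (φ : B' ≃[L] B)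
    (hφ : s.K.IsEmb φ.toEmbedding) {A' : L.Substructure B'} (hA : ∀ x, x ∈ A' ↔ φ x ∈ A) :
    s.DoesNotFork (restrictEmb φ.toEmbedding hφ p) A' := by
  obtain ⟨C, _, i, hi, c, rfl, hd⟩ := h
  refine ⟨C, inferInstance, i.comp φ.toEmbedding, hi.comp hφ, c, rfl, ?_⟩
  have h1 : A'.map (i.comp φ.toEmbedding).toHom = A.map i.toHom := by
    ext x
    simp only [FirstOrder.Language.Substructure.mem_map]
    constructor
    · rintro ⟨a, ha, rfl⟩
      exact ⟨φ a, (hA a).1 ha, rfl⟩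
    · rintro ⟨a, ha, rfl⟩
      refine ⟨φ.symm a, (hA _).2 (by simpa using ha), ?_⟩
      simp
  have h2 : (i.comp φ.toEmbedding).toHom.range = i.toHom.range := by
    ext x
    simp only [FirstOrder.Language.Hom.mem_range]
    constructor
    · rintro ⟨a, rfl⟩
      exact ⟨φ a, rfl⟩
    · rintro ⟨a, rfl⟩
      exact ⟨φ.symm a, by simp⟩
  rw [h1, h2]
  exact hd

theorem DoesNotFork.notMem_range {A B : Type u} [L.Structure A] [L.Structure B] {f : A ↪[L] B}
    {hf : s.K.IsEmb f} {b : B} {A₀ : L.Substructure A}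
    (h : s.DoesNotFork (tpEmb f hf b) A₀) : b ∉ Set.range f := by
  obtain ⟨C, _, i, hi, c, hp, hd⟩ := h
  rw [mem_range_of_tpEmb_eq hp]
  exact (s.dnf_dom hd).2.2.2.2.2

/-- Monotonicity raises the base of `dnf` from the image of `A` to the image of `B`, and then
`dnf_basic` applies. As `dnf_mono` starts from submodels of a common structure, `C` is first
replaced by its substructure `⊤`; `bs_iso` moves the result from the image of `B` back to `B`. -/
theorem DoesNotFork.mem_bs {B : Type u} [L.Structure B] {p : s.K.GaloisType B}
    {A : L.Substructure B} (h : s.DoesNotFork p A) : p ∈ s.bs B := by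
  obtain ⟨C, _, i, hi, c, rfl, hd⟩ := h
  obtain ⟨hA, hB, hC, hAB, hBC, hc⟩ := s.dnf_dom hd
  have hrefl : ∀ {X : L.Substructure C}, s.K.Strong C X → s.K.Le X X :=
    fun h => s.K.coherence le_rfl h h
  have htop : s.K.Strong C (⊤ : L.Substructure C) := s.K.strong_refl hC.1
  have hCtop : s.K.MemCard lam (⊤ : L.Substructure C) :=
    hC.of_equiv FirstOrder.Language.Substructure.topEquiv.symm
  have hin : s.dnfIn (A.map i.toHom) i.toHom.range c (⊤ : L.Substructure C) := by
    refine ⟨trivial, ?_⟩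
    have := s.dnf_iso (FirstOrder.Language.Substructure.topEquiv (L := L) (M := C)).symm hd
    have hmap : ∀ X : L.Substructure C, X.map
        (FirstOrder.Language.Substructure.topEquiv (L := L) (M := C)).symm.toHom =
        X.comap (⊤ : L.Substructure C).subtype.toHom := by
      intro X
      ext ⟨x, hx⟩
      simp only [FirstOrder.Language.Substructure.mem_map,
        FirstOrder.Language.Substructure.mem_comap]
      constructor
      · rintro ⟨y, hy, hyx⟩
        have : y = x := congrArg Subtype.val hyx
        exact this ▸ hy
      · intro h
        exact ⟨x, h, rfl⟩
    rw [hmap, hmap] at this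
    exact this
  have hd' := (s.dnf_mono (A.map i.toHom) i.toHom.range i.toHom.range i.toHom.range ⊤ ⊤ c
    hA hB hB hB hCtop hCtop hC hAB (hrefl hBC) (hrefl hBC) (s.K.coherence le_top hBC htop)
    (hrefl htop) htop trivial hc hin).2
  have hbs := s.dnf_basic _ hBC c hd'
  exact s.bs_iso i.toHom.range.subtype (isEmb_subtype hBC) i hi i.equivRange.symm
    (FirstOrder.Language.Equiv.refl L C) c hB hC (by
      intro b
      obtain ⟨a, rfl⟩ := i.equivRange.surjective b
      simp [FirstOrder.Language.Equiv.refl_apply]) (by simpa using hc) hbs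

/-- Transitivity of nonforking, for embeddings. -/
theorem Transitivity.trans (hT : s.Transitivity) {A₀ A₁ A₂ : Type u} [L.Structure A₀]
    [L.Structure A₁] [L.Structure A₂] (hA₀ : s.K.MemCard lam A₀) (hA₁ : s.K.MemCard lam A₁)
    (hA₂ : s.K.MemCard lam A₂) (e₁ : A₀ ↪[L] A₁) (he₁ : s.K.IsEmb e₁) (e₂ : A₁ ↪[L] A₂)
    (he₂ : s.K.IsEmb e₂) {p : s.K.GaloisType A₂} (h₂ : s.DoesNotFork p e₂.toHom.range)
    (h₁ : s.DoesNotFork (restrictEmb e₂ he₂ p) e₁.toHom.range) :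
    s.DoesNotFork p (e₂.comp e₁).toHom.range := by
  refine hT A₂ (e₂.comp e₁).toHom.range e₂.toHom.range he₂
    (hA₀.of_equiv (e₂.comp e₁).equivRange) (hA₁.of_equiv e₂.equivRange) hA₂
    (le_range he₁ fun _ => rfl) p h₂ ?_
  have h := h₁.transfer e₂.equivRange.symm
    (isEmb_equiv _ (hA₁.of_equiv e₂.equivRange).1)
    (A' := (e₂.comp e₁).toHom.range.comap e₂.toHom.range.subtype.toHom) (by
      intro x
      obtain ⟨a, rfl⟩ := e₂.equivRange.surjective x
      rw [FirstOrder.Language.Equiv.symm_apply_apply]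
      simp only [FirstOrder.Language.Substructure.mem_comap, FirstOrder.Language.Hom.mem_range]
      constructor
      · rintro ⟨y, hy⟩
        exact ⟨y, e₂.injective (hy.trans (e₂.equivRange_apply a))⟩
      · rintro ⟨y, hy⟩
        exact ⟨y, (congrArg e₂ hy).trans (e₂.equivRange_apply a).symm⟩)
  rw [restrictEmb_restrictEmb] at h
  unfold restrict
  convert h using 1
  apply restrictEmb_congr
  intro x
  obtain ⟨a, rfl⟩ := e₂.equivRange.surjective x
  simp

open CModel

/-- Continuity of nonforking, for concrete chains. -/
theorem Continuity.of_chain (hC : s.Continuity) {U : Type u} {δ : Ordinal.{u}}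
    (hδ : Order.IsSuccLimit δ) (hδlam : δ < (Order.succ lam).ord) {F : Ordinal.{u} → CModel L U}
    (hF : IsChain s.K δ F) (hFlam : ∀ α < δ, s.K.MemCard lam (F α).carrier) {N : CModel L U}
    (hN : IsUnionOf s.K δ F N) (hNlam : s.K.MemCard lam N.carrier) (p : s.K.GaloisType N.carrier)
    (hp : ∀ α (hα : α < δ), s.DoesNotFork
      (restrictEmb (Emb.emb (hN.le α hα)) (Emb.isEmb (hN.le α hα)) p)
      (Emb.emb (hF.le 0 α zero_le hα)).toHom.range) :
    s.DoesNotFork p (Emb.emb (hN.le 0 hδ.bot_lt)).toHom.range := by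
  classical
  let A : Ordinal.{u} → L.Substructure N.carrier := fun α =>
    if h : α < δ then (Emb.emb (hN.le α h)).toHom.range else ⊤
  have hA : ∀ α (h : α < δ), A α = (Emb.emb (hN.le α h)).toHom.range := fun α h => dif_pos h
  have hmem : ∀ α (h : α < δ) (x : N.carrier), x ∈ A α ↔ (x : U) ∈ (F α).carrier := by
    intro α h x
    rw [hA α h, FirstOrder.Language.Hom.mem_range]
    constructor
    · rintro ⟨y, rfl⟩
      simp
    · intro hx
      exact ⟨⟨x, hx⟩, Subtype.ext (by simp)⟩
  have hstr : ∀ α < δ, s.K.Strong N.carrier (A α) := by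
    intro α h
    rw [hA α h]
    exact Emb.isEmb (hN.le α h)
  have hAlam : ∀ α < δ, s.K.MemCard lam (A α) := by
    intro α h
    rw [hA α h]
    exact (hFlam α h).of_equiv (Emb.emb (hN.le α h)).equivRange
  have := (hC N.carrier δ A hstr hδ hδlam hNlam hAlam ⟨fun α h => (hAlam α h).1, ?_⟩ ?_ ?_ p ?_).2
  · rwa [hA 0 hδ.bot_lt] at this
  · intro α β h hβ
    rw [hA α (h.trans_lt hβ), hA β hβ]
    exact le_range (Emb.isEmb (hF.le α β h hβ)) (fun x => Subtype.ext (by simp))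
  · intro γ hγ hlim x
    rw [hmem γ hγ]
    constructor
    · intro hx
      obtain ⟨α, hα, hxα⟩ := (hF.isUnionOf hγ hlim).exists_mem hx
      exact ⟨α, hα, (hmem α (hα.trans hγ) x).2 hxα⟩
    · rintro ⟨α, hα, hx⟩
      exact (hF.le α γ hα.le hγ).subset ((hmem α (hα.trans hγ) x).1 hx)
  · intro x
    simp only [FirstOrder.Language.Substructure.mem_top, true_iff]
    obtain ⟨α, hα, hx⟩ := hN.exists_mem x.2
    exact ⟨α, hα, (hmem α hα x).2 hx⟩
  · intro α hα
    have hmem0 := hmem 0 hδ.bot_lt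
    have hmemα := hmem α hα
    -- `A α` equals the range only propositionally, and the restricted type depends on it; a
    -- variable `X` permits the substitution.
    have key : ∀ (X : L.Substructure N.carrier) (hX : s.K.Strong N.carrier X),
        X = (Emb.emb (hN.le α hα)).toHom.range →
        s.DoesNotFork (restrict p X hX) ((A 0).comap X.subtype.toHom) := by
      rintro X hX rfl
      have h := (hp α hα).transfer (Emb.emb (hN.le α hα)).equivRange.symm
        (isEmb_equiv _ ((hFlam α hα).of_equiv (Emb.emb (hN.le α hα)).equivRange).1)
        (A' := (A 0).comap ((Emb.emb (hN.le α hα)).toHom.range).subtype.toHom) (by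
          intro x
          obtain ⟨a, rfl⟩ := (Emb.emb (hN.le α hα)).equivRange.surjective x
          rw [FirstOrder.Language.Equiv.symm_apply_apply]
          simp only [FirstOrder.Language.Substructure.mem_comap]
          refine (hmem0 _).trans ?_
          have ha : ((((Emb.emb (hN.le α hα)).equivRange a : N.carrier)) : U) = a := by simp
          have hcoe : ((((Emb.emb (hN.le α hα)).toHom.range).subtype.toHom
            ((Emb.emb (hN.le α hα)).equivRange a) : N.carrier) : U) = a := ha
          rw [hcoe, FirstOrder.Language.Hom.mem_range]
          constructor
          · intro h
            exact ⟨⟨a, h⟩, Subtype.ext (by simp)⟩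
          · rintro ⟨y, rfl⟩
            simp)
      rw [restrictEmb_restrictEmb] at h
      unfold restrict
      convert h using 1
      apply restrictEmb_congr
      intro x
      obtain ⟨a, rfl⟩ := (Emb.emb (hN.le α hα)).equivRange.surjective x
      simp
    exact key _ _ (hA α hα)

end PreFrame

/-! ### Guessing functions with the diamond -/

/-- The usual ω-fold iteration: `f β` bounds the values of `c` below `β`, and uncountable cofinality
keeps the supremum of the iterates below κ. -/
theorem Cardinal.IsRegular.exists_closed {κ : Cardinal.{u}} (hκ : κ.IsRegular) (hκ' : ℵ₀ < κ)
    (c : Ordinal.{u} → Ordinal.{u}) (hc : ∀ α < κ.ord, c α < κ.ord) {x : Ordinal.{u}}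
    (hx : x < κ.ord) : ∃ y < κ.ord, x ≤ y ∧ ∀ α < y, c α < y := by
  let f : Ordinal.{u} → Ordinal.{u} := fun β =>
    ⨆ i : β.ToType, Order.succ (c (Ordinal.ToType.mk.symm i))
  have hlim := Cardinal.isSuccLimit_ord hκ.aleph0_le
  have hf : ∀ β < κ.ord, f β < κ.ord := by
    intro β hβ
    refine Ordinal.iSup_lt_of_lt_cof ?_ fun i => hlim.succ_lt (hc _ ?_)
    · rw [hκ.cof_ord, Cardinal.mk_toType]
      exact Cardinal.lt_ord.1 hβ
    · exact (Ordinal.ToType.mk.symm i).2.trans hβ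
  have hcf : ∀ β, ∀ α < β, c α < f β := by
    intro β α hα
    have := Ordinal.le_iSup (fun i : β.ToType => Order.succ (c (Ordinal.ToType.mk.symm i)))
      (Ordinal.ToType.mk ⟨α, hα⟩)
    simp only [OrderIso.symm_apply_apply] at this
    exact (Order.lt_succ _).trans_le this
  refine ⟨Ordinal.nfp f x, Ordinal.nfp_lt_ord (by rwa [hκ.cof_ord]) hf hx, Ordinal.le_nfp f x, ?_⟩
  intro α hα
  obtain ⟨n, hn⟩ := Ordinal.lt_nfp_iff.1 hα
  refine (hcf _ α hn).trans_le ?_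
  have := Ordinal.iterate_le_nfp f x (n + 1)
  rwa [Function.iterate_succ_apply'] at this

/-- The diamond principle guesses functions, at limit ordinals closed under a given function. -/
theorem Diamond.exists_guess {κ : Cardinal.{u}} (hκ : κ.IsRegular) (hκ' : ℵ₀ < κ)
    (h : Diamond κ) {T : Type u} [Nonempty T] (hT : #T ≤ κ) :
    ∃ g : Ordinal.{u} → Ordinal.{u} → T, ∀ (f : Ordinal.{u} → T) (c : Ordinal.{u} → Ordinal.{u}),
      (∀ α < κ.ord, c α < κ.ord) → ∃ δ < κ.ord, Order.IsSuccLimit δ ∧ (∀ α < δ, c α < δ) ∧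
        ∀ α < δ, g δ α = f α := by
  classical
  obtain ⟨S, -, hS⟩ := h
  have hlim := Cardinal.isSuccLimit_ord hκ.aleph0_le
  have hcard : #(Set.Iio κ.ord × T) ≤ #(Set.Iio κ.ord) := by
    have hinf : ℵ₀ ≤ Cardinal.lift.{u + 1} κ := by simpa using hκ.aleph0_le
    have hI : #(Set.Iio κ.ord) = Cardinal.lift.{u + 1} κ := by
      rw [Cardinal.mk_Iio_ordinal, Cardinal.card_ord]
    have hT' : Cardinal.lift.{u + 1} #T ≤ Cardinal.lift.{u + 1} κ := Cardinal.lift_le.2 hT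
    rw [Cardinal.mk_prod, hI, Cardinal.lift_id'.{u, u + 1}]
    exact (mul_le_mul_right hT' _).trans (Cardinal.mul_eq_self hinf).le
  obtain ⟨e⟩ := hcard
  let g : Ordinal.{u} → Ordinal.{u} → T := fun δ α =>
    if h : ∃ t : T, ∃ (hδ : δ < κ.ord) (hα : α < κ.ord), e (⟨α, hα⟩, t) ∈ S ⟨δ, hδ⟩ then h.choose
    else Classical.arbitrary T
  refine ⟨g, fun f c hc => ?_⟩
  -- `X` is the coded graph of `f`. The bound `c'` combines `c`, the successor function and the code
  -- of `(α, f α)`, so that a nonzero δ closed under `c'` is a limit and contains the codes of all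
  -- pairs from `f ↾ δ`.
  let X : Set (Set.Iio κ.ord) := Set.range fun α => e (α, f α)
  let c' : Ordinal.{u} → Ordinal.{u} := fun α =>
    max (max (c α) (Order.succ α)) (if h : α < κ.ord then e (⟨α, h⟩, f α) else 0)
  have hc' : ∀ α < κ.ord, c' α < κ.ord := by
    intro α hα
    refine max_lt (max_lt (hc α hα) (hlim.succ_lt hα)) ?_
    rw [dif_pos hα]
    exact (e _).2
  let C : Set (Set.Iio κ.ord) := {δ | 0 < δ.1 ∧ ∀ α < δ.1, c' α < δ.1}
  have hC : IsClub C := by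
    constructor
    · intro d hd hne _ a ha
      obtain ⟨x, hx⟩ := hne
      refine ⟨(hd hx).1.trans_le (ha.1 hx), fun α hα => ?_⟩
      obtain ⟨y, hy, hαy⟩ := (lt_isLUB_iff ha (b := ⟨α, hα.trans a.2⟩)).1 hα
      exact ((hd hy).2 α hαy).trans_le (ha.1 hy)
    · intro x
      obtain ⟨y, hy, hxy, hcy⟩ := hκ.exists_closed hκ' c' hc' (hlim.succ_lt x.2)
      exact ⟨⟨y, hy⟩, ⟨(Order.bot_lt_succ _).trans_le hxy, hcy⟩,
        ((Order.le_succ x.1).trans hxy : x.1 ≤ y)⟩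
  obtain ⟨⟨δ, hδκ⟩, hδS, hδ0, hδc⟩ := hS X hC
  refine ⟨δ, hδκ, ?_, ?_, ?_⟩
  · refine ⟨fun hmin => hδ0.ne' hmin.eq_bot, ?_⟩
    rw [Order.isSuccPrelimit_iff_succ_lt]
    intro α hα
    exact ((le_max_right _ _).trans (le_max_left _ _)).trans_lt (hδc α hα)
  · intro α hα
    exact ((le_max_left _ _).trans (le_max_left _ _)).trans_lt (hδc α hα)
  · intro α hα
    have hακ : α < κ.ord := hα.trans hδκ
    have hlt : (e (⟨α, hακ⟩, f α) : Ordinal) < δ := by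
      refine lt_of_le_of_lt ?_ (hδc α hα)
      refine le_trans (le_of_eq ?_) (le_max_right _ _)
      rw [dif_pos hακ]
    have hmem : e (⟨α, hακ⟩, f α) ∈ S ⟨δ, hδκ⟩ := by
      have hXS : X ∩ Set.Iio ⟨δ, hδκ⟩ = S ⟨δ, hδκ⟩ := hδS
      rw [← hXS]
      exact ⟨⟨⟨α, hακ⟩, rfl⟩, hlt⟩
    have hex : ∃ t : T, ∃ (hδ : δ < κ.ord) (hα : α < κ.ord), e (⟨α, hα⟩, t) ∈ S ⟨δ, hδ⟩ :=
      ⟨f α, hδκ, hακ, hmem⟩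
    have hg : g δ α = hex.choose := dif_pos hex
    rw [hg]
    obtain ⟨_, _, hm⟩ := hex.choose_spec
    have hXS : X ∩ Set.Iio ⟨δ, hδκ⟩ = S ⟨δ, hδκ⟩ := hδS
    rw [← hXS] at hm
    -- At a correctly guessed δ every code in `S δ` comes from the graph of `f`, so the decoded
    -- value can only be `f α`.
    obtain ⟨⟨β, hβ⟩, -⟩ := hm
    have := e.injective hβ
    rw [Prod.mk.injEq] at this
    rw [← this.2]
    exact congrArg f (congrArg Subtype.val this.1)

/-! ### Truncation of binary sequences -/

/-- The restriction of a binary sequence to `α`, extended by `false`. -/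
noncomputable def Ordinal.trunc (α : Ordinal.{u}) (η : Ordinal.{u} → Bool) : Ordinal.{u} → Bool :=
  open Classical in fun β => if β < α then η β else false

namespace Ordinal

theorem trunc_apply_of_lt {α β : Ordinal.{u}} (h : β < α) (η : Ordinal.{u} → Bool) :
    trunc α η β = η β := if_pos h

-- Because of this default, `trunc α η` read at level `α + 1` denotes the left successor of the node
-- `η ↾ α`.
@[simp]
theorem trunc_apply_self (α : Ordinal.{u}) (η : Ordinal.{u} → Bool) : trunc α η α = false :=
  if_neg (lt_irrefl α)

theorem trunc_trunc_of_le {α β : Ordinal.{u}} (h : α ≤ β) (η : Ordinal.{u} → Bool) :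
    trunc α (trunc β η) = trunc α η := by
  funext γ
  by_cases hγ : γ < α
  · rw [trunc_apply_of_lt hγ, trunc_apply_of_lt hγ, trunc_apply_of_lt (hγ.trans_le h)]
  · simp [trunc, hγ]

theorem trunc_congr {α : Ordinal.{u}} {η ν : Ordinal.{u} → Bool} (h : ∀ β < α, η β = ν β) :
    trunc α η = trunc α ν := by
  funext γ
  by_cases hγ : γ < α
  · rw [trunc_apply_of_lt hγ, trunc_apply_of_lt hγ, h γ hγ]
  · simp [trunc, hγ]

end Ordinal

/-! ### The type of a point over a node, and nonforking nodes -/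

namespace EmbNode

open CModel AEC

variable {L : FirstOrder.Language.{u, u}} {K : AEC L} {U : Type u} {μ : Cardinal.{u}}

/-- The type of `b` over the domain of a node, computed in its codomain. -/
noncomputable def tp (n : EmbNode L U) (h : Emb K n.dom n.cod n.map) {b : U}
    (hb : b ∈ n.cod.carrier) : K.GaloisType n.dom.carrier :=
  tpEmb h.emb h.isEmb ⟨b, hb⟩

theorem Le.restrict_tp {n m : EmbNode L U} (hle : Le K n m) (hn : Emb K n.dom n.cod n.map)
    (hm : Emb K m.dom m.cod m.map) {b : U} (hb : b ∈ n.cod.carrier) :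
    restrictEmb (Emb.emb hle.dom) (Emb.isEmb hle.dom) (m.tp hm (hle.cod.subset hb)) =
      n.tp hn hb := by
  refine (tpEmb_eq_of_comp (Emb.emb hle.cod) (Emb.isEmb hle.cod) (fun a => Subtype.ext ?_)
    (Subtype.ext ?_)).symm
  · simp [hle.map]
  · simp

/-- Realizing a given extension of the type of `b`. -/
theorem exists_realizing [Infinite U] (hU : μ < #U) (hμ : K.LST ≤ μ) (hAP : K.Amalgamation μ)
    {n : EmbNode L U} (hn : Good K μ n) {b : U} (hb : b ∈ n.cod.carrier) {A : CModel L U}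
    (hA : K.MemCard μ A.carrier) (hle : CModel.Le K n.dom A) (q : K.GaloisType A.carrier)
    (hq : restrictEmb (Emb.emb hle) (Emb.isEmb hle) q = n.tp hn.emb hb) :
    ∃ (B : CModel L U) (j : U → U) (hg : Good K μ ⟨A, B, j⟩) (hle' : Le K n ⟨A, B, j⟩),
      tp ⟨A, B, j⟩ hg.emb (hle'.cod.subset hb) = q := by
  obtain ⟨X, _, f, hf, c, hX, rfl⟩ := exists_eq_tpEmb_card hμ hA q
  -- The codomain of the node is amalgamated over its domain with a realization `c` of `q`,
  -- identifying `b` with `c`; thus `b` itself realizes `q` in the new codomain.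
  obtain ⟨D, _, g, k, hD, hg, hk, hgk, hgc⟩ := exists_amalg_of_tpEmb_eq hμ hAP hn.dom hn.cod hX
    hq.symm
  obtain ⟨B, ψ, hB, hBμ, hψ⟩ := exists_concrete_ext_card hU g hg hD
  have : Nonempty U := ⟨b⟩
  obtain ⟨j, hj, hjx⟩ := exists_emb_map ((ψ.toEmbedding.comp k).comp f)
    (((isEmb_equiv ψ hD.1).comp hk).comp hf)
  have hgood : Good K μ ⟨A, B, j⟩ := ⟨hj, hA, hBμ⟩
  have hnle : Le K n ⟨A, B, j⟩ := by
    refine ⟨hle, hB, fun x hx => ?_⟩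
    have h1 := hjx (Emb.emb hle ⟨x, hx⟩)
    rw [Le.emb_apply] at h1
    refine h1.trans ?_
    have h2 := hψ (hn.emb.emb ⟨x, hx⟩)
    rw [hgk, hn.emb.emb_apply] at h2
    exact h2
  refine ⟨B, j, hgood, hnle, ?_⟩
  refine (tpEmb_eq_of_comp (ψ.toEmbedding.comp k) ((isEmb_equiv ψ hD.1).comp hk)
    (fun a => Subtype.ext ?_) (Subtype.ext ?_)).symm
  · rw [Emb.emb_apply]
    exact (hjx a).symm
  · have := hψ ⟨b, hb⟩
    rw [hgc] at this
    exact this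

end EmbNode

namespace PreFrame

open CModel AEC

variable {L : FirstOrder.Language.{u, u}} {lam : Cardinal.{u}} {s : PreFrame L lam} {U : Type u}

/-- The type of `b` over the domain of the node does not fork over `A₀`. -/
def NodeNF (s : PreFrame L lam) (A₀ : CModel L U) (b : U) (n : EmbNode L U) : Prop :=
  ∃ (h : Emb s.K n.dom n.cod n.map) (hb : b ∈ n.cod.carrier) (h₀ : CModel.Le s.K A₀ n.dom),
    s.DoesNotFork (n.tp h hb) (Emb.emb h₀).toHom.range

/-- Together with `NodeNF.limit` this carries nonforking over the root up a tree: transitivity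
serves the successor steps, continuity the limit steps. -/
theorem NodeNF.trans (hT : s.Transitivity) {A₀ : CModel L U} {b : U} {n m : EmbNode L U}
    (hA₀ : s.K.MemCard lam A₀.carrier) (hn : EmbNode.Good s.K lam n)
    (hm : EmbNode.Good s.K lam m) (h : s.NodeNF A₀ b n) (hle : EmbNode.Le s.K n m)
    (hb : b ∈ m.cod.carrier)
    (h' : s.DoesNotFork (m.tp hm.emb hb) (Emb.emb hle.dom).toHom.range) :
    s.NodeNF A₀ b m := by
  obtain ⟨hne, hnb, hn₀, hd⟩ := h
  refine ⟨hm.emb, hb, hn₀.trans hle.dom, ?_⟩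
  rw [← hle.restrict_tp hne hm.emb hnb] at hd
  have := Transitivity.trans hT hA₀ hn.dom hm.dom (Emb.emb hn₀) (Emb.isEmb hn₀)
    (Emb.emb hle.dom) (Emb.isEmb hle.dom) h' hd
  rwa [Emb.eq_emb (hn₀.trans hle.dom) ((Emb.emb hle.dom).comp (Emb.emb hn₀))
    (fun x => by simp)] at this

theorem NodeNF.limit (hC : s.Continuity) {b : U} {δ : Ordinal.{u}} (hδ : Order.IsSuccLimit δ)
    (hδlam : δ < (Order.succ lam).ord) {G : Ordinal.{u} → EmbNode L U}
    (hG : EmbNode.IsChain s.K δ G) (hgood : ∀ α < δ, EmbNode.Good s.K lam (G α))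
    (hnf : ∀ α < δ, s.NodeNF (G 0).dom b (G α)) {n : EmbNode L U}
    (hn : EmbNode.Good s.K lam n) (hdom : IsUnionOf s.K δ (fun α => (G α).dom) n.dom)
    (hle : ∀ α < δ, EmbNode.Le s.K (G α) n) : s.NodeNF (G 0).dom b n := by
  have hb : b ∈ n.cod.carrier := by
    obtain ⟨_, hb, _⟩ := hnf 0 hδ.bot_lt
    exact (hle 0 hδ.bot_lt).cod.subset hb
  refine ⟨hn.emb, hb, hdom.le 0 hδ.bot_lt, ?_⟩
  refine hC.of_chain hδ hδlam hG.dom (fun α hα => (hgood α hα).dom) hdom hn.dom _ ?_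
  intro α hα
  obtain ⟨he, hb', h₀, hd⟩ := hnf α hα
  rwa [← (hle α hα).restrict_tp he hn.emb hb'] at hd

/-- The type of `b` over `A` has at most one nonforking extension to every extension of `A`. -/
def UniqueExt (s : PreFrame L lam) {A B : Type u} [L.Structure A] [L.Structure B] (i : A ↪[L] B)
    (hi : s.K.IsEmb i) (b : B) : Prop :=
  ∀ (A' : Type u) [L.Structure A'] (e : A ↪[L] A') (he : s.K.IsEmb e), s.K.MemCard lam A' →
    ∀ q q' : s.K.GaloisType A', s.DoesNotFork q e.toHom.range → s.DoesNotFork q' e.toHom.range →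
      restrictEmb e he q = tpEmb i hi b → restrictEmb e he q' = tpEmb i hi b → q = q'

/-- If the type of `b` has two nonforking extensions, then it has two such extensions over the
same model inside a homogeneous model. -/
theorem exists_two_extensions [Infinite U] (hU : lam < #U) (hAP : s.K.Amalgamation lam)
    (hT : s.Transitivity) {A₀ M : CModel L U} (hA₀ : s.K.MemCard lam A₀.carrier)
    (hhom : ∀ (N N' : Type u) [L.Structure N] [L.Structure N'] (e : N ↪[L] M.carrier)
      (f : N ↪[L] N'), s.K.MemCard lam N → s.K.MemCard lam N' → s.K.IsEmb e → s.K.IsEmb f →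
        ∃ g : N' ↪[L] M.carrier, s.K.IsEmb g ∧ ∀ x, g (f x) = e x)
    {n : EmbNode L U} (hn : EmbNode.Good s.K lam n) {b : U} (hnf : s.NodeNF A₀ b n)
    (hM : CModel.Le s.K n.dom M) (hb : b ∈ n.cod.carrier)
    (hnu : ¬ s.UniqueExt hn.emb.emb hn.emb.isEmb ⟨b, hb⟩) :
    ∃ (A B₁ B₂ : CModel L U) (j₁ j₂ : U → U) (h₁ : Emb s.K A B₁ j₁) (h₂ : Emb s.K A B₂ j₂)
      (hb₁ : b ∈ B₁.carrier) (hb₂ : b ∈ B₂.carrier),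
      CModel.Le s.K A M ∧ ¬ A.carrier ⊆ n.dom.carrier ∧
      (EmbNode.Good s.K lam ⟨A, B₁, j₁⟩ ∧ EmbNode.Le s.K n ⟨A, B₁, j₁⟩ ∧
        s.NodeNF A₀ b ⟨A, B₁, j₁⟩) ∧
      (EmbNode.Good s.K lam ⟨A, B₂, j₂⟩ ∧ EmbNode.Le s.K n ⟨A, B₂, j₂⟩ ∧
        s.NodeNF A₀ b ⟨A, B₂, j₂⟩) ∧
      EmbNode.tp ⟨A, B₁, j₁⟩ h₁ hb₁ ≠ EmbNode.tp ⟨A, B₂, j₂⟩ h₂ hb₂ := by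
  unfold UniqueExt at hnu
  push Not at hnu
  obtain ⟨A', _, e, he, hA', q₁, q₂, hq₁, hq₂, hr₁, hr₂, hne⟩ := hnu
  -- Homogeneity moves the model `A'` carrying the two types into `M`, over the domain of the node.
  obtain ⟨g, hg, hge⟩ := hhom _ A' (Emb.emb hM) e hn.dom hA' (Emb.isEmb hM) he
  obtain ⟨A, φ, hAM, hφ⟩ := exists_image g hg
  have hAlam := hA'.of_equiv φ
  have hφe : ∀ x, (φ (e x) : U) = x := by
    intro x
    rw [hφ, hge, Le.emb_apply]
  have hle : CModel.Le s.K n.dom A := by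
    refine hM.of_subset hAM fun x hx => ?_
    have := (φ (e ⟨x, hx⟩)).2
    rwa [hφe] at this
  have hφle : ∀ x, φ.symm (Emb.emb hle x) = e x := by
    intro x
    apply φ.injective
    rw [FirstOrder.Language.Equiv.apply_symm_apply]
    exact Subtype.ext (by rw [Le.emb_apply, hφe])
  have hφs := isEmb_equiv φ.symm hAlam.1
  have hnfq : ∀ q, s.DoesNotFork q e.toHom.range → s.DoesNotFork
      (restrictEmb φ.symm.toEmbedding hφs q) (Emb.emb hle).toHom.range := by
    intro q hq
    refine hq.transfer φ.symm hφs fun x => ?_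
    simp only [FirstOrder.Language.Hom.mem_range]
    constructor
    · rintro ⟨y, rfl⟩
      exact ⟨y, (hφle y).symm⟩
    · rintro ⟨y, hy⟩
      exact ⟨y, φ.symm.injective ((hφle y).trans hy)⟩
  have hres : ∀ q, restrictEmb (Emb.emb hle) (Emb.isEmb hle)
      (restrictEmb φ.symm.toEmbedding hφs q) = restrictEmb e he q := by
    intro q
    rw [restrictEmb_restrictEmb]
    exact restrictEmb_congr hφle q
  have hinj : restrictEmb φ.symm.toEmbedding hφs q₁ ≠ restrictEmb φ.symm.toEmbedding hφs q₂ :=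
    fun h => hne (restrictEmb_injective _ _ φ.symm.surjective h)
  obtain ⟨B₁, j₁, hg₁, hle₁, ht₁⟩ := EmbNode.exists_realizing hU s.lst_le hAP hn hb hAlam hle
    (restrictEmb φ.symm.toEmbedding hφs q₁) ((hres q₁).trans hr₁)
  obtain ⟨B₂, j₂, hg₂, hle₂, ht₂⟩ := EmbNode.exists_realizing hU s.lst_le hAP hn hb hAlam hle
    (restrictEmb φ.symm.toEmbedding hφs q₂) ((hres q₂).trans hr₂)
  refine ⟨A, B₁, B₂, j₁, j₂, hg₁.emb, hg₂.emb, hle₁.cod.subset hb, hle₂.cod.subset hb, hAM, ?_,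
    ⟨hg₁, hle₁, ?_⟩, ⟨hg₂, hle₂, ?_⟩, ?_⟩
  -- Over the domain of the node itself the two types would both be the type of `b`, so the new
  -- domain is strictly larger.
  · intro hsub
    refine hne ?_
    have hs : Function.Surjective e := by
      intro a
      refine ⟨⟨φ a, hsub (φ a).2⟩, φ.injective (Subtype.ext (hφe _))⟩
    exact restrictEmb_injective e he hs (hr₁.trans hr₂.symm)
  · exact hnf.trans hT hA₀ hn hg₁ hle₁ (hle₁.cod.subset hb) (ht₁ ▸ hnfq q₁ hq₁)
  · exact hnf.trans hT hA₀ hn hg₂ hle₂ (hle₂.cod.subset hb) (ht₂ ▸ hnfq q₂ hq₂)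
  · rw [ht₁, ht₂]
    exact hinj

/-- Every nonforking triple is isomorphic to a node. -/
theorem exists_node [Infinite U] (hU : lam < #U) {A₀ B₀ : Type u} [L.Structure A₀]
    [L.Structure B₀] {i : A₀ ↪[L] B₀} {hi : s.K.IsEmb i} {b : B₀} (hA₀ : s.K.MemCard lam A₀)
    (hB₀ : s.K.MemCard lam B₀) (hnf : s.DoesNotFork (tpEmb i hi b) ⊤) {A : CModel L U}
    (ψ : A₀ ≃[L] A.carrier) :
    ∃ (B : CModel L U) (j : U → U) (χ : B₀ ≃[L] B.carrier), EmbNode.Good s.K lam ⟨A, B, j⟩ ∧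
      s.NodeNF A (χ b) ⟨A, B, j⟩ ∧ ∀ a, j (ψ a) = χ (i a) := by
  obtain ⟨B, ⟨χ⟩⟩ := CModel.exists_concrete (L := L) (U := U) (X := B₀) (hB₀.2.le.trans hU.le)
  have hAc := hA₀.of_equiv ψ
  have hψs := isEmb_equiv ψ.symm hAc.1
  have hχ := isEmb_equiv χ hB₀.1
  obtain ⟨j, hj, hjx⟩ := exists_emb_map ((χ.toEmbedding.comp i).comp ψ.symm.toEmbedding)
    ((hχ.comp hi).comp hψs)
  have hjψ : ∀ a : A₀, j (ψ a) = χ (i a) := by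
    intro a
    have := hjx (ψ a)
    simpa using this
  refine ⟨B, j, χ, ⟨hj, hAc, hB₀.of_equiv χ⟩, ⟨hj, (χ b).2, CModel.Le.refl hAc.1, ?_⟩, hjψ⟩
  have h1 := hnf.transfer ψ.symm hψs
    (A' := (Emb.emb (CModel.Le.refl (K := s.K) hAc.1)).toHom.range) (by
      intro x
      refine iff_of_true ⟨x, ?_⟩ trivial
      exact Subtype.ext (Le.emb_apply _ x))
  have h2 : restrictEmb ψ.symm.toEmbedding hψs (tpEmb i hi b) =
      EmbNode.tp ⟨A, B, j⟩ hj (χ b).2 := by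
    refine tpEmb_eq_of_comp χ.toEmbedding hχ (fun a => Subtype.ext ?_) rfl
    rw [Emb.emb_apply]
    exact (hjx a).symm
  rwa [h2] at h1

/-- The nonforking extension of a triple given by an extension of a node isomorphic to it. -/
theorem NodeNF.doesNotFork {A₀ B₀ : Type u} [L.Structure A₀] [L.Structure B₀] {i : A₀ ↪[L] B₀}
    {b : B₀} {n₀ n : EmbNode L U} (ψ : A₀ ≃[L] n₀.dom.carrier) (χ : B₀ ≃[L] n₀.cod.carrier)
    (hψχ : ∀ a, n₀.map (ψ a) = χ (i a)) (hn : EmbNode.Good s.K lam n)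
    (hle : EmbNode.Le s.K n₀ n) (hnf : s.NodeNF n₀.dom (χ b) n) :
    (∀ a, hn.emb.emb ((Emb.emb hle.dom).comp ψ.toEmbedding a) =
      (Emb.emb hle.cod).comp χ.toEmbedding (i a)) ∧
    s.DoesNotFork (tpEmb hn.emb.emb hn.emb.isEmb ((Emb.emb hle.cod).comp χ.toEmbedding b))
      ((Emb.emb hle.dom).comp ψ.toEmbedding).toHom.range := by
  obtain ⟨hne, hb, hn₀n, hnfn⟩ := hnf
  constructor
  · intro a
    apply Subtype.ext
    change ((hn.emb.emb (Emb.emb hle.dom (ψ a)) : n.cod.carrier) : U) =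
      (Emb.emb hle.cod (χ (i a)) : n.cod.carrier)
    rw [Emb.emb_apply, Le.emb_apply, Le.emb_apply, hle.map _ (ψ a).2]
    exact hψχ a
  · have hbb : (Emb.emb hle.cod).comp χ.toEmbedding b = ⟨(χ b : U), hb⟩ :=
      Subtype.ext (Le.emb_apply hle.cod _)
    have hr : ((Emb.emb hle.dom).comp ψ.toEmbedding).toHom.range =
        (Emb.emb hn₀n).toHom.range := by
      ext x
      simp only [FirstOrder.Language.Hom.mem_range]
      constructor
      · rintro ⟨y, rfl⟩
        exact ⟨ψ y, rfl⟩
      · rintro ⟨y, rfl⟩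
        exact ⟨ψ.symm y, congrArg (Emb.emb hle.dom) (ψ.apply_symm_apply y)⟩
    rw [hr]
    have h3 : tpEmb hn.emb.emb hn.emb.isEmb ((Emb.emb hle.cod).comp χ.toEmbedding b) =
        n.tp hne hb := tpEmb_congr (fun _ => rfl) hbb
    exact h3 ▸ hnfn

theorem UniqueExt.of_equiv {A₀ B₀ A B : Type u} [L.Structure A₀] [L.Structure B₀]
    [L.Structure A] [L.Structure B] {i : A₀ ↪[L] B₀} {hi : s.K.IsEmb i} {b : B₀}
    (h : s.UniqueExt i hi b) (ψ : A₀ ≃[L] A) (χ : B₀ ≃[L] B) {j : A ↪[L] B} (hj : s.K.IsEmb j)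
    (hψχ : ∀ a, χ (i a) = j (ψ a)) : s.UniqueExt j hj (χ b) := by
  have hψ := isEmb_equiv ψ hi.mem_left
  have hrs : restrictEmb ψ.toEmbedding hψ (tpEmb j hj (χ b)) = tpEmb i hi b :=
    (tpEmb_eq_of_comp χ.toEmbedding (isEmb_equiv χ hi.mem_right) hψχ rfl).symm
  intro A' _ e he hA' q q' hq hq' hr hr'
  have hrange : (e.comp ψ.toEmbedding).toHom.range = e.toHom.range := by
    ext x
    simp only [FirstOrder.Language.Hom.mem_range]
    constructor
    · rintro ⟨y, rfl⟩
      exact ⟨ψ y, rfl⟩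
    · rintro ⟨y, rfl⟩
      exact ⟨ψ.symm y, congrArg e (ψ.apply_symm_apply y)⟩
  refine h A' (e.comp ψ.toEmbedding) (he.comp hψ) hA' q q' (hrange ▸ hq) (hrange ▸ hq') ?_ ?_
  · rw [← restrictEmb_restrictEmb _ hψ _ he, hr, hrs]
  · rw [← restrictEmb_restrictEmb _ hψ _ he, hr', hrs]

end PreFrame

/-! ### First stage: a tree of splitting types against stability in λ⁺ -/

namespace EmbNode

open CModel AEC

variable {L : FirstOrder.Language.{u, u}} {K : AEC L} {U : Type u} {μ : Cardinal.{u}}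

/-- The support of a family of nodes indexed by binary sequences. -/
def familySupp (x : (Ordinal.{u} → Bool) → EmbNode L U) : Set ((Ordinal.{u} → Bool) × (U ⊕ U)) :=
  {z | z.2 ∈ (x z.1).supp}

/-- A whole level of the tree is one object of the transfinite recursion; tagging elements with
their branch turns continuity along all branches into one condition on supports. -/
theorem familySupp_subset_iff {x : (Ordinal.{u} → Bool) → EmbNode L U} {δ : Ordinal.{u}}
    {F : Ordinal.{u} → (Ordinal.{u} → Bool) → EmbNode L U} :
    familySupp x ⊆ ⋃ α < δ, familySupp (F α) ↔ ∀ η, (x η).supp ⊆ ⋃ α < δ, (F α η).supp := by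
  constructor
  · intro h η z hz
    have := h (show (η, z) ∈ familySupp x from hz)
    simpa [familySupp] using this
  · rintro h ⟨η, z⟩ hz
    have := h η hz
    simpa [familySupp] using this

/-- The two nodes have the same domain and determine different types of `b` over it. -/
def Split (K : AEC L) (b : U) (n m : EmbNode L U) : Prop :=
  ∃ (A B₁ B₂ : CModel L U) (j₁ j₂ : U → U) (h₁ : Emb K A B₁ j₁) (h₂ : Emb K A B₂ j₂)
    (hb₁ : b ∈ B₁.carrier) (hb₂ : b ∈ B₂.carrier), n = ⟨A, B₁, j₁⟩ ∧ m = ⟨A, B₂, j₂⟩ ∧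
    tp ⟨A, B₁, j₁⟩ h₁ hb₁ ≠ tp ⟨A, B₂, j₂⟩ h₂ hb₂

end EmbNode

namespace PreFrame

open CModel AEC Ordinal

variable {L : FirstOrder.Language.{u, u}} {lam : Cardinal.{u}} {s : PreFrame L lam} {U : Type u}

/-- If no node above `n₀` has unique nonforking extensions, there is a full binary tree of
nonforking extensions, with domains inside `M`. -/
theorem exists_split_tree [Infinite U] (hinf : ℵ₀ ≤ lam) (hU : lam < #U)
    (hAP : s.K.Amalgamation lam) (hT : s.Transitivity) (hC : s.Continuity) {M : CModel L U}
    (hhom : ∀ (N N' : Type u) [L.Structure N] [L.Structure N'] (e : N ↪[L] M.carrier)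
      (f : N ↪[L] N'), s.K.MemCard lam N → s.K.MemCard lam N' → s.K.IsEmb e → s.K.IsEmb f →
        ∃ g : N' ↪[L] M.carrier, s.K.IsEmb g ∧ ∀ x, g (f x) = e x)
    {n₀ : EmbNode L U} (hn₀ : EmbNode.Good s.K lam n₀) {b : U} (hnf₀ : s.NodeNF n₀.dom b n₀)
    (hM₀ : CModel.Le s.K n₀.dom M)
    (hbad : ∀ n : EmbNode L U, ∀ hn : EmbNode.Good s.K lam n, EmbNode.Le s.K n₀ n →
      s.NodeNF n₀.dom b n → ∀ hb : b ∈ n.cod.carrier,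
        ¬ s.UniqueExt hn.emb.emb hn.emb.isEmb ⟨b, hb⟩) :
    ∃ F : Ordinal.{u} → (Ordinal.{u} → Bool) → EmbNode L U,
      (∀ α < (Order.succ lam).ord, ∀ η, F α η = F α (trunc α η)) ∧
      (∀ η, EmbNode.IsChain s.K (Order.succ lam).ord fun α => F α η) ∧
      (∀ α < (Order.succ lam).ord, ∀ η, EmbNode.Good s.K lam (F α η) ∧ b ∈ (F α η).cod.carrier ∧
        CModel.Le s.K (F α η).dom M) ∧
      (∀ α, α + 1 < (Order.succ lam).ord → ∀ η,
        ¬ (F (α + 1) η).dom.carrier ⊆ (F α η).dom.carrier) ∧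
      ∀ α, α + 1 < (Order.succ lam).ord → ∀ η ν, trunc α η = trunc α ν → η α = false →
        ν α = true → EmbNode.Split s.K b (F (α + 1) η) (F (α + 1) ν) := by
  have hlim := Cardinal.isSuccLimit_ord (hinf.trans (Order.le_succ lam))
  let I : EmbNode L U → Prop := fun n => (EmbNode.Good s.K lam n ∧ EmbNode.Le s.K n₀ n) ∧
    s.NodeNF n₀.dom b n ∧ CModel.Le s.K n.dom M
  have H := Ordinal.exists_continuous_chain (Order.succ lam).ord
    (fun (x y : (Ordinal.{u} → Bool) → EmbNode L U) => ∀ η, EmbNode.Le s.K (x η) (y η))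
    EmbNode.familySupp (fun α x => (∀ η, x η = x (trunc α η)) ∧ ∀ η, I (x η))
    (fun α x y => (∀ η, ¬ (y η).dom.carrier ⊆ (x η).dom.carrier) ∧
      ∀ η ν, trunc α η = trunc α ν → η α = false → ν α = true →
        EmbNode.Split s.K b (y η) (y ν)) (fun _ => n₀)
    (fun _ x hx η => (hx.2 η).1.1.le_refl) (fun x y z h h' η => (h η).trans (h' η))
    ⟨fun _ => rfl, fun _ => ⟨⟨hn₀, hn₀.le_refl⟩, hnf₀, hM₀⟩⟩ ?_ ?_
  · obtain ⟨F, -, h1, h2, h3, h4⟩ := H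
    have h1' := h1 hlim.bot_lt
    refine ⟨F, fun α hα => (h1' α hα).1, fun η => ⟨fun α β h hβ => h2 α β h hβ η,
      fun γ hγ hlimγ => EmbNode.familySupp_subset_iff.1 (h3 γ hγ hlimγ) η⟩, ?_,
      fun α hα => (h4 α hα).1, fun α hα => (h4 α hα).2⟩
    intro α hα η
    obtain ⟨⟨hg, -⟩, ⟨_, hb, _⟩, hM⟩ := (h1' α hα).2 η
    exact ⟨hg, hb, hM⟩
  · rintro α hα x ⟨hxt, hxI⟩
    have hstep : ∀ η, ∃ n m : EmbNode L U, EmbNode.Split s.K b n m ∧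
        (¬ n.dom.carrier ⊆ (x η).dom.carrier ∧ EmbNode.Le s.K (x η) n ∧ I n) ∧
        (¬ m.dom.carrier ⊆ (x η).dom.carrier ∧ EmbNode.Le s.K (x η) m ∧ I m) := by
      intro η
      obtain ⟨⟨hg, hle⟩, hnf, hM⟩ := hxI η
      have hb : b ∈ (x η).cod.carrier := by
        obtain ⟨_, hb, _⟩ := hnf
        exact hb
      obtain ⟨A, B₁, B₂, j₁, j₂, h₁, h₂, hb₁, hb₂, hAM, hsub, ⟨hg₁, hle₁, hnf₁⟩,
        ⟨hg₂, hle₂, hnf₂⟩, hne⟩ := exists_two_extensions hU hAP hT hn₀.dom hhom hg hnf hM hb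
          (hbad _ hg hle hnf hb)
      exact ⟨⟨A, B₁, j₁⟩, ⟨A, B₂, j₂⟩, ⟨A, B₁, B₂, j₁, j₂, h₁, h₂, hb₁, hb₂, rfl, rfl, hne⟩,
        ⟨hsub, hle₁, ⟨hg₁, hle.trans hle₁⟩, hnf₁, hAM⟩,
        ⟨hsub, hle₂, ⟨hg₂, hle.trans hle₂⟩, hnf₂, hAM⟩⟩
    choose n m hsplit hn hm using hstep
    -- The chosen successors are evaluated at `trunc α η`, so that the new level depends on `η ↾ (α
    -- + 1)` only; `trunc δ η` plays this role at limit levels.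
    refine ⟨fun η => if η α = true then m (trunc α η) else n (trunc α η), ?_, ⟨?_, ?_⟩, ?_, ?_⟩
    · intro η
      dsimp only
      rw [hxt η]
      split_ifs
      exacts [(hm _).2.1, (hn _).2.1]
    · intro η
      dsimp only
      rw [trunc_apply_of_lt (show α < α + 1 from Order.lt_succ α),
          trunc_trunc_of_le (show α ≤ α + 1 from Order.le_succ α)]
    · intro η
      dsimp only
      split_ifs
      exacts [(hm _).2.2, (hn _).2.2]
    · intro η
      dsimp only
      rw [hxt η]
      split_ifs
      exacts [(hm _).1, (hn _).1]
    · intro η ν h hη hν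
      dsimp only
      rw [hη, hν, h]
      exact hsplit _
  · intro δ hδ hδlim F hF hle hsupp hF0
    have hch : ∀ η, EmbNode.IsChain s.K δ fun α => F α η := fun η =>
      ⟨fun α β h hβ => hle α β h hβ η,
        fun γ hγ hlimγ => EmbNode.familySupp_subset_iff.1 (hsupp γ hγ hlimγ) η⟩
    have hex : ∀ η, ∃ n : EmbNode L U, I n ∧ (∀ α < δ, EmbNode.Le s.K (F α η) n) ∧
        n.supp ⊆ ⋃ α < δ, (F α η).supp := by
      intro η
      obtain ⟨A, hA⟩ := (hch η).dom.exists_isUnionOf hδlim.bot_lt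
      obtain ⟨n, rfl, hn, hnle, -, hns⟩ := (hch η).exists_union hδlim.bot_lt hinf
        (Order.lt_succ_iff.1 (Cardinal.lt_ord.1 hδ)) (fun α hα => ((hF α hα).2 η).1.1) hA
      have h0 : F 0 η = n₀ := congrFun hF0 η
      refine ⟨n, ⟨⟨hn, h0 ▸ hnle 0 hδlim.bot_lt⟩, ?_, ?_⟩, hnle, hns⟩
      · have := NodeNF.limit hC hδlim hδ (hch η) (fun α hα => ((hF α hα).2 η).1.1)
          (b := b) (fun α hα => by
            rw [h0]
            exact ((hF α hα).2 η).2.1) hn hA hnle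
        rwa [h0] at this
      · exact hA.emb hδlim.bot_lt (hch η).dom fun α hα => ((hF α hα).2 η).2.2
    choose z hzI hzle hzs using hex
    have hFt : ∀ α < δ, ∀ η, F α (trunc δ η) = F α η := by
      intro α hα η
      rw [(hF α hα).1 η, (hF α hα).1 (trunc δ η), trunc_trunc_of_le hα.le]
    refine ⟨fun η => z (trunc δ η), ⟨fun η => ?_, fun η => hzI _⟩, fun α hα η => ?_, ?_⟩
    · dsimp only
      rw [trunc_trunc_of_le le_rfl]
    · rw [← hFt α hα η]
      exact hzle _ α hα
    · rw [EmbNode.familySupp_subset_iff]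
      intro η t ht
      obtain ⟨α, hα, h⟩ := Set.mem_iUnion₂.1 (hzs _ ht)
      exact Set.mem_iUnion₂.2 ⟨α, hα, hFt α hα η ▸ h⟩

/-- A type over `λ⁺` obtained from a branch of length `λ⁺`. -/
theorem exists_type_of_branch (hinf : ℵ₀ ≤ lam) (hU : #U = Order.succ lam)
    (hAP' : s.K.Amalgamation (Order.succ lam)) {M : CModel L U}
    (hM : s.K.MemCard (Order.succ lam) M.carrier) {G : Ordinal.{u} → EmbNode L U}
    (hG : EmbNode.IsChain s.K (Order.succ lam).ord G) {b : U}
    (hgood : ∀ α < (Order.succ lam).ord, EmbNode.Good s.K lam (G α) ∧ b ∈ (G α).cod.carrier ∧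
      CModel.Le s.K (G α).dom M)
    (hstrict : ∀ α, α + 1 < (Order.succ lam).ord →
      ¬ (G (α + 1)).dom.carrier ⊆ (G α).dom.carrier) :
    ∃ q : s.K.GaloisType M.carrier, ∀ α < (Order.succ lam).ord,
      ∀ (n : EmbNode L U) (h : Emb s.K n.dom n.cod n.map) (hb : b ∈ n.cod.carrier)
        (hnM : CModel.Le s.K n.dom M), G α = n →
        restrictEmb (Emb.emb hnM) (Emb.isEmb hnM) q = n.tp h hb := by
  have hlim := Cardinal.isSuccLimit_ord (hinf.trans (Order.le_succ lam))
  obtain ⟨A, hA⟩ := hG.dom.exists_isUnionOf hlim.bot_lt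
  obtain ⟨B, hB⟩ := hG.cod.exists_isUnionOf hlim.bot_lt
  obtain ⟨j, hj, hjx⟩ := hG.exists_map hlim.bot_lt (fun α hα => (hgood α hα).1.emb) hA hB
  have hAM : CModel.Le s.K A M := hA.emb hlim.bot_lt hG.dom fun α hα => (hgood α hα).2.2
  -- The domains grow strictly, so their union has size λ⁺ and amalgamation in λ⁺ applies to `M` and
  -- `B` over `A`.
  have hAc : s.K.MemCard (Order.succ lam) A.carrier :=
    hA.memCard_succ hinf (fun α hα => (hgood α hα).1.dom.2.le)
      (fun α β h hβ => (hG.le α β h hβ).dom.subset) (fun α hα => hstrict α (hlim.succ_lt hα))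
  have hBc : s.K.MemCard (Order.succ lam) B.carrier := by
    refine ⟨hj.mem_right, le_antisymm ((Cardinal.mk_set_le _).trans hU.le) ?_⟩
    rw [← hAc.2]
    exact Cardinal.mk_le_of_injective hj.emb.injective
  obtain ⟨D, _, f, g, hD, hf, hg, hfg⟩ := hAP' _ _ _ (Emb.emb hAM) hj.emb hAc hM hBc
    (Emb.isEmb hAM) hj.isEmb
  have hbB : b ∈ B.carrier := (hB.le 0 hlim.bot_lt).subset (hgood 0 hlim.bot_lt).2.1
  refine ⟨tpEmb f hf (g ⟨b, hbB⟩), ?_⟩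
  -- The equation `G α = n` in the statement allows nodes of two branches with the same domain to be
  -- written over one model, where their types can be compared without casts.
  rintro α hα n h hb hnM rfl
  have hBle := hB.le α hα
  have hAle := hA.le α hα
  refine (tpEmb_eq_of_comp (g.comp (Emb.emb hBle)) (hg.comp (Emb.isEmb hBle)) (fun a => ?_)
    ?_).symm
  · have h1 : Emb.emb hBle (h.emb a) = hj.emb (Emb.emb hAle a) := by
      apply Subtype.ext
      rw [Le.emb_apply, h.emb_apply, hj.emb_apply, Le.emb_apply]
      exact (hjx α hα a a.2).symm
    have h2 : Emb.emb hAM (Emb.emb hAle a) = Emb.emb hnM a := Subtype.ext (by simp)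
    change g (Emb.emb hBle (h.emb a)) = f (Emb.emb hnM a)
    rw [h1, ← hfg, h2]
  · exact congrArg g (Subtype.ext (by simp))

/-- Above every nonforking type there is one with unique nonforking extensions. -/
theorem exists_uniqueExt (hinf : ℵ₀ ≤ lam) (hAP : s.K.Amalgamation lam)
    (hNM : s.K.NoMaximalModel lam) (hT : s.Transitivity) (hC : s.Continuity)
    (hAP' : s.K.Amalgamation (Order.succ lam)) (hst : s.K.Stable (Order.succ lam))
    {A₀ B₀ : Type u} [L.Structure A₀] [L.Structure B₀] (i : A₀ ↪[L] B₀) (hi : s.K.IsEmb i)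
    (b : B₀) (hA₀ : s.K.MemCard lam A₀) (hB₀ : s.K.MemCard lam B₀)
    (hnf : s.DoesNotFork (tpEmb i hi b) ⊤) :
    ∃ (A₁ B₁ : Type u) (_ : L.Structure A₁) (_ : L.Structure B₁) (e : A₀ ↪[L] A₁)
      (f : B₀ ↪[L] B₁) (i₁ : A₁ ↪[L] B₁) (_ : s.K.IsEmb e) (_ : s.K.IsEmb f)
      (hi₁ : s.K.IsEmb i₁), s.K.MemCard lam A₁ ∧ s.K.MemCard lam B₁ ∧
      (∀ a, i₁ (e a) = f (i a)) ∧ s.DoesNotFork (tpEmb i₁ hi₁ (f b)) e.toHom.range ∧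
      s.UniqueExt i₁ hi₁ (f b) := by
  by_contra hcon
  have hinf' : ℵ₀ ≤ Order.succ lam := hinf.trans (Order.le_succ lam)
  -- All types counted below are types over this one homogeneous model.
  obtain ⟨M₀, _, hM₀, ⟨e₀, he₀⟩, hhom₀⟩ := exists_homogeneous hinf s.lst_le hAP hNM hAP' hst hA₀
  let U : Type u := (Order.succ lam).out
  have hU : #U = Order.succ lam := Cardinal.mk_out _
  have hU' : lam < #U := hU ▸ Order.lt_succ lam
  have : Infinite U := Cardinal.infinite_iff.2 (hinf.trans hU'.le)
  obtain ⟨M, ⟨φ⟩⟩ := CModel.exists_concrete (L := L) (U := U) (X := M₀) (hM₀.2.le.trans hU.ge)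
  have hM := hM₀.of_equiv φ
  have hhom : ∀ (N N' : Type u) [L.Structure N] [L.Structure N'] (e : N ↪[L] M.carrier)
      (f : N ↪[L] N'), s.K.MemCard lam N → s.K.MemCard lam N' → s.K.IsEmb e → s.K.IsEmb f →
        ∃ g : N' ↪[L] M.carrier, s.K.IsEmb g ∧ ∀ x, g (f x) = e x := by
    intro N N' _ _ e f hN hN' he hf
    obtain ⟨g, hg, hgx⟩ := hhom₀ N N' (φ.symm.toEmbedding.comp e) f hN hN'
      ((isEmb_equiv _ hM.1).comp he) hf
    refine ⟨φ.toEmbedding.comp g, (isEmb_equiv φ hM₀.1).comp hg, fun x => ?_⟩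
    have := congrArg φ (hgx x)
    simpa using this
  obtain ⟨A, ψ, hAM, hψ⟩ := exists_image (φ.toEmbedding.comp e₀) ((isEmb_equiv φ hM₀.1).comp he₀)
  obtain ⟨B, j, χ, hn₀, hnf₀, hψχ⟩ := exists_node hU' hA₀ hB₀ hnf ψ
  let n₀ : EmbNode L U := ⟨A, B, j⟩
  obtain ⟨F, hFt, hFch, hFg, hFs, hFsplit⟩ := exists_split_tree hinf hU' hAP hT hC hhom
    (n₀ := n₀) hn₀ hnf₀ hAM (by
      rintro n hn hle hnfn hb huniq
      obtain ⟨h1, h2⟩ := NodeNF.doesNotFork (n₀ := n₀) ψ χ hψχ hn hle hnfn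
      refine hcon ⟨n.dom.carrier, n.cod.carrier, inferInstance, inferInstance,
        (Emb.emb hle.dom).comp ψ.toEmbedding, (Emb.emb hle.cod).comp χ.toEmbedding, hn.emb.emb,
        (Emb.isEmb hle.dom).comp (isEmb_equiv ψ hA₀.1),
        (Emb.isEmb hle.cod).comp (isEmb_equiv χ hB₀.1), hn.emb.isEmb, hn.dom, hn.cod, h1, h2, ?_⟩
      have hbb : (Emb.emb hle.cod).comp χ.toEmbedding b = ⟨(χ b : U), hb⟩ :=
        Subtype.ext (Le.emb_apply hle.cod _)
      rw [hbb]
      exact huniq)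
  have hlim := Cardinal.isSuccLimit_ord hinf'
  have hq := fun η => exists_type_of_branch hinf hU hAP' hM (hFch η) (fun α hα => hFg α hα η)
    (fun α hα => hFs α hα η)
  choose q hq using hq
  have hsep : ∀ η ν (α : Ordinal.{u}), α < (Order.succ lam).ord → trunc α η = trunc α ν →
      η α = false → ν α = true → q η ≠ q ν := by
    intro η ν α hα htr hη hν heq
    obtain ⟨A, B₁, B₂, j₁, j₂, h₁, h₂, hb₁, hb₂, e₁, e₂, hne⟩ :=
      hFsplit α (hlim.succ_lt hα) η ν htr hη hν
    have hAM : CModel.Le s.K A M := by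
      have := (hFg (α + 1) (hlim.succ_lt hα) η).2.2
      rwa [e₁] at this
    have r₁ := hq η (α + 1) (hlim.succ_lt hα) ⟨A, B₁, j₁⟩ h₁ hb₁ hAM e₁
    have r₂ := hq ν (α + 1) (hlim.succ_lt hα) ⟨A, B₂, j₂⟩ h₂ hb₂ hAM e₂
    exact hne (r₁.symm.trans (heq ▸ r₂))
  classical
  let ext : (Set.Iio (Order.succ lam).ord → Bool) → Ordinal.{u} → Bool := fun ζ α =>
    if h : α < (Order.succ lam).ord then ζ ⟨α, h⟩ else false
  have hext : ∀ ζ (α : Set.Iio (Order.succ lam).ord), ext ζ α = ζ α := fun ζ α => dif_pos α.2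
  have hinj : Function.Injective fun ζ => q (ext ζ) := by
    intro ζ ξ h
    by_contra hne
    obtain ⟨β, hβ⟩ := Function.ne_iff.1 hne
    let T : Set (Set.Iio (Order.succ lam).ord) := {β | ζ β ≠ ξ β}
    -- At the first difference α the branches leave a common node in different directions, so their
    -- types differ already over the common domain at level α + 1.
    obtain ⟨α, hαT, hmin⟩ := WellFounded.has_min (wellFounded_lt) T ⟨β, hβ⟩
    have htr : trunc (α : Ordinal.{u}) (ext ζ) = trunc (α : Ordinal.{u}) (ext ξ) := by
      refine trunc_congr fun γ hγ => ?_
      have := hmin ⟨γ, hγ.trans α.2⟩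
      have h2 : ζ ⟨γ, hγ.trans α.2⟩ = ξ ⟨γ, hγ.trans α.2⟩ := by
        by_contra h3
        exact this h3 hγ
      exact (hext ζ ⟨γ, hγ.trans α.2⟩).trans (h2.trans (hext ξ ⟨γ, hγ.trans α.2⟩).symm)
    have hαT' : ζ α ≠ ξ α := hαT
    cases hζ : ζ α <;> cases hξ : ξ α
    · exact hαT' (hζ.trans hξ.symm)
    · exact hsep _ _ α α.2 htr ((hext ζ α).trans hζ) ((hext ξ α).trans hξ) h
    · exact hsep _ _ α α.2 htr.symm ((hext ξ α).trans hξ) ((hext ζ α).trans hζ) h.symm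
    · exact hαT' (hζ.trans hξ.symm)
  have hle := (Cardinal.mk_le_of_injective hinj).trans (mk_galoisType_le hinf' hst hM)
  rw [Cardinal.mk_arrow, Cardinal.mk_Iio_ordinal, Cardinal.card_ord, Cardinal.mk_bool,
    Cardinal.lift_ofNat, Cardinal.lift_id'.{0, u + 1}] at hle
  exact absurd hle (not_le_of_gt (Cardinal.cantor _))

end PreFrame

/-! ### Second stage: a tree of incompatible amalgams over common domains -/

namespace EmbNode

open CModel AEC

variable {L : FirstOrder.Language.{u, u}} {K : AEC L} {U : Type u} {μ : Cardinal.{u}}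

/-- The nodes `n₁` and `n₂` cannot be amalgamated over `n.cod` and their domain. -/
def Incompatible (K : AEC L) (n n₁ n₂ : EmbNode L U) : Prop :=
  ∀ (G : CModel L U) (f₁ f₂ : U → U), Emb K n₁.cod G f₁ → Emb K n₂.cod G f₂ →
    (∀ x ∈ n.cod.carrier, f₁ x = f₂ x) →
    ¬ ∀ x ∈ n₁.dom.carrier, f₁ (n₁.map x) = f₂ (n₂.map x)

end EmbNode

namespace PreFrame

open CModel AEC Ordinal

variable {L : FirstOrder.Language.{u, u}} {lam : Cardinal.{u}} {s : PreFrame L lam} {U : Type u}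

/-- An amalgamation of the node `n` with an extension of its domain, as a node. -/
theorem exists_node_of_amalgamation [Infinite U] (hU : lam < #U) {n : EmbNode L U}
    (hn : EmbNode.Good s.K lam n) {b : U} (hb : b ∈ n.cod.carrier) {A : CModel L U}
    (hA : s.K.MemCard lam A.carrier) (hle : CModel.Le s.K n.dom A)
    {C D : Type u} [L.Structure C] [L.Structure D] (φ : C ≃[L] A.carrier)
    {g : n.cod.carrier ↪[L] D} {k : C ↪[L] D} (hg : s.K.IsEmb g) (hk : s.K.IsEmb k)
    (hD : s.K.MemCard lam D) (hgk : ∀ x, k (φ.symm (Emb.emb hle x)) = g (hn.emb.emb x))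
    (hφ : s.K.IsEmb φ.symm.toEmbedding) :
    ∃ (B : CModel L U) (j : U → U) (hm : EmbNode.Good s.K lam ⟨A, B, j⟩)
      (hle' : EmbNode.Le s.K n ⟨A, B, j⟩) (ψ : D ≃[L] B.carrier),
      (∀ x, (ψ (g x) : U) = x) ∧ (∀ c, (ψ (k c) : U) = j (φ c)) ∧
      EmbNode.tp ⟨A, B, j⟩ hm.emb (hle'.cod.subset hb) =
        restrictEmb φ.symm.toEmbedding hφ (tpEmb k hk (g ⟨b, hb⟩)) := by
  obtain ⟨B, ψ, hB, hBc, hψ⟩ := exists_concrete_ext_card hU g hg hD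
  obtain ⟨j, hj, hjx⟩ := exists_emb_map ((ψ.toEmbedding.comp k).comp φ.symm.toEmbedding)
    (((isEmb_equiv ψ hD.1).comp hk).comp hφ)
  have hjx' : ∀ c, (ψ (k c) : U) = j (φ c) := by
    intro c
    rw [hjx (φ c)]
    simp
  have hm : EmbNode.Good s.K lam ⟨A, B, j⟩ := ⟨hj, hA, hBc⟩
  have hle' : EmbNode.Le s.K n ⟨A, B, j⟩ := by
    refine ⟨hle, hB, fun x hx => ?_⟩
    have h1 := hjx' (φ.symm (Emb.emb hle ⟨x, hx⟩))
    rw [FirstOrder.Language.Equiv.apply_symm_apply, Le.emb_apply, hgk, hψ,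
      hn.emb.emb_apply] at h1
    exact h1.symm
  refine ⟨B, j, hm, hle', ψ, hψ, hjx', ?_⟩
  refine (tpEmb_eq_of_comp ψ.toEmbedding (isEmb_equiv ψ hD.1)
    (fun a => Subtype.ext ?_) (Subtype.ext ?_)).symm
  · rw [Emb.emb_apply]
    exact (hjx a).symm
  · exact hψ ⟨b, hb⟩

/-- A failure of uniqueness gives two incompatible nodes. -/
theorem exists_incompatible [Infinite U] (hU : lam < #U) {n : EmbNode L U}
    (hn : EmbNode.Good s.K lam n) {b : U} (hb : b ∈ n.cod.carrier) {C : Type u} [L.Structure C]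
    {j : hn.emb.emb.toHom.range ↪[L] C} (hW : s.WitnessesNonuniqueness _ ⟨b, hb⟩ j) :
    ∃ (A : CModel L U) (n₁ n₂ : EmbNode L U) (h₁ : EmbNode.Good s.K lam n₁)
      (h₂ : EmbNode.Good s.K lam n₂) (hle₁ : EmbNode.Le s.K n n₁) (hle₂ : EmbNode.Le s.K n n₂),
      n₁.dom = A ∧ n₂.dom = A ∧ ¬ A.carrier ⊆ n.dom.carrier ∧
      s.DoesNotFork (n₁.tp h₁.emb (hle₁.cod.subset hb)) (Emb.emb hle₁.dom).toHom.range ∧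
      s.DoesNotFork (n₂.tp h₂.emb (hle₂.cod.subset hb)) (Emb.emb hle₂.dom).toHom.range ∧
      EmbNode.Incompatible s.K n n₁ n₂ := by
  obtain ⟨hC, hj, hjs, D, _, F, _, fBD, fCD, fBF, fCF, hfD, hfF, hD, hF, ⟨hBD, -, hDeq⟩,
    ⟨hBF, -, hFeq⟩, hne, hty, hnf⟩ := hW
  let e := hn.emb.emb.equivRange
  obtain ⟨A, φ, hA, hAc, hφ⟩ := exists_concrete_ext_card hU (j.comp e.toEmbedding)
    (hj.comp (isEmb_equiv e hn.dom.1)) hC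
  have hφs := isEmb_equiv φ.symm hAc.1
  have hφe : ∀ x, φ.symm (Emb.emb hA x) = j (e x) := by
    intro x
    apply φ.injective
    rw [FirstOrder.Language.Equiv.apply_symm_apply]
    exact Subtype.ext (by rw [Le.emb_apply]; exact (hφ x).symm)
  obtain ⟨B₁, j₁, hm₁, hle₁, ψ₁, hψ₁, hk₁, ht₁⟩ := exists_node_of_amalgamation hU hn hb hAc hA φ
    hBD hfD hD (fun x => by rw [hφe]; exact (hDeq _).symm) hφs
  obtain ⟨B₂, j₂, hm₂, hle₂, ψ₂, hψ₂, hk₂, ht₂⟩ := exists_node_of_amalgamation hU hn hb hAc hA φ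
    hBF hfF hF (fun x => by rw [hφe]; exact (hFeq _).symm) hφs
  have hnf' : s.DoesNotFork (restrictEmb φ.symm.toEmbedding hφs
      (tpEmb fCD hfD (fBD ⟨b, hb⟩))) (Emb.emb hA).toHom.range := by
    refine hnf.transfer φ.symm hφs fun x => ?_
    simp only [FirstOrder.Language.Hom.mem_range]
    constructor
    · rintro ⟨y, rfl⟩
      exact ⟨e y, (hφe y).symm⟩
    · rintro ⟨y, hy⟩
      obtain ⟨z, rfl⟩ := e.surjective y
      exact ⟨z, φ.symm.injective ((hφe z).trans hy)⟩
  refine ⟨A, ⟨A, B₁, j₁⟩, ⟨A, B₂, j₂⟩, hm₁, hm₂, hle₁, hle₂, rfl, rfl, ?_, ht₁ ▸ hnf', ?_, ?_⟩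
  · intro hsub
    refine hjs fun c => ⟨e ⟨φ c, hsub (φ c).2⟩, ?_⟩
    rw [← hφe]
    apply φ.injective
    rw [FirstOrder.Language.Equiv.apply_symm_apply]
    exact Subtype.ext (Le.emb_apply hA _)
  · rw [ht₂, ← hty]
    exact hnf'
  -- Compatible maps into `G` would make the two amalgamations equivalent.
  · intro G f₁ f₂ hf₁ hf₂ hcod hdom
    refine hne ⟨G.carrier, inferInstance, hf₁.emb.comp ψ₁.toEmbedding,
      hf₂.emb.comp ψ₂.toEmbedding, hf₁.isEmb.comp (isEmb_equiv ψ₁ hD.1),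
      hf₂.isEmb.comp (isEmb_equiv ψ₂ hF.1), fun x => Subtype.ext ?_, fun c => Subtype.ext ?_⟩
    · change (hf₁.emb (ψ₁ (fBD x)) : U) = hf₂.emb (ψ₂ (fBF x))
      rw [hf₁.emb_apply, hf₂.emb_apply, hψ₁, hψ₂]
      exact hcod x x.2
    · change (hf₁.emb (ψ₁ (fCD c)) : U) = hf₂.emb (ψ₂ (fCF c))
      rw [hf₁.emb_apply, hf₂.emb_apply, hk₁, hk₂]
      exact hdom _ (φ c).2

/-- Nonforking extensions of a type with unique nonforking extensions are determined by their
domain. -/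
theorem UniqueExt.tp_eq {n₀ : EmbNode L U} (hn₀ : EmbNode.Good s.K lam n₀) {b : U}
    {hb : b ∈ n₀.cod.carrier} (hu : s.UniqueExt hn₀.emb.emb hn₀.emb.isEmb ⟨b, hb⟩)
    {A B B' : CModel L U} {j j' : U → U} (hn : EmbNode.Good s.K lam ⟨A, B, j⟩)
    (hm : EmbNode.Good s.K lam ⟨A, B', j'⟩) (hle : EmbNode.Le s.K n₀ ⟨A, B, j⟩)
    (hle' : EmbNode.Le s.K n₀ ⟨A, B', j'⟩) (hnf : s.NodeNF n₀.dom b ⟨A, B, j⟩)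
    (hnf' : s.NodeNF n₀.dom b ⟨A, B', j'⟩) (h₁ : b ∈ B.carrier) (h₂ : b ∈ B'.carrier) :
    EmbNode.tp ⟨A, B, j⟩ hn.emb h₁ = EmbNode.tp ⟨A, B', j'⟩ hm.emb h₂ := by
  obtain ⟨_, _, _, h⟩ := hnf
  obtain ⟨_, _, _, h'⟩ := hnf'
  exact hu A.carrier (Emb.emb hle.dom) (Emb.isEmb hle.dom) hn.dom _ _ h h'
    (hle.restrict_tp hn₀.emb hn.emb hb) (hle'.restrict_tp hn₀.emb hm.emb hb)

/-- Extending a node over the domain of an extension of another node. -/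
theorem UniqueExt.exists_extension [Infinite U] (hU : lam < #U) (hAP : s.K.Amalgamation lam)
    (hT : s.Transitivity) {n₀ n n' m : EmbNode L U} (hn₀ : EmbNode.Good s.K lam n₀) {b : U}
    {hb : b ∈ n₀.cod.carrier} (hu : s.UniqueExt hn₀.emb.emb hn₀.emb.isEmb ⟨b, hb⟩)
    (hn : EmbNode.Good s.K lam n) (hm : EmbNode.Good s.K lam m) (hdom : m.dom = n.dom)
    (hle : EmbNode.Le s.K n₀ n) (hlem : EmbNode.Le s.K n₀ m) (hnf : s.NodeNF n₀.dom b n)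
    (hnfm : s.NodeNF n₀.dom b m) (hn' : EmbNode.Good s.K lam n') (hnn' : EmbNode.Le s.K n n')
    (h' : s.DoesNotFork (n'.tp hn'.emb (hnn'.cod.subset (hle.cod.subset hb)))
      (Emb.emb hnn'.dom).toHom.range) :
    ∃ m' : EmbNode L U, m'.dom = n'.dom ∧ EmbNode.Good s.K lam m' ∧ EmbNode.Le s.K m m' ∧
      s.NodeNF n₀.dom b m' := by
  obtain ⟨A, B, j⟩ := n
  obtain ⟨A', B', j'⟩ := m
  obtain rfl : A' = A := hdom
  -- By uniqueness `b` has the same type over the common domain in both nodes. Hence the type of `b`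
  -- over the domain of `n'` also extends its type in `m`, and can be realized above `m`.
  have heq := hu.tp_eq hn₀ hn hm hle hlem hnf hnfm (hle.cod.subset hb) (hlem.cod.subset hb)
  obtain ⟨E, i, hg, hle'', ht⟩ := EmbNode.exists_realizing hU s.lst_le hAP hm
    (hlem.cod.subset hb) hn'.dom hnn'.dom
    (n'.tp hn'.emb (hnn'.cod.subset (hle.cod.subset hb)))
    ((hnn'.restrict_tp hn.emb hn'.emb (hle.cod.subset hb)).trans heq)
  exact ⟨⟨n'.dom, E, i⟩, rfl, hg, hle'', hnfm.trans hT hn₀.dom hm hg hle'' _ (ht ▸ h')⟩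

/-- If no node above `n₀` determines a uniqueness triple, there is a binary tree of nodes such
that the successors of a prescribed node on each level are incompatible. -/
theorem exists_incompatible_tree [Infinite U] (hinf : ℵ₀ ≤ lam) (hU : lam < #U)
    (hAP : s.K.Amalgamation lam) (hT : s.Transitivity) (hC : s.Continuity)
    {n₀ : EmbNode L U} (hn₀ : EmbNode.Good s.K lam n₀) {b : U} (hnf₀ : s.NodeNF n₀.dom b n₀)
    (hb : b ∈ n₀.cod.carrier) (hu : s.UniqueExt hn₀.emb.emb hn₀.emb.isEmb ⟨b, hb⟩)
    (hbad : ∀ n : EmbNode L U, ∀ hn : EmbNode.Good s.K lam n, EmbNode.Le s.K n₀ n →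
      s.NodeNF n₀.dom b n → ∀ hb : b ∈ n.cod.carrier,
        ∃ (C : Type u) (_ : L.Structure C) (j : hn.emb.emb.toHom.range ↪[L] C),
          s.WitnessesNonuniqueness _ ⟨b, hb⟩ j)
    (w : Ordinal.{u} → Ordinal.{u} → Bool) :
    ∃ F : Ordinal.{u} → (Ordinal.{u} → Bool) → EmbNode L U,
      (∀ α < (Order.succ lam).ord, ∀ η, F α η = F α (trunc α η)) ∧
      (∀ η, EmbNode.IsChain s.K (Order.succ lam).ord fun α => F α η) ∧
      (∀ α < (Order.succ lam).ord, ∀ η, EmbNode.Good s.K lam (F α η)) ∧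
      (∀ α < (Order.succ lam).ord, ∀ η ν, (F α η).dom = (F α ν).dom) ∧
      (∀ α, α + 1 < (Order.succ lam).ord → ∀ η,
        ¬ (F (α + 1) η).dom.carrier ⊆ (F α η).dom.carrier) ∧
      ∀ α, α + 1 < (Order.succ lam).ord → ∀ η ν, trunc α η = trunc α (w α) →
        trunc α ν = trunc α (w α) → η α = false → ν α = true →
          EmbNode.Incompatible s.K (F α (w α)) (F (α + 1) η) (F (α + 1) ν) := by
  have hlim := Cardinal.isSuccLimit_ord (hinf.trans (Order.le_succ lam))
  let I : EmbNode L U → Prop := fun n => (EmbNode.Good s.K lam n ∧ EmbNode.Le s.K n₀ n) ∧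
    s.NodeNF n₀.dom b n
  have H := Ordinal.exists_continuous_chain (Order.succ lam).ord
    (fun (x y : (Ordinal.{u} → Bool) → EmbNode L U) => ∀ η, EmbNode.Le s.K (x η) (y η))
    EmbNode.familySupp (fun α x => (∀ η, x η = x (trunc α η)) ∧ (∀ η, I (x η)) ∧
      ∀ η ν, (x η).dom = (x ν).dom)
    (fun α x y => (∀ η, ¬ (y η).dom.carrier ⊆ (x η).dom.carrier) ∧
      ∀ η ν, trunc α η = trunc α (w α) → trunc α ν = trunc α (w α) → η α = false → ν α = true →
        EmbNode.Incompatible s.K (x (w α)) (y η) (y ν)) (fun _ => n₀)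
    (fun _ x hx η => (hx.2.1 η).1.1.le_refl) (fun x y z h h' η => (h η).trans (h' η))
    ⟨fun _ => rfl, fun _ => ⟨⟨hn₀, hn₀.le_refl⟩, hnf₀⟩, fun _ _ => rfl⟩ ?_ ?_
  · obtain ⟨F, -, h1, h2, h3, h4⟩ := H
    have h1' := h1 hlim.bot_lt
    exact ⟨F, fun α hα => (h1' α hα).1, fun η => ⟨fun α β h hβ => h2 α β h hβ η,
      fun γ hγ hlimγ => EmbNode.familySupp_subset_iff.1 (h3 γ hγ hlimγ) η⟩,
      fun α hα η => ((h1' α hα).2.1 η).1.1, fun α hα => (h1' α hα).2.2,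
      fun α hα => (h4 α hα).1, fun α hα => (h4 α hα).2⟩
  · rintro α hα x ⟨hxt, hxI, hxd⟩
    -- Only the prescribed node is split. Its successors fix the new common domain `A`, to which
    -- every other node is then extended.
    obtain ⟨⟨hg, hle⟩, hnf⟩ := hxI (w α)
    obtain ⟨C, _, j, hW⟩ := hbad _ hg hle hnf (hle.cod.subset hb)
    obtain ⟨A, n, m, hn, hm, hlen, hlem, hnA, hmA, hsub, hnfn, hnfm, hinc⟩ :=
      exists_incompatible hU hg _ hW
    have hstep : ∀ η, ∃ y : EmbNode L U, y.dom = A ∧ EmbNode.Le s.K (x η) y ∧ I y := by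
      intro η
      obtain ⟨⟨hgη, hleη⟩, hnfη⟩ := hxI η
      obtain ⟨y, hyd, hy, hyle, hynf⟩ := hu.exists_extension hU hAP hT hn₀ hg hgη (hxd _ _) hle
        hleη hnf hnfη hn hlen hnfn
      exact ⟨y, hyd.trans hnA, hyle, ⟨hy, hleη.trans hyle⟩, hynf⟩
    choose y hyd hyle hyI using hstep
    classical
    -- At any other node the two successors coincide.
    let z : (Ordinal.{u} → Bool) → EmbNode L U := fun η =>
      if trunc α η = trunc α (w α) then if η α = true then m else n else y (trunc α η)
    have hz : ∀ η, (z η).dom = A ∧ EmbNode.Le s.K (x η) (z η) ∧ I (z η) := by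
      intro η
      by_cases h : trunc α η = trunc α (w α)
      · have hxw : x η = x (w α) := by rw [hxt η, h, ← hxt]
        by_cases hηα : η α = true
        · have : z η = m := by simp only [z, if_pos h, if_pos hηα]
          rw [this, hxw]
          exact ⟨hmA, hlem, ⟨hm, hle.trans hlem⟩, hnf.trans hT hn₀.dom hg hm hlem _ hnfm⟩
        · have : z η = n := by simp only [z, if_pos h, if_neg hηα]
          rw [this, hxw]
          exact ⟨hnA, hlen, ⟨hn, hle.trans hlen⟩, hnf.trans hT hn₀.dom hg hn hlen _ hnfn⟩
      · have : z η = y (trunc α η) := by simp only [z, if_neg h]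
        rw [this, hxt η]
        exact ⟨hyd _, hyle _, hyI _⟩
    refine ⟨z, fun η => (hz η).2.1, ⟨fun η => ?_, fun η => (hz η).2.2, fun η ν => ?_⟩, ?_, ?_⟩
    · dsimp only [z]
      rw [trunc_apply_of_lt (show α < α + 1 from Order.lt_succ α),
        trunc_trunc_of_le (show α ≤ α + 1 from Order.le_succ α)]
    · rw [(hz η).1, (hz ν).1]
    · intro η
      rw [(hz η).1, hxd η (w α)]
      exact hsub
    · intro η ν h h' hη hν
      have h1 : z η = n := by simp [z, h, hη]
      have h2 : z ν = m := by simp [z, h', hν]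
      rw [h1, h2]
      exact hinc
  · intro δ hδ hδlim F hF hle hsupp hF0
    have hch : ∀ η, EmbNode.IsChain s.K δ fun α => F α η := fun η =>
      ⟨fun α β h hβ => hle α β h hβ η,
        fun γ hγ hlimγ => EmbNode.familySupp_subset_iff.1 (hsupp γ hγ hlimγ) η⟩
    -- Domains agree on each level, so the union along one branch serves as the limit domain of all
    -- branches.
    obtain ⟨A, hA₀⟩ := (hch fun _ => false).dom.exists_isUnionOf hδlim.bot_lt
    have hex : ∀ η, ∃ n : EmbNode L U, I n ∧ (∀ α < δ, EmbNode.Le s.K (F α η) n) ∧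
        n.supp ⊆ ⋃ α < δ, (F α η).supp ∧ n.dom = A := by
      intro η
      have hA : IsUnionOf s.K δ (fun α => (F α η).dom) A := by
        refine ⟨fun x hx => ?_, fun α hα => ?_⟩
        · obtain ⟨α, hα, h⟩ := hA₀.exists_mem hx
          exact Set.mem_iUnion₂.2 ⟨α, hα, (hF α hα).2.2 _ η ▸ h⟩
        · rw [(hF α hα).2.2 η fun _ => false]
          exact hA₀.le α hα
      obtain ⟨n, rfl, hn, hnle, -, hns⟩ := (hch η).exists_union hδlim.bot_lt hinf
        (Order.lt_succ_iff.1 (Cardinal.lt_ord.1 hδ)) (fun α hα => ((hF α hα).2.1 η).1.1) hA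
      have h0 : F 0 η = n₀ := congrFun hF0 η
      refine ⟨n, ⟨⟨hn, h0 ▸ hnle 0 hδlim.bot_lt⟩, ?_⟩, hnle, hns, rfl⟩
      have := NodeNF.limit hC hδlim hδ (hch η) (fun α hα => ((hF α hα).2.1 η).1.1)
        (b := b) (fun α hα => by
          rw [h0]
          exact ((hF α hα).2.1 η).2) hn hA hnle
      rwa [h0] at this
    choose z hzI hzle hzs hzd using hex
    have hFt : ∀ α < δ, ∀ η, F α (trunc δ η) = F α η := by
      intro α hα η
      rw [(hF α hα).1 η, (hF α hα).1 (trunc δ η), trunc_trunc_of_le hα.le]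
    refine ⟨fun η => z (trunc δ η), ⟨fun η => ?_, fun η => hzI _, fun η ν => ?_⟩,
      fun α hα η => ?_, ?_⟩
    · dsimp only
      rw [trunc_trunc_of_le le_rfl]
    · rw [hzd, hzd]
    · rw [← hFt α hα η]
      exact hzle _ α hα
    · rw [EmbNode.familySupp_subset_iff]
      intro η t ht
      obtain ⟨α, hα, h⟩ := Set.mem_iUnion₂.1 (hzs _ ht)
      exact Set.mem_iUnion₂.2 ⟨α, hα, hFt α hα η ▸ h⟩

end PreFrame

/-! ### The diamond argument -/

namespace PreFrame

open CModel AEC Ordinal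

variable {L : FirstOrder.Language.{u, u}} {lam : Cardinal.{u}} {s : PreFrame L lam} {U : Type u}

/-- A branch of the tree embeds in a universal extension of the union of the domains. -/
theorem exists_emb_of_branch (hinf : ℵ₀ ≤ lam) (hU : #U = Order.succ lam)
    {G : Ordinal.{u} → EmbNode L U} (hG : EmbNode.IsChain s.K (Order.succ lam).ord G)
    (hgood : ∀ α < (Order.succ lam).ord, EmbNode.Good s.K lam (G α)) {A N : CModel L U}
    {k : U → U} (hA : IsUnionOf s.K (Order.succ lam).ord (fun α => (G α).dom) A)
    (hAc : s.K.MemCard (Order.succ lam) A.carrier)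
    (huniv : ∀ (M : Type u) [L.Structure M] (f : A.carrier ↪[L] M),
      s.K.MemCard (Order.succ lam) M → s.K.IsEmb f →
        ∃ g : M ↪[L] N.carrier, s.K.IsEmb g ∧ ∀ x, (g (f x) : U) = k x) [Nonempty U] :
    ∃ f : U → U, ∀ α < (Order.succ lam).ord, Emb s.K (G α).cod N f ∧
      ∀ x ∈ (G α).dom.carrier, f ((G α).map x) = k x := by
  have hlim := Cardinal.isSuccLimit_ord (hinf.trans (Order.le_succ lam))
  obtain ⟨B, hB⟩ := hG.cod.exists_isUnionOf hlim.bot_lt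
  obtain ⟨j, hj, hjx⟩ := hG.exists_map hlim.bot_lt (fun α hα => (hgood α hα).emb) hA hB
  have hBc : s.K.MemCard (Order.succ lam) B.carrier := by
    refine ⟨hj.mem_right, le_antisymm ((Cardinal.mk_set_le _).trans hU.le) ?_⟩
    rw [← hAc.2]
    exact Cardinal.mk_le_of_injective hj.emb.injective
  obtain ⟨g, hg, hgx⟩ := huniv B.carrier hj.emb hBc hj.isEmb
  obtain ⟨f, hf, hfx⟩ := exists_emb_map g hg
  refine ⟨f, fun α hα => ⟨hf.of_le (hB.le α hα), fun x hx => ?_⟩⟩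
  have hxA := (hA.le α hα).subset hx
  have h1 := hgx ⟨x, hxA⟩
  rw [← hfx, hj.emb_apply] at h1
  rw [← hjx α hα x hx]
  exact h1

/-- A type with unique nonforking extensions has a nonforking extension realized in a
uniqueness triple. -/
theorem exists_not_witnessesNonuniqueness (hinf : ℵ₀ ≤ lam) (hd : Diamond (Order.succ lam))
    (hAP : s.K.Amalgamation lam) (hT : s.Transitivity) (hC : s.Continuity)
    (hAP' : s.K.Amalgamation (Order.succ lam)) (hst : s.K.Stable (Order.succ lam))
    {A₀ B₀ : Type u} [L.Structure A₀] [L.Structure B₀] {i : A₀ ↪[L] B₀} {hi : s.K.IsEmb i}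
    {b : B₀} (hA₀ : s.K.MemCard lam A₀) (hB₀ : s.K.MemCard lam B₀)
    (hnf : s.DoesNotFork (tpEmb i hi b) ⊤) (hu : s.UniqueExt i hi b) :
    ∃ (A₁ B₁ : Type u) (_ : L.Structure A₁) (_ : L.Structure B₁) (e : A₀ ↪[L] A₁)
      (f : B₀ ↪[L] B₁) (i₁ : A₁ ↪[L] B₁) (_ : s.K.IsEmb e) (_ : s.K.IsEmb f)
      (hi₁ : s.K.IsEmb i₁), s.K.MemCard lam A₁ ∧ s.K.MemCard lam B₁ ∧
      (∀ a, i₁ (e a) = f (i a)) ∧ s.DoesNotFork (tpEmb i₁ hi₁ (f b)) e.toHom.range ∧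
      ¬ ∃ (C : Type u) (_ : L.Structure C) (j : i₁.toHom.range ↪[L] C),
        s.WitnessesNonuniqueness _ (f b) j := by
  by_contra hcon
  have hinf' : ℵ₀ ≤ Order.succ lam := hinf.trans (Order.le_succ lam)
  have hreg := Cardinal.isRegular_succ hinf
  have hlim := Cardinal.isSuccLimit_ord hinf'
  -- The elements of `U` are the ordinals below λ⁺, so a map U → U is a sequence of length λ⁺. The
  -- guess `g δ α` in `Bool × U` thus predicts a branch and an embedding simultaneously.
  let U : Type u := (Order.succ lam).ord.ToType
  have hU : #U = Order.succ lam := by simp [U]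
  have hU' : lam < #U := hU ▸ Order.lt_succ lam
  have : Infinite U := Cardinal.infinite_iff.2 (hinf.trans hU'.le)
  obtain ⟨A, ⟨ψ⟩⟩ := CModel.exists_concrete (L := L) (U := U) (X := A₀) (hA₀.2.le.trans hU'.le)
  obtain ⟨B, j, χ, hn₀, hnf₀, hψχ⟩ := exists_node hU' hA₀ hB₀ hnf ψ
  let n₀ : EmbNode L U := ⟨A, B, j⟩
  have hu₀ : s.UniqueExt hn₀.emb.emb hn₀.emb.isEmb ⟨χ b, (χ b).2⟩ :=
    hu.of_equiv ψ χ hn₀.emb.isEmb fun a => Subtype.ext (by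
      rw [hn₀.emb.emb_apply]
      exact (hψχ a).symm)
  obtain ⟨g, hg⟩ := hd.exists_guess hreg (hinf.trans_lt (Order.lt_succ lam)) (T := Bool × U) (by
    rw [Cardinal.mk_prod, Cardinal.lift_uzero, Cardinal.mk_bool, Cardinal.lift_ofNat, hU]
    exact Cardinal.mul_le_of_le hinf' ((Cardinal.natCast_lt_aleph0 (n := 2)).le.trans hinf') le_rfl)
  obtain ⟨F, hFt, hFch, hFg, hFd, hFs, hFinc⟩ := exists_incompatible_tree hinf hU' hAP hT hC
    (n₀ := n₀) hn₀ hnf₀ (χ b).2 hu₀ (by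
      intro n hn hle hnfn hb
      by_contra hno
      obtain ⟨h1, h2⟩ := NodeNF.doesNotFork (n₀ := n₀) ψ χ hψχ hn hle hnfn
      refine hcon ⟨n.dom.carrier, n.cod.carrier, inferInstance, inferInstance,
        (Emb.emb hle.dom).comp ψ.toEmbedding, (Emb.emb hle.cod).comp χ.toEmbedding, hn.emb.emb,
        (Emb.isEmb hle.dom).comp (isEmb_equiv ψ hA₀.1),
        (Emb.isEmb hle.cod).comp (isEmb_equiv χ hB₀.1), hn.emb.isEmb, hn.dom, hn.cod, h1, h2, ?_⟩
      have hbb : (Emb.emb hle.cod).comp χ.toEmbedding b = ⟨(χ b : U), hb⟩ :=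
        Subtype.ext (Le.emb_apply hle.cod _)
      rw [hbb]
      exact hno) (fun δ α => (g δ α).1)
  let w : Ordinal.{u} → Ordinal.{u} → Bool := fun δ α => (g δ α).1
  let o : Ordinal.{u} → Bool := fun _ => false
  obtain ⟨A', hA'⟩ := (hFch o).dom.exists_isUnionOf hlim.bot_lt
  have hA'c : s.K.MemCard (Order.succ lam) A'.carrier :=
    hA'.memCard_succ hinf (fun α hα => (hFg α hα o).dom.2.le)
      (fun α β h hβ => ((hFch o).le α β h hβ).dom.subset)
      (fun α hα => hFs α (hlim.succ_lt hα) o)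
  have hA'η : ∀ η, IsUnionOf s.K (Order.succ lam).ord (fun α => (F α η).dom) A' := by
    intro η
    refine ⟨fun x hx => ?_, fun α hα => ?_⟩
    · obtain ⟨α, hα, h⟩ := hA'.exists_mem hx
      exact Set.mem_iUnion₂.2 ⟨α, hα, hFd α hα o η ▸ h⟩
    · rw [hFd α hα η o]
      exact hA'.le α hα
  -- All branches have the same union `A'` of domains, so one universal extension of `A'` receives
  -- all of them, each map extending `k`.
  obtain ⟨N₀, _, k₀, hN₀, hk₀, huniv₀⟩ := exists_universal hinf'
    (s.lst_le.trans (Order.le_succ lam)) hAP' hst A'.carrier hA'c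
  obtain ⟨N, ⟨θ⟩⟩ := CModel.exists_concrete (L := L) (U := U) (X := N₀) (hN₀.2.le.trans hU.ge)
  have hθ := isEmb_equiv θ hN₀.1
  obtain ⟨k, hk, hkx⟩ := exists_emb_map (θ.toEmbedding.comp k₀) (hθ.comp hk₀)
  have hbranch : ∀ η, ∃ f : U → U, ∀ α < (Order.succ lam).ord, Emb s.K (F α η).cod N f ∧
      ∀ x ∈ (F α η).dom.carrier, f ((F α η).map x) = k x := by
    intro η
    refine exists_emb_of_branch hinf hU (hFch η) (fun α hα => hFg α hα η) (hA'η η) hA'c ?_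
    intro M _ f hM hf
    obtain ⟨g, hg, hgf⟩ := huniv₀ M f hM hf
    refine ⟨θ.toEmbedding.comp g, hθ.comp hg, fun x => ?_⟩
    rw [hkx]
    exact congrArg (fun y => (θ y : U)) (hgf x)
  let code : U → Ordinal.{u} := fun x => Ordinal.ToType.mk.symm x
  have hcode : ∀ x, code x < (Order.succ lam).ord := fun x => (Ordinal.ToType.mk.symm x).2
  classical
  let φ : Ordinal.{u} → U → U := fun δ x => (g δ (code x)).2
  -- `P δ` asks whether the left successor of the guessed node embeds in `N` compatibly with the
  -- guessed map `φ δ` and with `k`. It refers only to the guess and the tree, so the branch `η` can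
  -- be defined outright and its embedding `f` chosen afterwards.
  let P : Ordinal.{u} → Prop := fun δ => ∃ f' : U → U,
    Emb s.K (F (δ + 1) (trunc δ (w δ))).cod N f' ∧
      (∀ x ∈ (F δ (w δ)).cod.carrier, f' x = φ δ x) ∧
      ∀ x ∈ (F (δ + 1) (trunc δ (w δ))).dom.carrier,
        f' ((F (δ + 1) (trunc δ (w δ))).map x) = k x
  let η : Ordinal.{u} → Bool := fun δ => decide (P δ)
  obtain ⟨f, hf⟩ := hbranch η
  let dec : Ordinal.{u} → U := fun α =>
    if h : α < (Order.succ lam).ord then Ordinal.ToType.mk ⟨α, h⟩ else Classical.arbitrary U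
  have hdec : ∀ x, dec (code x) = x := by
    intro x
    simp only [dec, dif_pos (hcode x)]
    exact Ordinal.ToType.mk.apply_symm_apply x
  -- If δ is a limit closed under these bounds, the model at level δ of the branch consists of
  -- ordinals below δ, so a correct guess of `f ↾ δ` determines `f` on all of it.
  have hbound : ∀ α < (Order.succ lam).ord, ∃ c < (Order.succ lam).ord,
      ∀ x ∈ (F α η).cod.carrier, code x < c := by
    intro α hα
    obtain ⟨c, hc, h⟩ := Ordinal.exists_stage hinf (X := (F α η).cod.carrier)
      (hFg α hα η).cod.2.le (fun x => (x : U)) (S := fun β => {x | code x < β})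
      (fun β γ hβγ _ x hx => show code x < γ from lt_of_lt_of_le (show code x < β from hx) hβγ)
      (fun x => ⟨Order.succ (code x), hlim.succ_lt (hcode x),
        show code x < Order.succ (code x) from Order.lt_succ _⟩)
    exact ⟨c, hc, fun x hx => h ⟨x, hx⟩⟩
  choose! c hc hcx using hbound
  obtain ⟨δ, hδ, hδlim, hcδ, hgδ⟩ := hg (fun α => (η α, f (dec α))) c hc
  have hδ1 : δ + 1 < (Order.succ lam).ord := hlim.succ_lt hδ
  have hw : trunc δ (w δ) = trunc δ η := trunc_congr fun α hα => congrArg Prod.fst (hgδ α hα)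
  have hFδ : F δ (w δ) = F δ η := by rw [hFt δ hδ, hw, ← hFt δ hδ]
  have hφ : ∀ x ∈ (F δ (w δ)).cod.carrier, f x = φ δ x := by
    intro x hx
    rw [hFδ] at hx
    obtain ⟨α, hα, hxα⟩ := ((hFch η).cod.isUnionOf hδ hδlim).exists_mem hx
    have hlt : code x < δ := (hcx α (hα.trans hδ) x hxα).trans (hcδ α hα)
    have := congrArg Prod.snd (hgδ _ hlt)
    rw [hdec] at this
    exact this.symm
  -- If `P δ` holds, `η` turns right, and `f'` on the left successor together with `f` on the right
  -- one contradicts incompatibility. If it fails, `η` turns left, and `f` itself witnesses `P δ`.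
  by_cases hP : P δ
  · obtain ⟨f', hf', hφ', hk'⟩ := id hP
    refine hFinc δ hδ1 (trunc δ (w δ)) η (trunc_trunc_of_le le_rfl _) hw.symm
      (trunc_apply_self _ _) (decide_eq_true hP) N f' f hf' (hf (δ + 1) hδ1).1
      (fun x hx => (hφ' x hx).trans (hφ x hx).symm) fun x hx => ?_
    rw [hk' x hx, (hf (δ + 1) hδ1).2 x (hFd (δ + 1) hδ1 _ η ▸ hx)]
  · have hηδ : η δ = false := decide_eq_false hP
    have h1 : trunc (δ + 1) η = trunc (δ + 1) (trunc δ (w δ)) := by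
      refine trunc_congr fun β hβ => ?_
      rcases (Order.lt_succ_iff.1 hβ).lt_or_eq with h | rfl
      · rw [hw, trunc_apply_of_lt h]
      · rw [trunc_apply_self, hηδ]
    have h2 : F (δ + 1) (trunc δ (w δ)) = F (δ + 1) η := by
      rw [hFt (δ + 1) hδ1, ← h1, ← hFt (δ + 1) hδ1]
    refine hP ⟨f, ?_, hφ, ?_⟩
    · rw [h2]
      exact (hf (δ + 1) hδ1).1
    · rw [h2]
      exact (hf (δ + 1) hδ1).2

end PreFrame

/-! ### Composition of the two stages -/

theorem theorem11p2 {L : FirstOrder.Language.{u, u}} (lam : Cardinal.{u}) (hlam : ℵ₀ ≤ lam)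
    (hdiamond : Diamond (Order.succ lam))
    (s : PreFrame L lam)
    (hAP : s.K.Amalgamation lam) (hNoMax : s.K.NoMaximalModel lam)
    (hDensity : s.Density) (hTransitivity : s.Transitivity)
    (hExistence : s.Existence) (hContinuity : s.Continuity)
    (hAP_succ : s.K.Amalgamation (Order.succ lam)) (hStable_succ : s.K.Stable (Order.succ lam)) :
    ∀ (B : Type u) [L.Structure B] (A : L.Substructure B) (b : B), s.IsBasicTriple A b →
      ∃ (D : Type u) (_ : L.Structure D) (C : L.Substructure D) (h : B ↪[L] D),
        s.IsUniquenessTriple C (h b) ∧ s.LeBs h A b C (h b) := by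
  rintro B _ A b ⟨hA, hB, -, hAB, hbs⟩
  obtain ⟨A₁, B₁, _, _, e, f, i₁, he, hf, hi₁, hA₁, hB₁, hcomm, hnf₁, hu⟩ :=
    PreFrame.exists_uniqueExt hlam hAP hNoMax hTransitivity hContinuity hAP_succ hStable_succ
      A.subtype (AEC.isEmb_subtype hAB) b hA hB (hExistence A hA _ hbs)
  obtain ⟨A₂, B₂, _, _, e₂, f₂, i₂, he₂, hf₂, hi₂, hA₂, hB₂, hcomm₂, hnf₂, hno⟩ :=
    PreFrame.exists_not_witnessesNonuniqueness hlam hdiamond hAP hTransitivity hContinuity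
      hAP_succ hStable_succ hA₁ hB₁ (hExistence A₁ hA₁ _ hnf₁.mem_bs) hu
  have hr : AEC.restrictEmb e₂ he₂ (AEC.tpEmb i₂ hi₂ (f₂ (f b))) = AEC.tpEmb i₁ hi₁ (f b) :=
    (AEC.tpEmb_eq_of_comp f₂ hf₂ (fun a => (hcomm₂ a).symm) rfl).symm
  -- The second extension does not fork over `A₁`, and its restriction to `A₁` does not fork over
  -- `A`.
  have hnf := PreFrame.Transitivity.trans hTransitivity hA hA₁ hA₂ e he e₂ he₂ hnf₂
    (hr.symm ▸ hnf₁)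
  have hcomp : ∀ a : A, i₂ ((e₂.comp e) a) = (f₂.comp f) a := fun a =>
    (hcomm₂ (e a)).trans (congrArg f₂ (hcomm a))
  -- Triples are stated for substructures, so `A₂` is replaced by its image in `B₂`.
  let r := i₂.equivRange
  have hrange := hA₂.of_equiv r
  have hrs := AEC.isEmb_equiv r.symm hrange.1
  have htp : AEC.restrictEmb r.symm.toEmbedding hrs (AEC.tpEmb i₂ hi₂ (f₂ (f b))) =
      AEC.tp i₂.toHom.range hi₂ ((f₂.comp f) b) := by
    refine AEC.tpEmb_congr (fun x => ?_) rfl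
    obtain ⟨y, rfl⟩ := r.surjective x
    change i₂ (r.symm (r y)) = _
    rw [FirstOrder.Language.Equiv.symm_apply_apply]
    rfl
  have hmap : A.map (f₂.comp f).toHom = (i₂.comp (e₂.comp e)).toHom.range := by
    ext x
    simp only [FirstOrder.Language.Substructure.mem_map, FirstOrder.Language.Hom.mem_range]
    constructor
    · rintro ⟨y, hy, rfl⟩
      exact ⟨⟨y, hy⟩, hcomp ⟨y, hy⟩⟩
    · rintro ⟨y, rfl⟩
      exact ⟨y, y.2, (hcomp y).symm⟩
  have hnf' : s.DoesNotFork (AEC.tp i₂.toHom.range hi₂ ((f₂.comp f) b))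
      ((A.map (f₂.comp f).toHom).comap i₂.toHom.range.subtype.toHom) := by
    rw [← htp]
    refine hnf.transfer r.symm hrs fun x => ?_
    obtain ⟨y, rfl⟩ := r.surjective x
    rw [FirstOrder.Language.Equiv.symm_apply_apply, hmap]
    simp only [FirstOrder.Language.Substructure.mem_comap, FirstOrder.Language.Hom.mem_range]
    constructor
    · rintro ⟨a, ha⟩
      exact ⟨a, i₂.injective ha⟩
    · rintro ⟨a, ha⟩
      exact ⟨a, congrArg i₂ ha⟩
  refine ⟨B₂, inferInstance, i₂.toHom.range, f₂.comp f, ⟨⟨hrange, hB₂, ?_, hi₂, hnf'.mem_bs⟩, hno⟩,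
    hf₂.comp hf, ?_, rfl, hi₂, hnf'⟩
  · intro hmem
    obtain ⟨a, ha⟩ := hmem
    exact hnf₂.notMem_range ⟨a, ha⟩
  · rw [hmap]
    exact AEC.le_range (he₂.comp he) fun _ => rfl
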